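/- **Conventions.** All $2$-categories, $2$-functors, $2$-natural transformations and $2$-comonads are strict. $G\circ F$ denotes composition of $1$-morphisms; for a $2$-morphism $\varphi$ and $1$-morphisms $F,G$ of matching type, $G\varphi$ and $\varphi_F$ denote whiskering, and $T^n$ is the $n$-fold composite of an endomorphism $T$. In a $2$-category $\mathbf K$, a limit cone in a category $\mathbf K(X,Y)$ is *pointwise* if precomposition with every $1$-morphism $W\to X$ sends it to a limit cone in $\mathbf K(W,Y)$. A $2$-functor is *pointwise pullback-preserving* if it sends every pointwise pullback in every category $\mathrm{End}(X)=\mathbf K(X,X)$ to a pointwise pullback. $\mathsf{TwoCat}_{\mathrm{pp}}$ is the $2$-category of (small) $2$-categories, pointwise pullback-preserving $2$-functors and $2$-natural transformations. **Additive bundles.** An *additive bundle* in a category consists of $q:E\to B$ all of whose $n$-fold pullbacks $E_n$ ($n\ge 1$) along itself exist, and of maps $z:B\to E$, $s:E_2\to E$ over $B$ (where $E_2$, with projections $\pi_1,\pi_2$, is a pullback of $q$ along $q$), such that $s$ is associative, commutative and has unit $z$. A *morphism* $(f,g):(q,z,s)\to(q',z',s')$ consists of $f:B\to B'$ and $g:E\to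 E'$ with $q'g=fq$, $gz=z'f$ and $gs=s'g_2$ for a map $g_2:E_2\to E_2'$ with $\pi_i'g_2=g\pi_i$ $(i=1,2)$. **Tangentads.** A *tangentad* $(X,\mathbb T)$ in a $2$-category $\mathbf K$ consists of an object $X$, $1$-morphisms $T,T_2:X\to X$ and $2$-morphisms $\pi_1,\pi_2:T_2\Rightarrow T$, $p:T\Rightarrow\mathrm{id}_X$, $z:\mathrm{id}_X\Rightarrow T$, $s:T_2\Rightarrow T$, $l:T\Rightarrow T^2$, $c:T^2\Rightarrow T^2$ such that: 1. $(T_2,\pi_1,\pi_2)$ is a pointwise pullback of $p$ along itself, $p$ admits all pointwise $n$-fold pullbacks $T_n$ along itself $(n\ge1)$, and all of these are sent to pointwise limits by postcomposition with every $T^k$; 2. $\mathbf p=(p,z,s)$ is an additive bundle in $\mathrm{End}(X)$, and $(z,l):\mathbf p\to T\mathbf p$ and $(\mathrm{id}_T,c):T\mathbf p\to\mathbf p_T$ are additive bundle morphisms; 3. $l_T\,l=Tl\,l$, $\;cl=l$, $\;c_T\,Tc\,l_T=Tl\,c$, $\;c^2=\mathrm{id}$, $\;Tc\,c_T\,Tc=c_T\,Tc\,c_T$;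 4. the square with sides $Ts\circ v:T_2\Rightarrow T^2$, $\;p\pi_1:T_2\Rightarrow\mathrm{id}_X$, $\;Tp:T^2\Rightarrow T$, $\;z:\mathrm{id}_X\Rightarrow T$ is a pointwise pullback, where $v:T_2\Rightarrow T\circ T_2$ is given by $T\pi_1\,v=z_T\,\pi_1$ and $T\pi_2\,v=l\,\pi_2$. Let $c_2:T\circ T_2\Rightarrow T_2\circ T$ denote the $2$-morphism with $(\pi_i)_T\,c_2=c\,(T\pi_i)$, $i=1,2$. **The $2$-category $\mathsf{Tng}_{\mathrm{co}}(\mathbf K)$.** Its objects are the tangentads in $\mathbf K$. A $1$-morphism $(G,\beta):(X,\mathbb T)\to(X',\mathbb T')$ is a *colax tangent morphism*: a $1$-morphism $G:X\to X'$ and a $2$-morphism $\beta:T'\circ G\Rightarrow G\circ T$ such that * (additivity) there is $\beta_2:T_2'\circ G\Rightarrow G\circ T_2$ with $G\pi_i\,\beta_2=\beta\,(\pi_i')_G$ $(i=1,2)$, $\;Gp\,\beta=p'_G$, $\;\beta\,z'_G=Gz$, $\;\beta\,s'_G=Gs\,\beta_2$, and compatible with the flips, $\;Gc_2\,\beta_{T_2}\,T'\beta_2=(\beta_2)_T\,T_2'\beta\,(c_2')_G$;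 * $Gl\,\beta=\beta_T\,T'\beta\,l'_G$ and $Gc\,\beta_T\,T'\beta=\beta_T\,T'\beta\,c'_G$. (When $G\circ T_2$ is a pointwise pullback of $Gp$ along itself, $\beta_2$ is the induced map $\beta\times\beta$, and its compatibility with the flips is automatic.) A $2$-morphism $(F,\alpha)\Rightarrow(G,\beta)$ is a $2$-morphism $\varphi:F\Rightarrow G$ with $\varphi_T\,\alpha=\beta\,T'\varphi$. The composite of $(F,\alpha):(X,\mathbb T)\to(X',\mathbb T')$ and $(G,\beta):(X',\mathbb T')\to(X'',\mathbb T'')$ is $(G\circ F,\;G\alpha\,\beta_F)$; all other operations are those of $\mathbf K$. **Theorem.** There is a $2$-comonad on $\mathsf{TwoCat}_{\mathrm{pp}}$, i.e. a $2$-endofunctor $\mathsf{Tng}_{\mathrm{co}}$ of $\mathsf{TwoCat}_{\mathrm{pp}}$ with $2$-natural counit and comultiplication which satisfy the two counit laws and the coassociativity law strictly, such that: 1. On objects, it sends $\mathbf K$ to $\mathsf{Tng}_{\mathrm{co}}(\mathbf K)$. On a pointwise pullback-preserving $2$-functor $\Gamma:\mathbf K\to\mathbf K'$, it is the $2$-functor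 $\mathsf{Tng}_{\mathrm{co}}(\Gamma)$ that applies $\Gamma$ to all the data of tangentads, of colax tangent morphisms and of their $2$-morphisms; in particular, $\mathsf{Tng}_{\mathrm{co}}(\Gamma)$ is well defined and pointwise pullback-preserving. On a $2$-natural transformation $\varphi:\Gamma\Rightarrow\Gamma'$, it is the $2$-natural transformation whose component at $(X,\mathbb T)$ is the strict tangent morphism $(\varphi_X,\mathrm{id}):(\Gamma X,\Gamma\mathbb T)\to(\Gamma'X,\Gamma'\mathbb T)$. 2. The component of the counit at $\mathbf K$ is the forgetful $2$-functor $\mathsf U_{\mathrm{co}}:\mathsf{Tng}_{\mathrm{co}}(\mathbf K)\to\mathbf K$, $(X,\mathbb T)\mapsto X$, $(F,\alpha)\mapsto F$, $\varphi\mapsto\varphi$. 3. The component of the comultiplication at $\mathbf K$ is the $2$-functor $\Delta_{\mathrm{co}}:\mathsf{Tng}_{\mathrm{co}}(\mathbf K)\to\mathsf{Tng}_{\mathrm{co}}(\mathsf{Tng}_{\mathrm{co}}(\mathbf K))$ that sends $(X,\mathbb T)$ to $(X;\mathbb T,\mathbb T,c)$, i.e. to the tangentad in $\mathsf{Tng}_{\mathrm{co}}(\mathbf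 K)$ with base object $(X,\mathbb T)$, tangent bundle $1$-morphism $(T,c):(X,\mathbb T)\to(X,\mathbb T)$ and the same underlying $1$-morphism $T_2$ and structural $2$-morphisms $\pi_1,\pi_2,p,z,s,l,c$ as $\mathbb T$; that sends a $1$-morphism $(F,\alpha)$ to $((F,\alpha),\alpha)$; and that sends a $2$-morphism $\varphi$ to $\varphi$. -/

import Mathlib

universe w v u w' v' u' w'' v'' u''

open CategoryTheory CategoryTheory.Bicategory CategoryTheory.Limits

namespace FormalTangent

/-! ### Additive bundles in a category -/

section Bundles

variable {C : Type u} [Category.{v} C]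

/-- `P`, with legs `π i : P ⟶ E` and base map `b : P ⟶ B`, is the `n`-fold pullback of `q : E ⟶ B`
along itself. -/
structure IsNFoldPullback {n : ℕ} {P E B : C} (q : E ⟶ B) (b : P ⟶ B) (π : Fin n → (P ⟶ E)) :
    Prop where
  w : ∀ i, π i ≫ q = b
  isLimit : Nonempty (IsLimit (WidePullbackCone.mk (f := fun _ : Fin n => q) b π w))

/-- The data of an additive bundle `q : E ⟶ B`, including the choice of the object `E₂` (with its
two projections) on which the sum `s` is defined. -/
structure BundleData (C : Type u) [Category.{v} C] where
  B : C
  E : C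
  E₂ : C
  π₁ : E₂ ⟶ E
  π₂ : E₂ ⟶ E
  q : E ⟶ B
  z : B ⟶ E
  s : E₂ ⟶ E

/-- The image of the data of an additive bundle under a functor. -/
@[simps]
def BundleData.mapFunctor {D : Type u'} [Category.{v'} D] (b : BundleData C) (F : C ⥤ D) :
    BundleData D where
  B := F.obj b.B
  E := F.obj b.E
  E₂ := F.obj b.E₂
  π₁ := F.map b.π₁
  π₂ := F.map b.π₂
  q := F.map b.q
  z := F.map b.z
  s := F.map b.s

/-- The axioms of an additive bundle. -/
structure BundleData.IsAdditive (b : BundleData C) : Prop where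
  isPullback : IsPullback b.π₁ b.π₂ b.q b.q
  nfold : ∀ n : ℕ, 1 ≤ n → ∃ (P : C) (β : P ⟶ b.B) (π : Fin n → (P ⟶ b.E)),
    IsNFoldPullback b.q β π
  z_q : b.z ≫ b.q = 𝟙 b.B
  s_q : b.s ≫ b.q = b.π₁ ≫ b.q
  assoc : ∀ {W : C} (x y t : W ⟶ b.E) (hxy : x ≫ b.q = y ≫ b.q) (hyt : y ≫ b.q = t ≫ b.q),
    isPullback.lift (isPullback.lift x y hxy ≫ b.s) t (by simp [s_q, hxy, hyt]) ≫ b.s =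
      isPullback.lift x (isPullback.lift y t hyt ≫ b.s) (by simp [s_q, hxy]) ≫ b.s
  unit : isPullback.lift (b.q ≫ b.z) (𝟙 b.E) (by simp [z_q]) ≫ b.s = 𝟙 b.E
  comm : isPullback.lift b.π₂ b.π₁ isPullback.w.symm ≫ b.s = b.s

/-- `(f, g)` is compatible with the projections, the zeros and the sums of two bundles, where
`g₂ : E₂ ⟶ E₂'` plays the role of `g ×_f g`. -/
structure BundleData.IsMorphismVia (b b' : BundleData C) (f : b.B ⟶ b'.B) (g : b.E ⟶ b'.E)
    (g₂ : b.E₂ ⟶ b'.E₂) : Prop where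
  π₁ : g₂ ≫ b'.π₁ = b.π₁ ≫ g
  π₂ : g₂ ≫ b'.π₂ = b.π₂ ≫ g
  q : g ≫ b'.q = b.q ≫ f
  z : b.z ≫ g = f ≫ b'.z
  s : b.s ≫ g = g₂ ≫ b'.s

/-- Additive bundle morphisms. When the target is an additive bundle, the map `g₂` is unique:
it is `g ×_f g`. -/
def BundleData.IsMorphism (b b' : BundleData C) (f : b.B ⟶ b'.B) (g : b.E ⟶ b'.E) : Prop :=
  ∃ g₂ : b.E₂ ⟶ b'.E₂, b.IsMorphismVia b' f g g₂

end Bundles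

/-! ### Pointwise limits -/

section Pointwise

variable {K : Type u} [Bicategory.{w, v} K]

/-- A pullback square in `K(X, Y)` which is preserved by precomposition with every `1`-morphism. -/
def IsPointwisePullback {X Y : K} {P A B C : X ⟶ Y} (fst : P ⟶ A) (snd : P ⟶ B) (f : A ⟶ C)
    (g : B ⟶ C) : Prop :=
  IsPullback fst snd f g ∧
    ∀ {W : K} (h : W ⟶ X), IsPullback (h ◁ fst) (h ◁ snd) (h ◁ f) (h ◁ g)

/-- An `n`-fold pullback in `K(X, Y)` which is preserved by precomposition with every
`1`-morphism. -/
def IsPointwiseNFoldPullback {n : ℕ} {X Y : K} {P E B : X ⟶ Y} (q : E ⟶ B) (b : P ⟶ B)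
    (π : Fin n → (P ⟶ E)) : Prop :=
  IsNFoldPullback q b π ∧
    ∀ {W : K} (h : W ⟶ X), IsNFoldPullback (h ◁ q) (h ◁ b) (fun i => h ◁ π i)

/-- The iterates of a `1`-endomorphism. -/
def iterate {X : K} (T : X ⟶ X) : ℕ → (X ⟶ X)
  | 0 => 𝟙 X
  | k + 1 => iterate T k ≫ T

end Pointwise

/-! ### Tangentads

Composition is written diagrammatically: the composite `G ∘ F` is `F ≫ G`, the whiskering `G φ` is
`φ ▷ G` and the whiskering `φ F` (or `φ_F`) is `F ◁ φ`. -/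

section Tangentads

/-- The data of a tangent structure on an object of `K`. -/
structure TangentData (K : Type u) [Bicategory.{w, v} K] where
  base : K
  T : base ⟶ base
  T₂ : base ⟶ base
  π₁ : T₂ ⟶ T
  π₂ : T₂ ⟶ T
  p : T ⟶ 𝟙 base
  z : 𝟙 base ⟶ T
  s : T₂ ⟶ T
  l : T ⟶ T ≫ T
  c : T ≫ T ⟶ T ≫ T

variable {K : Type u} [Bicategory.{w, v} K]

/-- The bundle `p : T ⟶ 𝟙` in the category of endomorphisms of the base object. -/
@[simps]
def TangentData.bundle (X : TangentData K) : BundleData (X.base ⟶ X.base) where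
  B := 𝟙 X.base
  E := X.T
  E₂ := X.T₂
  π₁ := X.π₁
  π₂ := X.π₂
  q := X.p
  z := X.z
  s := X.s

/-- The axioms of a tangent structure. -/
structure TangentData.IsTangent (X : TangentData K) : Prop where
  additive : X.bundle.IsAdditive
  /-- `T₂` is a pointwise pullback, preserved by the iterates of `T`. -/
  pullback : ∀ k : ℕ, IsPointwisePullback (X.π₁ ▷ iterate X.T k) (X.π₂ ▷ iterate X.T k)
    (X.p ▷ iterate X.T k) (X.p ▷ iterate X.T k)
  /-- All `n`-fold pointwise pullbacks of `p` exist and are preserved by the iterates of `T`. -/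
  nfold : ∀ n : ℕ, 1 ≤ n → ∃ (Tn : X.base ⟶ X.base) (b : Tn ⟶ 𝟙 X.base) (π : Fin n → (Tn ⟶ X.T)),
    ∀ k : ℕ, IsPointwiseNFoldPullback (X.p ▷ iterate X.T k) (b ▷ iterate X.T k)
      (fun i => π i ▷ iterate X.T k)
  /-- `(z, l) : p → T p` is an additive bundle morphism. -/
  lift_additive : X.bundle.IsMorphism (X.bundle.mapFunctor (postcomp X.base X.T))
    (X.z ≫ (λ_ X.T).inv) X.l
  /-- `(𝟙, c) : T p → p_T` is an additive bundle morphism. -/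
  flip_additive : (X.bundle.mapFunctor (postcomp X.base X.T)).IsMorphism
    (X.bundle.mapFunctor (precomp X.base X.T)) ((λ_ X.T).hom ≫ (ρ_ X.T).inv) X.c
  l_coassoc : X.l ≫ X.l ▷ X.T ≫ (α_ X.T X.T X.T).hom = X.l ≫ X.T ◁ X.l
  l_c : X.l ≫ X.c = X.l
  lift_flip : X.T ◁ X.l ≫ (α_ X.T X.T X.T).inv ≫ X.c ▷ X.T ≫ (α_ X.T X.T X.T).hom ≫ X.T ◁ X.c =
    X.c ≫ X.l ▷ X.T ≫ (α_ X.T X.T X.T).hom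
  c_c : X.c ≫ X.c = 𝟙 _
  yang_baxter :
    X.c ▷ X.T ≫ (α_ X.T X.T X.T).hom ≫ X.T ◁ X.c ≫ (α_ X.T X.T X.T).inv ≫ X.c ▷ X.T =
      (α_ X.T X.T X.T).hom ≫ X.T ◁ X.c ≫ (α_ X.T X.T X.T).inv ≫ X.c ▷ X.T ≫
        (α_ X.T X.T X.T).hom ≫ X.T ◁ X.c ≫ (α_ X.T X.T X.T).inv
  /-- Local linearity of the tangent bundle; `v` is the (unique) map `z_T × l`. -/
  local_linearity : ∃ v : X.T₂ ⟶ X.T₂ ≫ X.T,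
    v ≫ X.π₁ ▷ X.T = X.π₁ ≫ (ρ_ X.T).inv ≫ X.T ◁ X.z ∧
    v ≫ X.π₂ ▷ X.T = X.π₂ ≫ X.l ∧
    IsPointwisePullback (v ≫ X.s ▷ X.T) (X.π₁ ≫ X.p) (X.p ▷ X.T ≫ (λ_ X.T).hom) X.z

/-- Tangentads in `K`. -/
structure Tangentad (K : Type u) [Bicategory.{w, v} K] extends TangentData K where
  isTangent : toTangentData.IsTangent

theorem Tangentad.isPullback_whiskerLeft (X : Tangentad K) {W : K} (h : W ⟶ X.base) :
    IsPullback (h ◁ X.π₁) (h ◁ X.π₂) (h ◁ X.p) (h ◁ X.p) :=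
  ((X.isTangent.pullback 0).2 h).of_iso
    (whiskerLeftIso h (ρ_ X.T₂)) (whiskerLeftIso h (ρ_ X.T))
    (whiskerLeftIso h (ρ_ X.T)) (whiskerLeftIso h (ρ_ (𝟙 X.base)))
    (by simp [iterate]) (by simp [iterate]) (by simp [iterate]) (by simp [iterate])

theorem Tangentad.c_projection (X : Tangentad K) :
    X.c ≫ X.T ◁ X.p = X.p ▷ X.T ≫ (λ_ X.T).hom ≫ (ρ_ X.T).inv := by
  obtain ⟨g₂, h⟩ := X.isTangent.flip_additive
  exact h.q

theorem Tangentad.π₁_p (X : Tangentad K) : X.π₁ ≫ X.p = X.π₂ ≫ X.p :=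
  X.isTangent.additive.isPullback.w

/-- The canonical flip with `T₂` in place of one copy of `T`: the `2`-morphism `T ∘ T₂ ⟶ T₂ ∘ T`
whose components are `c ∘ T π₁` and `c ∘ T π₂`. -/
noncomputable def Tangentad.flip₂ (X : Tangentad K) : X.T₂ ≫ X.T ⟶ X.T ≫ X.T₂ :=
  (X.isPullback_whiskerLeft X.T).lift (X.π₁ ▷ X.T ≫ X.c) (X.π₂ ▷ X.T ≫ X.c) (by
    rw [Category.assoc, Category.assoc, X.c_projection, ← comp_whiskerRight_assoc, X.π₁_p,
      comp_whiskerRight_assoc])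

end Tangentads

/-! ### Colax tangent morphisms and the `2`-category of tangentads -/

section Colax

variable {K : Type u} [Bicategory.{w, v} K]

/-- The law `T' ∘ S' ∘ F ⟶ T' ∘ F ∘ S ⟶ F ∘ T ∘ S` obtained by pasting two laws along the same
`1`-morphism. -/
def stackLaw {X Y : K} {F : X ⟶ Y} {S T : X ⟶ X} {S' T' : Y ⟶ Y} (σ : F ≫ S' ⟶ S ≫ F)
    (τ : F ≫ T' ⟶ T ≫ F) : F ≫ S' ≫ T' ⟶ (S ≫ T) ≫ F :=
  (α_ F S' T').inv ≫ σ ▷ T' ≫ (α_ S F T').hom ≫ S ◁ τ ≫ (α_ S T F).inv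

/-- The law of the composite `G ∘ F`. -/
def compLaw {X Y Z : K} {F : X ⟶ Y} {G : Y ⟶ Z} {T : X ⟶ X} {T' : Y ⟶ Y} {T'' : Z ⟶ Z}
    (σ : F ≫ T' ⟶ T ≫ F) (τ : G ≫ T'' ⟶ T' ≫ G) : (F ≫ G) ≫ T'' ⟶ T ≫ F ≫ G :=
  (α_ F G T'').hom ≫ F ◁ τ ≫ (α_ F T' G).inv ≫ σ ▷ G ≫ (α_ T F G).hom

/-- The law of the identity. -/
def idLaw {X : K} (T : X ⟶ X) : 𝟙 X ≫ T ⟶ T ≫ 𝟙 X := (λ_ T).hom ≫ (ρ_ T).inv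

/-- `law : T' ∘ F ⟶ F ∘ T` is a colax distributive law.

In `additive`, the `2`-morphism `law₂ : T₂' ∘ F ⟶ F ∘ T₂` plays the role of `law × law`. Since `F` is
not required to preserve the pullback `T₂`, its existence is part of the condition, together with
its compatibility with the flips `T ∘ T₂ ⟶ T₂ ∘ T`. When `F ∘ T₂` is a pointwise pullback of `F p`
along itself, `law₂` exists, is unique, and is compatible with the flips, as soon as `law` is
compatible with the projections and with `c`. -/
structure IsColaxLaw (X Y : Tangentad K) (F : X.base ⟶ Y.base) (law : F ≫ Y.T ⟶ X.T ≫ F) :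
    Prop where
  /-- `(𝟙, law) : p'_F → F p` is an additive bundle morphism. -/
  additive : ∃ law₂ : F ≫ Y.T₂ ⟶ X.T₂ ≫ F,
    (Y.bundle.mapFunctor (precomp Y.base F)).IsMorphismVia
      (X.bundle.mapFunctor (postcomp X.base F)) ((ρ_ F).hom ≫ (λ_ F).inv) law law₂ ∧
    stackLaw law₂ law ≫ X.flip₂ ▷ F = F ◁ Y.flip₂ ≫ stackLaw law law₂
  lift : law ≫ X.l ▷ F = F ◁ Y.l ≫ stackLaw law law
  flip : stackLaw law law ≫ X.c ▷ F = F ◁ Y.c ≫ stackLaw law law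

/-- Colax tangent `1`-morphisms. -/
@[ext]
structure ColaxHom (X Y : Tangentad K) where
  mor : X.base ⟶ Y.base
  law : mor ≫ Y.T ⟶ X.T ≫ mor
  isColax : IsColaxLaw X Y mor law

/-- Tangent `2`-morphisms between colax tangent `1`-morphisms. -/
@[ext]
structure ColaxHom₂ {X Y : Tangentad K} (F G : ColaxHom X Y) where
  hom : F.mor ⟶ G.mor
  comm : F.law ≫ X.T ◁ hom = hom ▷ Y.T ≫ G.law

theorem stackLaw_compLaw {X Y Z : K} {F : X ⟶ Y} {G : Y ⟶ Z} {S T : X ⟶ X} {S' T' : Y ⟶ Y}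
    {S'' T'' : Z ⟶ Z} (σ : F ≫ S' ⟶ S ≫ F) (σ' : G ≫ S'' ⟶ S' ≫ G)
    (τ : F ≫ T' ⟶ T ≫ F) (τ' : G ≫ T'' ⟶ T' ≫ G) :
    stackLaw (compLaw σ σ') (compLaw τ τ') = compLaw (stackLaw σ τ) (stackLaw σ' τ') := by
  simp only [stackLaw, compLaw]
  calc
    _ = 𝟙 _ ⊗≫ F ◁ σ' ▷ T'' ⊗≫ (σ ▷ (G ≫ T'') ≫ (S ≫ F) ◁ τ') ⊗≫ S ◁ τ ▷ G ⊗≫ 𝟙 _ := by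
      bicategory
    _ = 𝟙 _ ⊗≫ F ◁ σ' ▷ T'' ⊗≫ ((F ≫ S') ◁ τ' ≫ σ ▷ (T' ≫ G)) ⊗≫ S ◁ τ ▷ G ⊗≫ 𝟙 _ := by
      rw [whisker_exchange]
    _ = _ := by bicategory

theorem compLaw_naturality {X Y Z : K} {F : X ⟶ Y} {G : Y ⟶ Z} {S T : X ⟶ X} {S' T' : Y ⟶ Y}
    {S'' T'' : Z ⟶ Z} {σ : F ≫ S' ⟶ S ≫ F} {σ' : G ≫ S'' ⟶ S' ≫ G}
    {τ : F ≫ T' ⟶ T ≫ F} {τ' : G ≫ T'' ⟶ T' ≫ G} {x : S ⟶ T} {x' : S' ⟶ T'} {x'' : S'' ⟶ T''}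
    (h : σ ≫ x ▷ F = F ◁ x' ≫ τ) (h' : σ' ≫ x' ▷ G = G ◁ x'' ≫ τ') :
    compLaw σ σ' ≫ x ▷ (F ≫ G) = (F ≫ G) ◁ x'' ≫ compLaw τ τ' := by
  simp only [compLaw]
  calc
    _ = 𝟙 _ ⊗≫ F ◁ σ' ⊗≫ (σ ≫ x ▷ F) ▷ G ⊗≫ 𝟙 _ := by bicategory
    _ = 𝟙 _ ⊗≫ F ◁ (σ' ≫ x' ▷ G) ⊗≫ τ ▷ G ⊗≫ 𝟙 _ := by rw [h]; bicategory
    _ = _ := by rw [h']; bicategory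

theorem stackLaw_idLaw {X : K} (S T : X ⟶ X) : stackLaw (idLaw S) (idLaw T) = idLaw (S ≫ T) := by
  simp only [stackLaw, idLaw]
  bicategory

theorem idLaw_naturality {X : K} {S T : X ⟶ X} (x : S ⟶ T) :
    idLaw S ≫ x ▷ 𝟙 X = 𝟙 X ◁ x ≫ idLaw T := by
  simp [idLaw]

theorem isMorphismVia_iff (X Y : Tangentad K) (F : X.base ⟶ Y.base) (law : F ≫ Y.T ⟶ X.T ≫ F)
    (law₂ : F ≫ Y.T₂ ⟶ X.T₂ ≫ F) :
    (Y.bundle.mapFunctor (precomp Y.base F)).IsMorphismVia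
      (X.bundle.mapFunctor (postcomp X.base F)) ((ρ_ F).hom ≫ (λ_ F).inv) law law₂ ↔
    law₂ ≫ X.π₁ ▷ F = F ◁ Y.π₁ ≫ law ∧ law₂ ≫ X.π₂ ▷ F = F ◁ Y.π₂ ≫ law ∧
    law ≫ X.p ▷ F = F ◁ Y.p ≫ (ρ_ F).hom ≫ (λ_ F).inv ∧
    ((ρ_ F).hom ≫ (λ_ F).inv) ≫ X.z ▷ F = F ◁ Y.z ≫ law ∧
    law₂ ≫ X.s ▷ F = F ◁ Y.s ≫ law :=
  ⟨fun h => ⟨h.π₁, h.π₂, h.q, h.z.symm, h.s.symm⟩,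
    fun h => ⟨h.1, h.2.1, h.2.2.1, h.2.2.2.1.symm, h.2.2.2.2.symm⟩⟩

theorem compLaw_unit {X Y Z : K} (F : X ⟶ Y) (G : Y ⟶ Z) :
    compLaw ((ρ_ F).hom ≫ (λ_ F).inv) ((ρ_ G).hom ≫ (λ_ G).inv) =
      (ρ_ (F ≫ G)).hom ≫ (λ_ (F ≫ G)).inv := by
  simp only [compLaw]
  bicategory

theorem IsColaxLaw.comp {X Y Z : Tangentad K} {F : X.base ⟶ Y.base} {G : Y.base ⟶ Z.base}
    {σ : F ≫ Y.T ⟶ X.T ≫ F} {τ : G ≫ Z.T ⟶ Y.T ≫ G} (hσ : IsColaxLaw X Y F σ)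
    (hτ : IsColaxLaw Y Z G τ) : IsColaxLaw X Z (F ≫ G) (compLaw σ τ) where
  additive := by
    obtain ⟨σ₂, hσ₂, hσf⟩ := hσ.additive
    obtain ⟨τ₂, hτ₂, hτf⟩ := hτ.additive
    rw [isMorphismVia_iff] at hσ₂ hτ₂
    refine ⟨compLaw σ₂ τ₂, ?_, ?_⟩
    · rw [isMorphismVia_iff, ← compLaw_unit]
      exact ⟨compLaw_naturality hσ₂.1 hτ₂.1, compLaw_naturality hσ₂.2.1 hτ₂.2.1,
        compLaw_naturality hσ₂.2.2.1 hτ₂.2.2.1, compLaw_naturality hσ₂.2.2.2.1 hτ₂.2.2.2.1,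
        compLaw_naturality hσ₂.2.2.2.2 hτ₂.2.2.2.2⟩
    · rw [stackLaw_compLaw, stackLaw_compLaw]
      exact compLaw_naturality hσf hτf
  lift := by
    rw [stackLaw_compLaw]
    exact compLaw_naturality hσ.lift hτ.lift
  flip := by
    rw [stackLaw_compLaw]
    exact compLaw_naturality hσ.flip hτ.flip

theorem IsColaxLaw.id (X : Tangentad K) : IsColaxLaw X X (𝟙 X.base) (idLaw X.T) where
  additive := by
    refine ⟨idLaw X.T₂, ?_, ?_⟩
    · rw [isMorphismVia_iff]
      refine ⟨idLaw_naturality _, idLaw_naturality _, ?_, ?_, idLaw_naturality _⟩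
      · simp [idLaw]
      · simp [idLaw]
    · rw [stackLaw_idLaw, stackLaw_idLaw]
      exact idLaw_naturality _
  lift := by
    rw [stackLaw_idLaw]
    exact idLaw_naturality _
  flip := by
    rw [stackLaw_idLaw]
    exact idLaw_naturality _

instance ColaxHom.category (X Y : Tangentad K) : Category (ColaxHom X Y) where
  Hom F G := ColaxHom₂ F G
  id F := ⟨𝟙 F.mor, by simp⟩
  comp φ ψ := ⟨φ.hom ≫ ψ.hom, by
    rw [whiskerLeft_comp, comp_whiskerRight, ← Category.assoc, φ.comm, Category.assoc, ψ.comm,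
      Category.assoc]⟩
  id_comp φ := ColaxHom₂.ext (Category.id_comp _)
  comp_id φ := ColaxHom₂.ext (Category.comp_id _)
  assoc φ ψ χ := ColaxHom₂.ext (Category.assoc _ _ _)

instance Tangentad.categoryStruct : CategoryStruct (Tangentad K) where
  Hom X Y := ColaxHom X Y
  id X := ⟨𝟙 X.base, idLaw X.T, .id X⟩
  comp F G := ⟨F.mor ≫ G.mor, compLaw F.law G.law, F.isColax.comp G.isColax⟩

instance Tangentad.homCategory (X Y : Tangentad K) : Category (X ⟶ Y) :=
  ColaxHom.category X Y

namespace Tangentad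

@[ext]
theorem hom₂_ext {X Y : Tangentad K} {F G : X ⟶ Y} {φ ψ : F ⟶ G} (h : φ.hom = ψ.hom) : φ = ψ :=
  ColaxHom₂.ext h

@[simp] theorem id_mor (X : Tangentad K) : (𝟙 X : X ⟶ X).mor = 𝟙 X.base := rfl
@[simp] theorem id_law (X : Tangentad K) : (𝟙 X : X ⟶ X).law = idLaw X.T := rfl
@[simp] theorem comp_mor {X Y Z : Tangentad K} (F : X ⟶ Y) (G : Y ⟶ Z) :
    (F ≫ G).mor = F.mor ≫ G.mor := rfl
@[simp] theorem comp_law {X Y Z : Tangentad K} (F : X ⟶ Y) (G : Y ⟶ Z) :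
    (F ≫ G).law = compLaw F.law G.law := rfl
@[simp] theorem id_hom {X Y : Tangentad K} (F : X ⟶ Y) : (𝟙 F : F ⟶ F).hom = 𝟙 F.mor := rfl
@[simp] theorem comp_hom {X Y : Tangentad K} {F G H : X ⟶ Y} (φ : F ⟶ G) (ψ : G ⟶ H) :
    (φ ≫ ψ).hom = φ.hom ≫ ψ.hom := rfl

/-- An invertible `2`-morphism compatible with the laws is an isomorphism of colax tangent
morphisms. -/
@[simps]
def isoMk {X Y : Tangentad K} {F G : X ⟶ Y} (e : F.mor ≅ G.mor)
    (h : F.law ≫ X.T ◁ e.hom = e.hom ▷ Y.T ≫ G.law) : F ≅ G where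
  hom := ⟨e.hom, h⟩
  inv := ⟨e.inv, by
    rw [← cancel_epi (e.hom ▷ Y.T), ← reassoc_of% h, ← whiskerLeft_comp]
    simp⟩
  hom_inv_id := by ext; simp
  inv_hom_id := by ext; simp

theorem whiskerLeft_comm {X Y Z : Tangentad K} (F : X ⟶ Y) {G H : Y ⟶ Z} (φ : G ⟶ H) :
    compLaw F.law G.law ≫ X.T ◁ F.mor ◁ φ.hom = (F.mor ◁ φ.hom) ▷ Z.T ≫ compLaw F.law H.law := by
  simp only [compLaw]
  calc
    _ = 𝟙 _ ⊗≫ F.mor ◁ G.law ⊗≫ (F.law ▷ G.mor ≫ (X.T ≫ F.mor) ◁ φ.hom) ⊗≫ 𝟙 _ := by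
      bicategory
    _ = 𝟙 _ ⊗≫ F.mor ◁ (G.law ≫ Y.T ◁ φ.hom) ⊗≫ F.law ▷ H.mor ⊗≫ 𝟙 _ := by
      rw [← whisker_exchange]; bicategory
    _ = _ := by rw [φ.comm]; bicategory

theorem whiskerRight_comm {X Y Z : Tangentad K} {F G : X ⟶ Y} (φ : F ⟶ G) (H : Y ⟶ Z) :
    compLaw F.law H.law ≫ X.T ◁ (φ.hom ▷ H.mor) = (φ.hom ▷ H.mor) ▷ Z.T ≫ compLaw G.law H.law := by
  simp only [compLaw]
  calc
    _ = 𝟙 _ ⊗≫ F.mor ◁ H.law ⊗≫ (F.law ≫ X.T ◁ φ.hom) ▷ H.mor ⊗≫ 𝟙 _ := by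
      bicategory
    _ = 𝟙 _ ⊗≫ (F.mor ◁ H.law ≫ φ.hom ▷ (Y.T ≫ H.mor)) ⊗≫ G.law ▷ H.mor ⊗≫ 𝟙 _ := by
      rw [φ.comm]; bicategory
    _ = _ := by rw [whisker_exchange]; bicategory

/-- The `2`-category `Tng_co(K)` of tangentads in `K`, colax tangent `1`-morphisms and tangent
`2`-morphisms. -/
instance bicategory : Bicategory (Tangentad K) where
  toCategoryStruct := Tangentad.categoryStruct
  homCategory := Tangentad.homCategory
  whiskerLeft {X Y Z} F G H φ :=
    ColaxHom₂.mk (F := F ≫ G) (G := F ≫ H) (F.mor ◁ ColaxHom₂.hom φ) (whiskerLeft_comm F φ)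
  whiskerRight {X Y Z F G} φ H :=
    ColaxHom₂.mk (F := F ≫ H) (G := G ≫ H) (ColaxHom₂.hom φ ▷ H.mor) (whiskerRight_comm φ H)
  associator F G H := isoMk (F := (F ≫ G) ≫ H) (G := F ≫ G ≫ H) (α_ F.mor G.mor H.mor) (by
    simp only [comp_law, compLaw, comp_mor]; bicategory)
  leftUnitor {X Y} F := isoMk (F := 𝟙 X ≫ F) (G := F) (λ_ F.mor) (by
    simp only [comp_law, compLaw, id_law, idLaw, id_mor]; bicategory)
  rightUnitor {X Y} F := isoMk (F := F ≫ 𝟙 Y) (G := F) (ρ_ F.mor) (by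
    simp only [comp_law, compLaw, id_law, idLaw, id_mor]; bicategory)
  whiskerLeft_id _ _ := by ext; simp
  whiskerLeft_comp _ _ _ _ _ _ := by ext; simp
  id_whiskerLeft _ := by ext; simp
  comp_whiskerLeft _ _ _ _ _ := by ext; simp
  id_whiskerRight _ _ := by ext; simp
  comp_whiskerRight _ _ _ := by ext; simp
  whiskerRight_id _ := by ext; simp
  whiskerRight_comp _ _ _ := by ext; simp
  whisker_assoc _ _ _ _ _ := by ext; simp
  whisker_exchange _ _ := by ext; simpa using whisker_exchange _ _
  pentagon _ _ _ _ := by ext; simp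
  triangle _ _ := by ext; simp

@[simp] theorem whiskerLeft_hom {X Y Z : Tangentad K} (F : X ⟶ Y) {G H : Y ⟶ Z} (φ : G ⟶ H) :
    (F ◁ φ).hom = F.mor ◁ φ.hom := rfl
@[simp] theorem whiskerRight_hom {X Y Z : Tangentad K} {F G : X ⟶ Y} (φ : F ⟶ G) (H : Y ⟶ Z) :
    (φ ▷ H).hom = φ.hom ▷ H.mor := rfl
@[simp] theorem associator_hom_hom {X Y Z W : Tangentad K} (F : X ⟶ Y) (G : Y ⟶ Z) (H : Z ⟶ W) :
    (α_ F G H).hom.hom = (α_ F.mor G.mor H.mor).hom := rfl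
@[simp] theorem leftUnitor_hom_hom {X Y : Tangentad K} (F : X ⟶ Y) :
    (λ_ F).hom.hom = (λ_ F.mor).hom := rfl
@[simp] theorem rightUnitor_hom_hom {X Y : Tangentad K} (F : X ⟶ Y) :
    (ρ_ F).hom.hom = (ρ_ F.mor).hom := rfl

@[simp]
theorem eqToHom_hom {X Y : Tangentad K} {F G : X ⟶ Y} (h : F = G) :
    (eqToHom h).hom = eqToHom (congrArg ColaxHom.mor h) := by
  subst h; rfl

theorem eq_of_hom_eq_eqToHom {X Y : Tangentad K} {F G : X ⟶ Y} (φ : F ⟶ G) (h : F.mor = G.mor)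
    (hφ : φ.hom = eqToHom h) : F = G := by
  obtain ⟨F, σ, hF⟩ := F
  obtain ⟨G, τ, hG⟩ := G
  obtain ⟨φ, hc⟩ := φ
  dsimp at h hφ φ hc
  subst h
  subst hφ
  simp at hc
  subst hc
  rfl

instance strict [Strict K] : Strict (Tangentad K) where
  id_comp F := eq_of_hom_eq_eqToHom (λ_ F).hom (Strict.id_comp _) (by
    simp [Strict.leftUnitor_eqToIso])
  comp_id F := eq_of_hom_eq_eqToHom (ρ_ F).hom (Strict.comp_id _) (by
    simp [Strict.rightUnitor_eqToIso])
  assoc F G H := eq_of_hom_eq_eqToHom (α_ F G H).hom (Strict.assoc _ _ _) (by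
    simp [Strict.associator_eqToIso])
  leftUnitor_eqToIso F := by ext; simp [Strict.leftUnitor_eqToIso]
  rightUnitor_eqToIso F := by ext; simp [Strict.rightUnitor_eqToIso]
  associator_eqToIso F G H := by ext; simp [Strict.associator_eqToIso]

/-- The forgetful `2`-functor `U_co : Tng_co(K) ⟶ K`. -/
@[simps!]
def forget (K : Type u) [Bicategory.{w, v} K] : StrictPseudofunctor (Tangentad K) K :=
  StrictPseudofunctor.mk' {
    obj X := X.base
    map F := F.mor
    map₂ φ := φ.hom }

end Tangentad

end Colax

/-! ### Strict `2`-functors and `2`-natural transformations -/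

section TwoFunctors

variable {B : Type u} [Bicategory.{w, v} B] {C : Type u'} [Bicategory.{w', v'} C]
  {D : Type u''} [Bicategory.{w'', v''} D]

/-- `2`-natural transformations between strict `2`-functors. -/
@[ext]
structure TwoNatTrans (F G : StrictPseudofunctor B C) where
  app : ∀ a : B, F.obj a ⟶ G.obj a
  naturality : ∀ {a b : B} (f : a ⟶ b), F.map f ≫ app b = app a ≫ G.map f
  naturality₂ : ∀ {a b : B} {f g : a ⟶ b} (η : f ⟶ g),
    F.map₂ η ▷ app b ≫ eqToHom (naturality g) = eqToHom (naturality f) ≫ app a ◁ G.map₂ η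

/-- Strict `2`-functors with the same action on cells are equal. -/
theorem strictPseudofunctor_ext {F G : StrictPseudofunctor B C}
    (h : F.toPrelaxFunctor = G.toPrelaxFunctor) : F = G := by
  obtain ⟨⟨⟨F, FI, FC, _, _, _, _, _⟩, hi, hI⟩, hc, hC⟩ := F
  obtain ⟨⟨⟨G, GI, GC, _, _, _, _, _⟩, hi', hI'⟩, hc', hC'⟩ := G
  dsimp at h
  subst h
  obtain rfl : FI = GI := by
    funext a
    exact (hI a).trans (hI' a).symm
  obtain rfl : @FC = @GC := by
    funext a b c f g
    exact (hC f g).trans (hC' f g).symm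
  rfl

namespace TwoNatTrans

theorem map₂_whiskerRight {F G : StrictPseudofunctor B C} (σ : TwoNatTrans F G) {a b : B}
    {f g : a ⟶ b} (η : f ⟶ g) :
    F.map₂ η ▷ σ.app b =
      eqToHom (σ.naturality f) ≫ σ.app a ◁ G.map₂ η ≫ eqToHom (σ.naturality g).symm := by
  rw [← Category.assoc, ← σ.naturality₂ η]
  simp

variable [Strict C] [Strict D]

/-- The identity `2`-natural transformation. -/
@[simps]
def id (F : StrictPseudofunctor B C) : TwoNatTrans F F where
  app a := 𝟙 (F.obj a)
  naturality f := (Strict.comp_id _).trans (Strict.id_comp _).symm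
  naturality₂ η := by
    simp [Strict.leftUnitor_eqToIso, Strict.rightUnitor_eqToIso]

/-- Vertical composition of `2`-natural transformations. -/
@[simps]
def vcomp {F G H : StrictPseudofunctor B C} (σ : TwoNatTrans F G) (τ : TwoNatTrans G H) :
    TwoNatTrans F H where
  app a := σ.app a ≫ τ.app a
  naturality f := by
    rw [← Strict.assoc, σ.naturality, Strict.assoc, τ.naturality, Strict.assoc]
  naturality₂ {a b f g} η := by
    rw [whiskerRight_comp, map₂_whiskerRight]
    simp only [comp_whiskerRight, whisker_assoc, map₂_whiskerRight, whiskerLeft_comp]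
    simp [Strict.associator_eqToIso]

/-- Whiskering on the left. -/
@[simps]
def whiskerLeft (F : StrictPseudofunctor B C) {G H : StrictPseudofunctor C D}
    (τ : TwoNatTrans G H) : TwoNatTrans (F.comp G) (F.comp H) where
  app a := τ.app (F.obj a)
  naturality f := τ.naturality (F.map f)
  naturality₂ η := τ.naturality₂ (F.map₂ η)

/-- Whiskering on the right. -/
@[simps]
def whiskerRight {F G : StrictPseudofunctor B C} (σ : TwoNatTrans F G)
    (H : StrictPseudofunctor C D) : TwoNatTrans (F.comp H) (G.comp H) where
  app a := H.map (σ.app a)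
  naturality f :=
    (H.map_comp _ _).symm.trans ((congrArg H.map (σ.naturality f)).trans (H.map_comp _ _))
  naturality₂ {a b f g} η := by
    have h := congrArg H.map₂ (σ.map₂_whiskerRight η)
    simp only [PrelaxFunctor.map₂_comp, PrelaxFunctor.map₂_eqToHom, Pseudofunctor.map₂_whisker_right,
      Pseudofunctor.map₂_whisker_left, H.mapComp_eq_eqToIso, eqToIso.hom, eqToIso.inv] at h
    have h' := congrArg (fun x => eqToHom (H.map_comp _ _).symm ≫ x ≫ eqToHom (H.map_comp _ _)) h
    simp only [Category.assoc, eqToHom_trans, eqToHom_trans_assoc, eqToHom_refl, Category.comp_id,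
      Category.id_comp] at h'
    have h'' : ∀ (e₁ : H.map (F.map g) ≫ H.map (σ.app b) = H.map (σ.app a) ≫ H.map (G.map g))
        (e₂ : H.map (F.map f) ≫ H.map (σ.app b) = H.map (σ.app a) ≫ H.map (G.map f)),
        H.map₂ (F.map₂ η) ▷ H.map (σ.app b) ≫ eqToHom e₁ =
          eqToHom e₂ ≫ H.map (σ.app a) ◁ H.map₂ (G.map₂ η) := by
      intro e₁ e₂
      rw [h']
      simp
    exact h'' _ _

end TwoNatTrans

end TwoFunctors

/-! ### The `2`-category of `2`-categories and pointwise pullback-preserving `2`-functors -/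

section PullbackPreserving

/-- Pointwise pullback-preserving `2`-functors: they preserve every pointwise pullback in each
category of endomorphisms. -/
def PreservesPointwisePullbacks {K : Type u} [Bicategory.{w, v} K] {L : Type u'}
    [Bicategory.{w', v'} L] (Γ : StrictPseudofunctor K L) : Prop :=
  ∀ {X : K} {P A B C : X ⟶ X} {fst : P ⟶ A} {snd : P ⟶ B} {f : A ⟶ C} {g : B ⟶ C},
    IsPointwisePullback fst snd f g →
      IsPointwisePullback (Γ.map₂ fst) (Γ.map₂ snd) (Γ.map₂ f) (Γ.map₂ g)

set_option linter.checkUnivs false in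
/-- Strict `2`-categories, as the objects of `TwoCat_pp`. -/
structure TwoCatPP : Type (max (w + 1) (v + 1) (u + 1)) where
  carrier : Type u
  [bicategory : Bicategory.{w, v} carrier]
  [strict : Strict carrier]

instance : CoeSort TwoCatPP.{w, v, u} (Type u) := ⟨TwoCatPP.carrier⟩

attribute [instance] TwoCatPP.bicategory TwoCatPP.strict

namespace TwoCatPP

/-- The `1`-morphisms of `TwoCat_pp`. -/
@[ext]
structure Hom (K L : TwoCatPP.{w, v, u}) where
  functor : StrictPseudofunctor K L
  preserves : PreservesPointwisePullbacks functor

/-- The `2`-morphisms of `TwoCat_pp`. -/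
@[ext]
structure Hom₂ {K L : TwoCatPP.{w, v, u}} (Γ Γ' : Hom K L) where
  trans : TwoNatTrans Γ.functor Γ'.functor

instance homCat (K L : TwoCatPP.{w, v, u}) : Category (Hom K L) where
  Hom Γ Γ' := Hom₂ Γ Γ'
  id Γ := ⟨.id Γ.functor⟩
  comp σ τ := ⟨σ.trans.vcomp τ.trans⟩
  id_comp _ := Hom₂.ext (TwoNatTrans.ext (funext fun _ => Strict.id_comp _))
  comp_id _ := Hom₂.ext (TwoNatTrans.ext (funext fun _ => Strict.comp_id _))
  assoc _ _ _ := Hom₂.ext (TwoNatTrans.ext (funext fun _ => Strict.assoc _ _ _))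

instance categoryStruct : CategoryStruct TwoCatPP.{w, v, u} where
  Hom K L := Hom K L
  id K := ⟨.id K, fun h => h⟩
  comp Γ Γ' := ⟨Γ.functor.comp Γ'.functor, fun h => Γ'.preserves (Γ.preserves h)⟩

instance homCategory (K L : TwoCatPP.{w, v, u}) : Category (K ⟶ L) := homCat K L

@[ext]
theorem hom_ext {K L : TwoCatPP.{w, v, u}} {Γ Γ' : K ⟶ L}
    (h : Γ.functor.toPrelaxFunctor = Γ'.functor.toPrelaxFunctor) : Γ = Γ' :=
  Hom.ext (strictPseudofunctor_ext h)

@[ext]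
theorem hom₂_ext {K L : TwoCatPP.{w, v, u}} {Γ Γ' : K ⟶ L} {σ τ : Γ ⟶ Γ'}
    (h : ∀ X : K, σ.trans.app X = τ.trans.app X) : σ = τ :=
  Hom₂.ext (TwoNatTrans.ext (funext h))

theorem eq_conj_eqToHom {K L : TwoCatPP.{w, v, u}} {Γ Γ' Λ Λ' : K ⟶ L} (σ : Γ ⟶ Γ') (τ : Λ ⟶ Λ')
    (h₁ : Γ = Λ) (h₂ : Λ' = Γ') (H : ∀ X : K, HEq (σ.trans.app X) (τ.trans.app X)) :
    σ = eqToHom h₁ ≫ τ ≫ eqToHom h₂ := by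
  subst h₁
  subst h₂
  rw [eqToHom_refl, eqToHom_refl, Category.id_comp, Category.comp_id]
  exact hom₂_ext fun X => eq_of_heq (H X)

theorem eq_eqToHom {K L : TwoCatPP.{w, v, u}} {Γ Γ' : K ⟶ L} (σ : Γ ⟶ Γ') (h : Γ = Γ')
    (H : ∀ X : K, HEq (σ.trans.app X) (𝟙 (Γ.functor.obj X))) : σ = eqToHom h := by
  subst h
  exact hom₂_ext fun X => eq_of_heq (H X)

/-- Whiskering on the left in `TwoCat_pp`. -/
def lwhisker {K L M : TwoCatPP.{w, v, u}} (Γ : K ⟶ L) {Λ Λ' : L ⟶ M} (τ : Λ ⟶ Λ') :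
    Γ ≫ Λ ⟶ Γ ≫ Λ' :=
  Hom₂.mk (Γ := Γ ≫ Λ) (Γ' := Γ ≫ Λ') (.whiskerLeft Γ.functor (Hom₂.trans τ))

/-- Whiskering on the right in `TwoCat_pp`. -/
def rwhisker {K L M : TwoCatPP.{w, v, u}} {Γ Γ' : K ⟶ L} (σ : Γ ⟶ Γ') (Λ : L ⟶ M) :
    Γ ≫ Λ ⟶ Γ' ≫ Λ :=
  Hom₂.mk (Γ := Γ ≫ Λ) (Γ' := Γ' ≫ Λ) (.whiskerRight (Hom₂.trans σ) Λ.functor)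

theorem lwhisker_eqToHom {K L M : TwoCatPP.{w, v, u}} (Γ : K ⟶ L) {Λ Λ' : L ⟶ M} (h : Λ = Λ') :
    lwhisker Γ (eqToHom h) = eqToHom (congrArg (Γ ≫ ·) h) := by
  subst h
  exact eq_eqToHom _ _ fun _ => HEq.rfl

theorem eqToHom_rwhisker {K L M : TwoCatPP.{w, v, u}} {Γ Γ' : K ⟶ L} (h : Γ = Γ') (Λ : L ⟶ M) :
    rwhisker (eqToHom h) Λ = eqToHom (congrArg (· ≫ Λ) h) := by
  subst h
  exact hom₂_ext fun _ => Λ.functor.map_id _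

theorem id_comp_eq {K L : TwoCatPP.{w, v, u}} (Γ : K ⟶ L) : 𝟙 K ≫ Γ = Γ := hom_ext rfl

theorem comp_id_eq {K L : TwoCatPP.{w, v, u}} (Γ : K ⟶ L) : Γ ≫ 𝟙 L = Γ := hom_ext rfl

theorem assoc_eq {K L M N : TwoCatPP.{w, v, u}} (Γ : K ⟶ L) (Λ : L ⟶ M) (Ξ : M ⟶ N) :
    (Γ ≫ Λ) ≫ Ξ = Γ ≫ Λ ≫ Ξ := hom_ext rfl

/-- The `2`-category `TwoCat_pp` of `2`-categories, pointwise pullback-preserving `2`-functors and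
`2`-natural transformations. -/
instance : Bicategory TwoCatPP.{w, v, u} where
  toCategoryStruct := categoryStruct
  homCategory := homCategory
  whiskerLeft Γ _ _ τ := lwhisker Γ τ
  whiskerRight σ Λ := rwhisker σ Λ
  associator Γ Λ Ξ := eqToIso (assoc_eq Γ Λ Ξ)
  leftUnitor Γ := eqToIso (id_comp_eq Γ)
  rightUnitor Γ := eqToIso (comp_id_eq Γ)
  whiskerLeft_id _ _ := rfl
  whiskerLeft_comp _ _ _ _ _ _ := rfl
  id_whiskerLeft {K L Λ Λ'} τ := eq_conj_eqToHom (lwhisker (𝟙 K) τ) τ (id_comp_eq Λ)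
    (id_comp_eq Λ').symm fun _ => HEq.rfl
  comp_whiskerLeft Γ Λ Ξ Ξ' τ := eq_conj_eqToHom (lwhisker (Γ ≫ Λ) τ)
    (lwhisker Γ (lwhisker Λ τ)) (assoc_eq Γ Λ Ξ) (assoc_eq Γ Λ Ξ').symm fun _ => HEq.rfl
  id_whiskerRight _ Λ := hom₂_ext fun _ => Λ.functor.map_id _
  comp_whiskerRight _ _ Λ := hom₂_ext fun _ => Λ.functor.map_comp _ _
  whiskerRight_id {K L Γ Γ'} σ := eq_conj_eqToHom (rwhisker σ (𝟙 L)) σ (comp_id_eq Γ)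
    (comp_id_eq Γ').symm fun _ => HEq.rfl
  whiskerRight_comp {K L M N Γ Γ'} σ Λ Ξ := eq_conj_eqToHom (rwhisker σ (Λ ≫ Ξ))
    (rwhisker (rwhisker σ Λ) Ξ) (assoc_eq Γ Λ Ξ).symm (assoc_eq Γ' Λ Ξ) fun _ => HEq.rfl
  whisker_assoc Γ Λ Λ' τ Ξ := eq_conj_eqToHom (rwhisker (lwhisker Γ τ) Ξ)
    (lwhisker Γ (rwhisker τ Ξ)) (assoc_eq Γ Λ Ξ) (assoc_eq Γ Λ' Ξ).symm fun _ => HEq.rfl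
  whisker_exchange _ τ := hom₂_ext fun _ => ((Hom₂.trans τ).naturality _).symm
  pentagon Γ Λ Ξ Ω := by
    simp only [eqToIso.hom, lwhisker_eqToHom, eqToHom_rwhisker, eqToHom_trans]
  triangle Γ Λ := by
    simp only [eqToIso.hom, lwhisker_eqToHom, eqToHom_rwhisker, eqToHom_trans]

instance : Strict TwoCatPP.{w, v, u} where
  id_comp := id_comp_eq
  comp_id := comp_id_eq
  assoc := assoc_eq
  leftUnitor_eqToIso _ := rfl
  rightUnitor_eqToIso _ := rfl
  associator_eqToIso _ _ _ := rfl

end TwoCatPP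

end PullbackPreserving

/-! ### Strict `2`-functors and `2`-comonads with a prescribed action on objects -/

section TwoComonads

/-- Strict `2`-endofunctors of a `2`-category `C` whose action on objects is `o`. -/
structure TwoEndofunctorOn {C : Type u} [Bicategory.{w, v} C] [Strict C] (o : C → C) where
  map : ∀ {X Y : C}, (X ⟶ Y) → (o X ⟶ o Y)
  map₂ : ∀ {X Y : C} {f g : X ⟶ Y}, (f ⟶ g) → (map f ⟶ map g)
  map₂_id : ∀ {X Y : C} (f : X ⟶ Y), map₂ (𝟙 f) = 𝟙 (map f)
  map₂_comp : ∀ {X Y : C} {f g h : X ⟶ Y} (η : f ⟶ g) (θ : g ⟶ h),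
    map₂ (η ≫ θ) = map₂ η ≫ map₂ θ
  map_id : ∀ X : C, map (𝟙 X) = 𝟙 (o X)
  map_comp : ∀ {X Y Z : C} (f : X ⟶ Y) (g : Y ⟶ Z), map (f ≫ g) = map f ≫ map g
  map₂_whisker_left : ∀ {X Y Z : C} (f : X ⟶ Y) {g g' : Y ⟶ Z} (η : g ⟶ g'),
    map₂ (f ◁ η) = eqToHom (map_comp f g) ≫ map f ◁ map₂ η ≫ eqToHom (map_comp f g').symm
  map₂_whisker_right : ∀ {X Y Z : C} {f f' : X ⟶ Y} (η : f ⟶ f') (g : Y ⟶ Z),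
    map₂ (η ▷ g) = eqToHom (map_comp f g) ≫ map₂ η ▷ map g ≫ eqToHom (map_comp f' g).symm

/-- The underlying strict `2`-functor. -/
def TwoEndofunctorOn.toStrict {C : Type u} [Bicategory.{w, v} C] [Strict C] {o : C → C}
    (E : TwoEndofunctorOn o) : StrictPseudofunctor C C :=
  .mk'' {
    obj := o
    map := E.map
    map₂ := E.map₂
    map₂_id := E.map₂_id
    map₂_comp := E.map₂_comp
    map_id := E.map_id
    map_comp := E.map_comp
    map₂_whisker_left := E.map₂_whisker_left
    map₂_whisker_right := E.map₂_whisker_right }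

/-- `2`-comonads on a `2`-category `C` whose action on objects is `o`: a strict `2`-endofunctor with
`2`-natural counit and comultiplication which satisfy the comonad laws strictly. -/
structure TwoComonadOn {C : Type u} [Bicategory.{w, v} C] [Strict C] (o : C → C) extends
    TwoEndofunctorOn o where
  counit : TwoNatTrans toTwoEndofunctorOn.toStrict (.id C)
  comult : TwoNatTrans toTwoEndofunctorOn.toStrict
    (toTwoEndofunctorOn.toStrict.comp toTwoEndofunctorOn.toStrict)
  comult_counit : ∀ X : C,
    (show o X ⟶ o (o X) from comult.app X) ≫ (show o (o X) ⟶ o X from counit.app (o X)) = 𝟙 (o X)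
  comult_map_counit : ∀ X : C,
    (show o X ⟶ o (o X) from comult.app X) ≫ map (show o X ⟶ X from counit.app X) = 𝟙 (o X)
  coassoc : ∀ X : C,
    (show o X ⟶ o (o X) from comult.app X) ≫ (show o (o X) ⟶ o (o (o X)) from comult.app (o X)) =
      (show o X ⟶ o (o X) from comult.app X) ≫ map (show o X ⟶ o (o X) from comult.app X)

/-- The component of the counit at `X`. -/
def TwoComonadOn.counitAt {C : Type u} [Bicategory.{w, v} C] [Strict C] {o : C → C}
    (E : TwoComonadOn o) (X : C) : o X ⟶ X := E.counit.app X

/-- The component of the comultiplication at `X`. -/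
def TwoComonadOn.comultAt {C : Type u} [Bicategory.{w, v} C] [Strict C] {o : C → C}
    (E : TwoComonadOn o) (X : C) : o X ⟶ o (o X) := E.comult.app X

end TwoComonads

/-! ### The action of `2`-functors and `2`-natural transformations on tangentads

Since the values of a `2`-functor are only equal, and not definitionally equal, to the prescribed
ones, cells are compared together with their boundaries. -/

section Action

variable {K : Type u} [Bicategory.{w, v} K] {L : Type u'} [Bicategory.{w', v'} L]

/-- The image under a strict `2`-functor `Γ` of the data of a tangent structure. The isomorphisms
`mapId` and `mapComp` are the equalities `Γ 𝟙 = 𝟙` and `Γ (f ≫ g) = Γ f ≫ Γ g`. -/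
def TangentData.map (Γ : StrictPseudofunctor K L) (X : TangentData K) : TangentData L where
  base := Γ.obj X.base
  T := Γ.map X.T
  T₂ := Γ.map X.T₂
  π₁ := Γ.map₂ X.π₁
  π₂ := Γ.map₂ X.π₂
  p := Γ.map₂ X.p ≫ (Γ.mapId X.base).hom
  z := (Γ.mapId X.base).inv ≫ Γ.map₂ X.z
  s := Γ.map₂ X.s
  l := Γ.map₂ X.l ≫ (Γ.mapComp X.T X.T).hom
  c := (Γ.mapComp X.T X.T).inv ≫ Γ.map₂ X.c ≫ (Γ.mapComp X.T X.T).hom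

/-- A `1`-morphism with a law, together with its source and target. -/
structure OneCellData (K : Type u) [Bicategory.{w, v} K] where
  src : TangentData K
  tgt : TangentData K
  mor : src.base ⟶ tgt.base
  law : mor ≫ tgt.T ⟶ src.T ≫ mor

/-- The image of a `1`-morphism with a law under a strict `2`-functor. -/
def OneCellData.map (Γ : StrictPseudofunctor K L) (F : OneCellData K) : OneCellData L where
  src := F.src.map Γ
  tgt := F.tgt.map Γ
  mor := Γ.map F.mor
  law := (Γ.mapComp F.mor F.tgt.T).inv ≫ Γ.map₂ F.law ≫ (Γ.mapComp F.src.T F.mor).hom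

/-- The data of a colax tangent `1`-morphism. -/
def oneCell {X Y : Tangentad K} (F : X ⟶ Y) : OneCellData K where
  src := X.toTangentData
  tgt := Y.toTangentData
  mor := ColaxHom.mor F
  law := ColaxHom.law F

/-- A `2`-morphism together with its boundary. -/
structure TwoCellData (K : Type u) [Bicategory.{w, v} K] where
  {src tgt : K}
  {dom cod : src ⟶ tgt}
  cell : dom ⟶ cod

/-- The `2`-morphism of `K` which underlies a tangent `2`-morphism. -/
def twoCell {X Y : Tangentad K} {F G : X ⟶ Y} (φ : F ⟶ G) : TwoCellData K :=
  ⟨ColaxHom₂.hom φ⟩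

/-- `G : Tng_co(K) ⟶ Tng_co(L)` is the `2`-functor `Tng_co(Γ)`, which applies `Γ` to all the
data. -/
structure IsTngMap (Γ : StrictPseudofunctor K L) (G : StrictPseudofunctor (Tangentad K) (Tangentad L)) :
    Prop where
  obj : ∀ X : Tangentad K, (G.obj X).toTangentData = X.toTangentData.map Γ
  map : ∀ {X Y : Tangentad K} (F : X ⟶ Y), oneCell (G.map F) = (oneCell F).map Γ
  map₂ : ∀ {X Y : Tangentad K} {F F' : X ⟶ Y} (φ : F ⟶ F'),
    twoCell (G.map₂ φ) = ⟨Γ.map₂ (ColaxHom₂.hom φ)⟩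

/-- `Φ : Tng_co(Γ) ⟶ Tng_co(Γ')` is the `2`-natural transformation `Tng_co[φ]`, whose component at a
tangentad on `X` is `φ.app X` with the identity `2`-morphism
`Γ' T ∘ φ.app X = φ.app X ∘ Γ T` as its law. -/
def IsTngMap₂ {Γ Γ' : StrictPseudofunctor K L} (φ : TwoNatTrans Γ Γ')
    {G G' : StrictPseudofunctor (Tangentad K) (Tangentad L)} (Φ : TwoNatTrans G G') : Prop :=
  ∀ X : Tangentad K, oneCell (Φ.app X) =
    { src := X.toTangentData.map Γ
      tgt := X.toTangentData.map Γ'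
      mor := φ.app X.base
      law := eqToHom (φ.naturality X.T).symm }

/-- `D : Tng_co(K) ⟶ Tng_co(Tng_co(K))` is the `2`-functor `Δ_co`. -/
structure IsTngComult (D : StrictPseudofunctor (Tangentad K) (Tangentad (Tangentad K))) : Prop where
  /-- `Δ_co(X, T)` is a tangent structure on the tangentad `(X, T)`. -/
  obj_base : ∀ X : Tangentad K, (D.obj X).base = X
  /-- Its tangent bundle `1`-morphism is `(T, c)`. -/
  obj_T : ∀ X : Tangentad K, oneCell (D.obj X).T = ⟨X.toTangentData, X.toTangentData, X.T, X.c⟩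
  /-- Its structural `2`-morphisms are those of `T`. -/
  obj_data : ∀ X : Tangentad K,
    (D.obj X).toTangentData.map (Tangentad.forget K) = X.toTangentData
  /-- The `1`-morphism underlying `Δ_co(F, α)` is `(F, α)`. -/
  map_mor : ∀ {X Y : Tangentad K} (F : X ⟶ Y), oneCell (ColaxHom.mor (D.map F)) = oneCell F
  /-- The law of `Δ_co(F, α)` is `α`. -/
  map_law : ∀ {X Y : Tangentad K} (F : X ⟶ Y),
    twoCell (ColaxHom.law (D.map F)) = ⟨ColaxHom.law F⟩
  /-- `Δ_co(φ) = φ`. -/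
  map₂ : ∀ {X Y : Tangentad K} {F G : X ⟶ Y} (φ : F ⟶ G),
    twoCell (ColaxHom₂.hom (D.map₂ φ)) = twoCell φ

/-- The `2`-category `Tng_co(K)` as an object of `TwoCat_pp`. -/
def TwoCatPP.tngCo (K : TwoCatPP.{w, max v w, max u v w}) : TwoCatPP.{w, max v w, max u v w} :=
  ⟨Tangentad K⟩

end Action

end FormalTangent

namespace FormalTangent

/-! ### n-fold pullbacks and their reduction to binary ones -/

section NFold

variable {C : Type u} [Category.{v} C]

/-! Everything rests on one fact: pointwise pullbacks in `Tng_co(K)` are computed in `K`. The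
forgetful `2`-functor reflects them (`isPointwisePullback_of_hom`). The `2`-morphism induced in `K`
is compatible with the laws because whiskering the cone by the tangent `1`-morphism of the source is
a precomposition, hence again gives a limit cone, on which compatibility can be tested. It also
preserves them (`isPointwisePullback_hom`). Every object `W` of `K` carries a trivial tangentad with
`T = 𝟙`. A law out of it is forced by its compatibility with `p`, so the colax tangent morphisms
from it to `Y` form a category equivalent to `K(W, Y.base)`. Precomposition in `K` with a
`1`-morphism out of `W` is therefore a precomposition in `Tng_co(K)`.

A pointwise pullback-preserving `Γ` maps tangentads to tangentads (`isTangent_map`). An `(n +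
1)`-fold pullback is a binary pullback of the `n`-fold one, so `Γ` preserves all of them by
induction, and equations between structural `2`-morphisms are transported. Associativity of the sum
quantifies over test objects of the target; it follows from the universal case, the triple of
projections of `T₃`, since the image of `T₃` is again a `3`-fold pullback. That `Tng_co(Γ)`
preserves pointwise pullbacks is then formal: forget, apply `Γ`, reflect.

For the comultiplication, the axioms of `c` say that `(T, c)` is a colax tangent morphism and that
`p, z, s, l, c` are tangent `2`-morphisms. The pullbacks `T_n` lift with the law `c × ⋯ × c`. Here
one needs that `T_n` preserves the pullback `T₂`, which holds because limits commute with limits.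
For a colax morphism `(F, α)`, the compatibility of `α` with `c` says that `α` is itself a tangent
`2`-morphism, and the compatibility of `α₂` with the flips says the same of `α₂`. The latter has to
be an axiom since `F` need not preserve `T₂`.

The strict laws are checked on cells. Tangentads and colax morphisms are determined by their data,
and the two sides differ only by comparison cells of strict `2`-functors, which are identities up to
transport, and by different constructions of the same induced map `flip₂`. -/

theorem isPullback_iff_existsUnique {P A B D : C} {fst : P ⟶ A} {snd : P ⟶ B} {f : A ⟶ D}
    {g : B ⟶ D} :
    IsPullback fst snd f g ↔ fst ≫ f = snd ≫ g ∧
      ∀ (W : C) (x : W ⟶ A) (y : W ⟶ B), x ≫ f = y ≫ g →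
        ∃! t : W ⟶ P, t ≫ fst = x ∧ t ≫ snd = y := by
  constructor
  · intro h
    exact ⟨h.w, fun W x y hxy => ⟨h.lift x y hxy, by simp, fun t ht =>
      h.hom_ext (by simp [ht.1]) (by simp [ht.2])⟩⟩
  · rintro ⟨hw, h⟩
    choose lift hl hu using h
    exact ⟨⟨hw⟩, ⟨PullbackCone.IsLimit.mk hw (fun s => lift _ s.fst s.snd s.condition)
      (fun s => (hl _ _ _ _).1) (fun s => (hl _ _ _ _).2)
      (fun s m h₁ h₂ => hu _ _ _ _ _ ⟨h₁, h₂⟩)⟩⟩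

variable {n : ℕ} {P E B : C} {q : E ⟶ B} {b : P ⟶ B} {π : Fin n → (P ⟶ E)}

theorem isNFoldPullback_iff_existsUnique :
    IsNFoldPullback q b π ↔ (∀ i, π i ≫ q = b) ∧
      ∀ (W : C) (β : W ⟶ B) (x : Fin n → (W ⟶ E)), (∀ i, x i ≫ q = β) →
        ∃! t : W ⟶ P, t ≫ b = β ∧ ∀ i, t ≫ π i = x i := by
  constructor
  · rintro ⟨hw, ⟨h⟩⟩
    refine ⟨hw, fun W β x hx => ⟨WidePullbackCone.IsLimit.lift h β x hx, ⟨?_, fun i => ?_⟩,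
      fun t ht => ?_⟩⟩
    · exact WidePullbackCone.IsLimit.lift_base h _ _ _
    · exact WidePullbackCone.IsLimit.lift_π h _ _ _ i
    · refine WidePullbackCone.IsLimit.hom_ext h (ht.1.trans ?_) fun i => (ht.2 i).trans ?_
      · exact (WidePullbackCone.IsLimit.lift_base h _ _ _).symm
      · exact (WidePullbackCone.IsLimit.lift_π h _ _ _ i).symm
  · rintro ⟨hw, h⟩
    choose lift hl hu using h
    exact ⟨hw, ⟨WidePullbackCone.IsLimit.mk _ (fun s => lift _ s.base s.π s.condition)
      (fun s => (hl _ _ _ _).1) (fun s i => (hl _ _ _ _).2 i)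
      (fun s m h₁ h₂ => hu _ _ _ _ _ ⟨h₁, h₂⟩)⟩⟩

namespace IsNFoldPullback

theorem exists_lift (h : IsNFoldPullback q b π) {W : C} (β : W ⟶ B) (x : Fin n → (W ⟶ E))
    (hx : ∀ i, x i ≫ q = β) : ∃ t : W ⟶ P, t ≫ b = β ∧ ∀ i, t ≫ π i = x i :=
  ((isNFoldPullback_iff_existsUnique.1 h).2 W β x hx).exists

theorem hom_ext (h : IsNFoldPullback q b π) {W : C} {t t' : W ⟶ P} (hb : t ≫ b = t' ≫ b)
    (hπ : ∀ i, t ≫ π i = t' ≫ π i) : t = t' :=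
  ((isNFoldPullback_iff_existsUnique.1 h).2 W (t' ≫ b) (fun i => t' ≫ π i)
    (fun i => by rw [Category.assoc, h.w])).unique ⟨hb, hπ⟩ ⟨rfl, fun _ => rfl⟩

/-- With at least one projection the base component is redundant. For `n = 0` the limit is `B`
itself and only the base component remains. -/
theorem hom_ext_of_pos (h : IsNFoldPullback q b π) (hn : 1 ≤ n) {W : C} {t t' : W ⟶ P}
    (hπ : ∀ i, t ≫ π i = t' ≫ π i) : t = t' :=
  h.hom_ext (by rw [← h.w ⟨0, hn⟩, ← Category.assoc, hπ, Category.assoc]) hπ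

theorem mk' (hw : ∀ i, π i ≫ q = b)
    (hl : ∀ {W : C} (β : W ⟶ B) (x : Fin n → (W ⟶ E)), (∀ i, x i ≫ q = β) →
      ∃ t : W ⟶ P, t ≫ b = β ∧ ∀ i, t ≫ π i = x i)
    (he : ∀ {W : C} {t t' : W ⟶ P}, t ≫ b = t' ≫ b → (∀ i, t ≫ π i = t' ≫ π i) → t = t') :
    IsNFoldPullback q b π :=
  isNFoldPullback_iff_existsUnique.2 ⟨hw, fun _ β x hx => by
    obtain ⟨t, ht⟩ := hl β x hx
    exact ⟨t, ht, fun t' ht' => he (ht'.1.trans ht.1.symm)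
      fun i => (ht'.2 i).trans (ht.2 i).symm⟩⟩

theorem of_iso (h : IsNFoldPullback q b π) {P' E' B' : C} {q' : E' ⟶ B'} {b' : P' ⟶ B'}
    {π' : Fin n → (P' ⟶ E')} (eP : P ≅ P') (eE : E ≅ E') (eB : B ≅ B')
    (hq : q ≫ eB.hom = eE.hom ≫ q') (hb : b ≫ eB.hom = eP.hom ≫ b')
    (hπ : ∀ i, π i ≫ eE.hom = eP.hom ≫ π' i) : IsNFoldPullback q' b' π' := by
  refine mk' (fun i => ?_) (fun {W} β x hx => ?_) fun {W t t'} hb' hπ' => ?_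
  · rw [← cancel_epi eP.hom, ← reassoc_of% (hπ i), ← hq, ← hb, reassoc_of% (h.w i)]
  · obtain ⟨t, ht, ht'⟩ := h.exists_lift (β ≫ eB.inv) (fun i => x i ≫ eE.inv) fun i => by
      have : eE.inv ≫ q = q' ≫ eB.inv := by
        rw [Iso.inv_comp_eq, ← reassoc_of% hq, Iso.hom_inv_id, Category.comp_id]
      rw [Category.assoc, this, reassoc_of% (hx i)]
    refine ⟨t ≫ eP.hom, ?_, fun i => ?_⟩
    · rw [Category.assoc, ← hb, reassoc_of% ht, Iso.inv_hom_id, Category.comp_id]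
    · rw [Category.assoc, ← hπ, reassoc_of% (ht' i), Iso.inv_hom_id, Category.comp_id]
  · rw [← cancel_mono eP.inv]
    refine h.hom_ext ?_ fun i => ?_
    · rw [← cancel_mono eB.hom, Category.assoc, Category.assoc, Category.assoc, Category.assoc,
        hb, eP.inv_hom_id_assoc, hb']
    · rw [← cancel_mono eE.hom, Category.assoc, Category.assoc, Category.assoc, Category.assoc,
        hπ, eP.inv_hom_id_assoc, hπ']

/-- The `n + 1`-fold pullback is the pullback of the `n`-fold pullback and the map itself. -/
theorem isPullback_succ (h : IsNFoldPullback q b π) {P' : C} {b' : P' ⟶ B}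
    {π' : Fin (n + 1) → (P' ⟶ E)} (h' : IsNFoldPullback q b' π') {r : P' ⟶ P}
    (hb : r ≫ b = b') (hr : ∀ i, r ≫ π i = π' i.succ) : IsPullback r (π' 0) b q := by
  refine isPullback_iff_existsUnique.2 ⟨by rw [hb, h'.w], fun W x y hxy => ?_⟩
  obtain ⟨t, ht, ht'⟩ := h'.exists_lift (x ≫ b) (Fin.cons y fun i => x ≫ π i) fun i => by
    refine Fin.cases ?_ (fun i => ?_) i
    · simp [hxy]
    · simp [h.w]
  refine ⟨t, ⟨h.hom_ext ?_ fun i => ?_, ht' 0⟩, fun t' ⟨hx', hy'⟩ => h'.hom_ext ?_ fun i => ?_⟩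
  · rw [Category.assoc, hb, ht]
  · rw [Category.assoc, hr, ht']
    rfl
  · rw [← hb, reassoc_of% hx', hb, ht]
  · rw [ht']
    refine Fin.cases hy' (fun i => ?_) i
    rw [← hr, reassoc_of% hx']
    rfl

/-- Converse of `isPullback_succ`. Together they make preservation of `n`-fold pullbacks an
induction on `n` using binary pullbacks only. -/
theorem of_isPullback_succ (h : IsNFoldPullback q b π) {P' : C} {b' : P' ⟶ B}
    {π' : Fin (n + 1) → (P' ⟶ E)} {r : P' ⟶ P} (h' : IsPullback r (π' 0) b q)
    (hb : r ≫ b = b') (hr : ∀ i, r ≫ π i = π' i.succ) : IsNFoldPullback q b' π' := by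
  refine mk' (fun i => ?_) (fun {W} β x hx => ?_) fun {W t t'} hb' hπ' => ?_
  · refine Fin.cases ?_ (fun i => ?_) i
    · rw [← hb, h'.w]
    · rw [← hr, ← hb, Category.assoc, h.w]
  · obtain ⟨t, ht, ht'⟩ := h.exists_lift β (fun i => x i.succ) fun i => hx _
    refine ⟨h'.lift t (x 0) (by rw [ht, hx]), ?_, fun i => ?_⟩
    · rw [← hb, IsPullback.lift_fst_assoc, ht]
    · refine Fin.cases ?_ (fun i => ?_) i
      · rw [IsPullback.lift_snd]
      · rw [← hr, IsPullback.lift_fst_assoc, ht']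
  · refine h'.hom_ext (h.hom_ext ?_ fun i => ?_) (hπ' 0)
    · rw [Category.assoc, Category.assoc, hb, hb']
    · rw [Category.assoc, Category.assoc, hr, hπ']

theorem isIso_one {π : Fin 1 → (P ⟶ E)} (h : IsNFoldPullback q b π) : IsIso (π 0) := by
  obtain ⟨t, ht, ht'⟩ := h.exists_lift q (fun _ => 𝟙 E) fun _ => Category.id_comp _
  refine ⟨t, h.hom_ext ?_ fun i => ?_, ht' 0⟩
  · rw [Category.assoc, ht, h.w, Category.id_comp]
  · obtain rfl : i = 0 := Subsingleton.elim _ _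
    rw [Category.assoc, ht', Category.comp_id, Category.id_comp]

theorem of_isIso_one {π : Fin 1 → (P ⟶ E)} (hw : π 0 ≫ q = b) [IsIso (π 0)] :
    IsNFoldPullback q b π := by
  refine mk' (fun i => ?_) (fun {W} β x hx => ⟨x 0 ≫ inv (π 0), ?_, fun i => ?_⟩)
    fun {W t t'} hb' hπ' => ?_
  · rwa [Subsingleton.elim i 0]
  · rw [← hw, Category.assoc, IsIso.inv_hom_id_assoc, hx]
  · rw [Subsingleton.elim i 0, Category.assoc, IsIso.inv_hom_id, Category.comp_id]
  · rw [← cancel_mono (π 0), hπ']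

theorem of_isIso (q : E ⟶ B) [IsIso q] (hw : ∀ i, π i ≫ q = b) [IsIso b] :
    IsNFoldPullback q b π := by
  refine mk' hw (fun {W} β x hx => ⟨β ≫ inv b, by simp, fun i => ?_⟩) fun {W t t'} hb' hπ' => ?_
  · rw [← cancel_mono q, hx, Category.assoc, Category.assoc, hw, IsIso.inv_hom_id,
      Category.comp_id]
  · rwa [cancel_mono] at hb'

end IsNFoldPullback

theorem isNFoldPullback_two_iff {fst snd : P ⟶ E} :
    IsNFoldPullback q (fst ≫ q) ![fst, snd] ↔ IsPullback fst snd q q := by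
  constructor
  · intro h
    refine isPullback_iff_existsUnique.2 ⟨(h.w 1).symm, fun W x y hxy => ?_⟩
    obtain ⟨t, ht, ht'⟩ := h.exists_lift (x ≫ q) ![x, y] (by simp [Fin.forall_fin_two, hxy])
    exact ⟨t, ⟨ht' 0, ht' 1⟩, fun t' ⟨h₁, h₂⟩ => h.hom_ext_of_pos le_add_self
      (Fin.forall_fin_two.2 ⟨h₁.trans (ht' 0).symm, h₂.trans (ht' 1).symm⟩)⟩
  · intro h
    refine .mk' (Fin.forall_fin_two.2 ⟨rfl, h.w.symm⟩) (fun {W} β x hx => ?_)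
      fun {W t t'} hb' hπ' => ?_
    · exact ⟨h.lift (x 0) (x 1) (by rw [hx, hx]), by simp [hx], by simp [Fin.forall_fin_two]⟩
    · exact h.hom_ext (hπ' 0) (hπ' 1)

end NFold

/-! ### Pointwise limits, and limits commuting with limits -/

section Pointwise

variable {K : Type u} [Bicategory.{w, v} K]

/-- Precomposition with the identity recovers the plain pullback through the left unitors, so the
first clause of pointwiseness is redundant. -/
theorem isPointwisePullback_of_forall {X Y : K} {P A B C : X ⟶ Y} {fst : P ⟶ A} {snd : P ⟶ B}
    {f : A ⟶ C} {g : B ⟶ C}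
    (h : ∀ {W : K} (h : W ⟶ X), IsPullback (h ◁ fst) (h ◁ snd) (h ◁ f) (h ◁ g)) :
    IsPointwisePullback fst snd f g :=
  ⟨(h (𝟙 X)).of_iso (λ_ P) (λ_ A) (λ_ B) (λ_ C) (by simp) (by simp) (by simp) (by simp), h⟩

theorem isPointwiseNFoldPullback_of_forall {n : ℕ} {X Y : K} {P E B : X ⟶ Y} {q : E ⟶ B}
    {b : P ⟶ B} {π : Fin n → (P ⟶ E)}
    (h : ∀ {W : K} (h : W ⟶ X), IsNFoldPullback (h ◁ q) (h ◁ b) (fun i => h ◁ π i)) :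
    IsPointwiseNFoldPullback q b π :=
  ⟨(h (𝟙 X)).of_iso (λ_ P) (λ_ E) (λ_ B) (by simp) (by simp) (by simp), h⟩

theorem IsPointwisePullback.of_iso {X Y : K} {P A B C P' A' B' C' : X ⟶ Y} {fst : P ⟶ A}
    {snd : P ⟶ B} {f : A ⟶ C} {g : B ⟶ C} {fst' : P' ⟶ A'} {snd' : P' ⟶ B'} {f' : A' ⟶ C'}
    {g' : B' ⟶ C'} (h : IsPointwisePullback fst snd f g) (e₁ : P ≅ P') (e₂ : A ≅ A')
    (e₃ : B ≅ B') (e₄ : C ≅ C') (h₁ : fst ≫ e₂.hom = e₁.hom ≫ fst')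
    (h₂ : snd ≫ e₃.hom = e₁.hom ≫ snd') (h₃ : f ≫ e₄.hom = e₂.hom ≫ f')
    (h₄ : g ≫ e₄.hom = e₃.hom ≫ g') : IsPointwisePullback fst' snd' f' g' := by
  refine isPointwisePullback_of_forall fun {W} k => (h.2 k).of_iso (whiskerLeftIso k e₁)
    (whiskerLeftIso k e₂) (whiskerLeftIso k e₃) (whiskerLeftIso k e₄) ?_ ?_ ?_ ?_
  all_goals simp only [whiskerLeftIso_hom, ← whiskerLeft_comp, h₁, h₂, h₃, h₄]

theorem IsPointwiseNFoldPullback.of_iso {n : ℕ} {X Y : K} {P E B P' E' B' : X ⟶ Y} {q : E ⟶ B}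
    {b : P ⟶ B} {π : Fin n → (P ⟶ E)} {q' : E' ⟶ B'} {b' : P' ⟶ B'} {π' : Fin n → (P' ⟶ E')}
    (h : IsPointwiseNFoldPullback q b π) (eP : P ≅ P') (eE : E ≅ E') (eB : B ≅ B')
    (hq : q ≫ eB.hom = eE.hom ≫ q') (hb : b ≫ eB.hom = eP.hom ≫ b')
    (hπ : ∀ i, π i ≫ eE.hom = eP.hom ≫ π' i) : IsPointwiseNFoldPullback q' b' π' := by
  refine isPointwiseNFoldPullback_of_forall fun {W} k => (h.2 k).of_iso (whiskerLeftIso k eP)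
    (whiskerLeftIso k eE) (whiskerLeftIso k eB) ?_ ?_ ?_
  all_goals simp only [whiskerLeftIso_hom, ← whiskerLeft_comp, hq, hb, hπ, implies_true]

theorem IsPointwisePullback.whiskerLeft {X Y Z : K} {P A B C : X ⟶ Y} {fst : P ⟶ A} {snd : P ⟶ B}
    {f : A ⟶ C} {g : B ⟶ C} (h : IsPointwisePullback fst snd f g) (k : Z ⟶ X) :
    IsPointwisePullback (k ◁ fst) (k ◁ snd) (k ◁ f) (k ◁ g) :=
  isPointwisePullback_of_forall fun {W} j => (h.2 (j ≫ k)).of_iso (α_ _ _ _) (α_ _ _ _)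
    (α_ _ _ _) (α_ _ _ _) (by simp) (by simp) (by simp) (by simp)

theorem isPointwiseNFoldPullback_two_iff {X Y : K} {P E B : X ⟶ Y} {q : E ⟶ B}
    {fst snd : P ⟶ E} :
    IsPointwiseNFoldPullback q (fst ≫ q) ![fst, snd] ↔ IsPointwisePullback fst snd q q := by
  have key : ∀ {W : K} (h : W ⟶ X), (fun i => h ◁ ![fst, snd] i) = ![h ◁ fst, h ◁ snd] := by
    intro W h
    funext i
    fin_cases i <;> rfl
  simp only [IsPointwiseNFoldPullback, IsPointwisePullback, isNFoldPullback_two_iff,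
    whiskerLeft_comp, key]

/-- If postcomposition with `E` and with `B` preserves a pullback, then so does postcomposition
with a pointwise `n`-fold pullback of `q : E ⟶ B`. -/
theorem IsPointwiseNFoldPullback.isPullback_whiskerRight {n : ℕ} {X Y Z : K} {P E B : X ⟶ Y}
    {q : E ⟶ B} {b : P ⟶ B} {π : Fin n → (P ⟶ E)} (hP : IsPointwiseNFoldPullback q b π)
    {D A A' D' : Z ⟶ X} {fst : D ⟶ A} {snd : D ⟶ A'} {f : A ⟶ D'} {g : A' ⟶ D'}
    (hE : IsPullback (fst ▷ E) (snd ▷ E) (f ▷ E) (g ▷ E))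
    (hB : IsPullback (fst ▷ B) (snd ▷ B) (f ▷ B) (g ▷ B)) (hw : fst ≫ f = snd ≫ g) :
    IsPullback (fst ▷ P) (snd ▷ P) (f ▷ P) (g ▷ P) := by
  refine isPullback_iff_existsUnique.2
    ⟨by rw [← comp_whiskerRight, hw, comp_whiskerRight], fun Q x y hxy => ?_⟩
  have hw' : ∀ {F : X ⟶ Y} (ρ : P ⟶ F), (x ≫ A ◁ ρ) ≫ f ▷ F = (y ≫ A' ◁ ρ) ≫ g ▷ F := by
    intro F ρ
    rw [Category.assoc, Category.assoc, whisker_exchange, whisker_exchange, reassoc_of% hxy]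
  -- Maps into `D ≫ P` are families of maps into `D ≫ E` that agree over `D ≫ B`. Each member comes
  -- from the pullback at `E`, and the agreement is tested in the pullback at `B`.
  obtain ⟨t, ht, ht'⟩ := (hP.2 D).exists_lift (hB.lift (x ≫ A ◁ b) (y ≫ A' ◁ b) (hw' b))
    (fun i => hE.lift (x ≫ A ◁ π i) (y ≫ A' ◁ π i) (hw' (π i))) fun i => by
      apply hB.hom_ext
      · rw [Category.assoc, whisker_exchange, IsPullback.lift_fst_assoc, IsPullback.lift_fst,
          Category.assoc, ← whiskerLeft_comp, hP.1.w]
      · rw [Category.assoc, whisker_exchange, IsPullback.lift_snd_assoc, IsPullback.lift_snd,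
          Category.assoc, ← whiskerLeft_comp, hP.1.w]
  refine ⟨t, ⟨(hP.2 A).hom_ext ?_ fun i => ?_, (hP.2 A').hom_ext ?_ fun i => ?_⟩,
    fun t' ⟨h₁, h₂⟩ => (hP.2 D).hom_ext ?_ fun i => ?_⟩
  · rw [Category.assoc, ← whisker_exchange, reassoc_of% ht, IsPullback.lift_fst]
  · rw [Category.assoc, ← whisker_exchange, reassoc_of% (ht' i), IsPullback.lift_fst]
  · rw [Category.assoc, ← whisker_exchange, reassoc_of% ht, IsPullback.lift_snd]
  · rw [Category.assoc, ← whisker_exchange, reassoc_of% (ht' i), IsPullback.lift_snd]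
  · rw [ht]
    apply hB.hom_ext
    · rw [Category.assoc, whisker_exchange, reassoc_of% h₁, IsPullback.lift_fst]
    · rw [Category.assoc, whisker_exchange, reassoc_of% h₂, IsPullback.lift_snd]
  · rw [ht']
    apply hE.hom_ext
    · rw [Category.assoc, whisker_exchange, reassoc_of% h₁, IsPullback.lift_fst]
    · rw [Category.assoc, whisker_exchange, reassoc_of% h₂, IsPullback.lift_snd]

/-- The pointwise version of `IsPointwiseNFoldPullback.isPullback_whiskerRight`. -/
theorem IsPointwiseNFoldPullback.isPointwisePullback_whiskerRight {n : ℕ} {X Y Z : K}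
    {P E B : X ⟶ Y} {q : E ⟶ B} {b : P ⟶ B} {π : Fin n → (P ⟶ E)}
    (hP : IsPointwiseNFoldPullback q b π)
    {D A A' D' : Z ⟶ X} {fst : D ⟶ A} {snd : D ⟶ A'} {f : A ⟶ D'} {g : A' ⟶ D'}
    (hE : IsPointwisePullback (fst ▷ E) (snd ▷ E) (f ▷ E) (g ▷ E))
    (hB : IsPointwisePullback (fst ▷ B) (snd ▷ B) (f ▷ B) (g ▷ B)) (hw : fst ≫ f = snd ≫ g) :
    IsPointwisePullback (fst ▷ P) (snd ▷ P) (f ▷ P) (g ▷ P) := by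
  have key : ∀ {F : X ⟶ Y}, IsPointwisePullback (fst ▷ F) (snd ▷ F) (f ▷ F) (g ▷ F) →
      ∀ {W : K} (h : W ⟶ Z),
        IsPullback ((h ◁ fst) ▷ F) ((h ◁ snd) ▷ F) ((h ◁ f) ▷ F) ((h ◁ g) ▷ F) :=
    fun hF W k => (hF.2 k).of_iso (α_ _ _ _).symm (α_ _ _ _).symm (α_ _ _ _).symm (α_ _ _ _).symm
      (by simp) (by simp) (by simp) (by simp)
  exact isPointwisePullback_of_forall fun {W} h => (hP.isPullback_whiskerRight (key hE h)
    (key hB h) (by rw [← whiskerLeft_comp, hw, whiskerLeft_comp])).of_iso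
    (α_ _ _ _) (α_ _ _ _) (α_ _ _ _) (α_ _ _ _) (by simp) (by simp) (by simp) (by simp)

end Pointwise

/-! ### Criteria for a law to be a colax distributive law -/

section Laws

variable {K : Type u} [Bicategory.{w, v} K]

theorem stackLaw_whiskerLeft {X Y : K} {F G : X ⟶ Y} {S T : X ⟶ X} {S' T' : Y ⟶ Y}
    {σ : F ≫ S' ⟶ S ≫ F} {τ : F ≫ T' ⟶ T ≫ F} {σ' : G ≫ S' ⟶ S ≫ G} {τ' : G ≫ T' ⟶ T ≫ G}
    {φ : F ⟶ G} (hσ : σ ≫ S ◁ φ = φ ▷ S' ≫ σ') (hτ : τ ≫ T ◁ φ = φ ▷ T' ≫ τ') :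
    stackLaw σ τ ≫ (S ≫ T) ◁ φ = φ ▷ (S' ≫ T') ≫ stackLaw σ' τ' := by
  simp only [stackLaw]
  calc
    _ = 𝟙 _ ⊗≫ σ ▷ T' ⊗≫ S ◁ (τ ≫ T ◁ φ) ⊗≫ 𝟙 _ := by bicategory
    _ = 𝟙 _ ⊗≫ (σ ≫ S ◁ φ) ▷ T' ⊗≫ S ◁ τ' ⊗≫ 𝟙 _ := by rw [hτ]; bicategory
    _ = _ := by rw [hσ]; bicategory

theorem stackLaw_naturality_left {X Y : K} {F : X ⟶ Y} {R S T : X ⟶ X} {R' S' T' : Y ⟶ Y}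
    {σ : F ≫ S' ⟶ S ≫ F} {ρ : F ≫ R' ⟶ R ≫ F} (τ : F ≫ T' ⟶ T ≫ F) {x : S ⟶ R} {x' : S' ⟶ R'}
    (h : σ ≫ x ▷ F = F ◁ x' ≫ ρ) :
    stackLaw σ τ ≫ (x ▷ T) ▷ F = F ◁ (x' ▷ T') ≫ stackLaw ρ τ := by
  simp only [stackLaw]
  calc
    _ = 𝟙 _ ⊗≫ σ ▷ T' ⊗≫ (S ◁ τ ≫ x ▷ (T ≫ F)) ⊗≫ 𝟙 _ := by bicategory
    _ = 𝟙 _ ⊗≫ (σ ≫ x ▷ F) ▷ T' ⊗≫ R ◁ τ ⊗≫ 𝟙 _ := by rw [whisker_exchange]; bicategory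
    _ = _ := by rw [h]; bicategory

theorem stackLaw_naturality_right {X Y : K} {F : X ⟶ Y} {R S T : X ⟶ X} {R' S' T' : Y ⟶ Y}
    {σ : F ≫ S' ⟶ S ≫ F} {ρ : F ≫ R' ⟶ R ≫ F} (τ : F ≫ T' ⟶ T ≫ F) {x : S ⟶ R} {x' : S' ⟶ R'}
    (h : σ ≫ x ▷ F = F ◁ x' ≫ ρ) :
    stackLaw τ σ ≫ (T ◁ x) ▷ F = F ◁ (T' ◁ x') ≫ stackLaw τ ρ := by
  simp only [stackLaw]
  calc
    _ = 𝟙 _ ⊗≫ τ ▷ S' ⊗≫ T ◁ (σ ≫ x ▷ F) ⊗≫ 𝟙 _ := by bicategory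
    _ = 𝟙 _ ⊗≫ (τ ▷ S' ≫ (T ≫ F) ◁ x') ⊗≫ T ◁ ρ ⊗≫ 𝟙 _ := by rw [h]; bicategory
    _ = _ := by rw [← whisker_exchange]; bicategory

@[simp]
theorem Tangentad.flip₂_π₁ (X : Tangentad K) : X.flip₂ ≫ X.T ◁ X.π₁ = X.π₁ ▷ X.T ≫ X.c :=
  (X.isPullback_whiskerLeft X.T).lift_fst _ _ _

@[simp]
theorem Tangentad.flip₂_π₂ (X : Tangentad K) : X.flip₂ ≫ X.T ◁ X.π₂ = X.π₂ ▷ X.T ≫ X.c :=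
  (X.isPullback_whiskerLeft X.T).lift_snd _ _ _

/-- Postcomposition with `F` preserves the pullback `T₂` of `p` along itself. -/
def Tangentad.IsPreservedBy (X : Tangentad K) {Y : K} (F : X.base ⟶ Y) : Prop :=
  IsPointwisePullback (X.π₁ ▷ F) (X.π₂ ▷ F) (X.p ▷ F) (X.p ▷ F)

theorem Tangentad.IsPreservedBy.of_iso {X : Tangentad K} {Y : K} {F G : X.base ⟶ Y}
    (h : X.IsPreservedBy F) (e : F ≅ G) : X.IsPreservedBy G :=
  IsPointwisePullback.of_iso h (whiskerLeftIso X.T₂ e) (whiskerLeftIso X.T e)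
    (whiskerLeftIso X.T e) (whiskerLeftIso (𝟙 _) e) (whisker_exchange _ _).symm
    (whisker_exchange _ _).symm (whisker_exchange _ _).symm (whisker_exchange _ _).symm

theorem Tangentad.isPreservedBy_iterate (X : Tangentad K) (k : ℕ) :
    X.IsPreservedBy (iterate X.T k) :=
  X.isTangent.pullback k

theorem Tangentad.isPreservedBy_id (X : Tangentad K) : X.IsPreservedBy (𝟙 X.base) :=
  X.isPreservedBy_iterate 0

theorem Tangentad.isPreservedBy_T (X : Tangentad K) : X.IsPreservedBy X.T :=
  (X.isPreservedBy_iterate 1).of_iso (λ_ X.T)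

theorem Tangentad.isPointwisePullback (X : Tangentad K) :
    IsPointwisePullback X.π₁ X.π₂ X.p X.p :=
  isPointwisePullback_of_forall fun h => X.isPullback_whiskerLeft h

/-- Limits commute with limits. This is what makes the pullbacks `T_n` eligible for
`IsColaxLaw.of_isPreservedBy`. -/
theorem Tangentad.isPreservedBy_of_nfold (X : Tangentad K) {Y : K} {n : ℕ} {P E B : X.base ⟶ Y}
    {q : E ⟶ B} {b : P ⟶ B} {π : Fin n → (P ⟶ E)} (hP : IsPointwiseNFoldPullback q b π)
    (hE : X.IsPreservedBy E) (hB : X.IsPreservedBy B) : X.IsPreservedBy P :=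
  hP.isPointwisePullback_whiskerRight hE hB X.π₁_p

theorem Tangentad.IsPreservedBy.whiskerLeft_hom_ext {X : Tangentad K} {Y Z : K}
    {F : X.base ⟶ Y} (hF : X.IsPreservedBy F) (h : Z ⟶ X.base) {Q : Z ⟶ Y}
    {f g : Q ⟶ (h ≫ X.T₂) ≫ F}
    (h₁ : f ≫ (h ◁ X.π₁) ▷ F = g ≫ (h ◁ X.π₁) ▷ F)
    (h₂ : f ≫ (h ◁ X.π₂) ▷ F = g ≫ (h ◁ X.π₂) ▷ F) : f = g := by
  rw [← cancel_mono (α_ _ _ _).hom]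
  apply (hF.2 h).hom_ext
  · rw [Category.assoc, Category.assoc, ← associator_naturality_middle, reassoc_of% h₁]
  · rw [Category.assoc, Category.assoc, ← associator_naturality_middle, reassoc_of% h₂]

/-- When `F` preserves the pullback `T₂`, the additivity of a law and its compatibility with the
flips can be tested on the given law. -/
theorem IsColaxLaw.of_isPreservedBy {X Y : Tangentad K} {F : X.base ⟶ Y.base}
    {law : F ≫ Y.T ⟶ X.T ≫ F} (hF : X.IsPreservedBy F)
    (hp : law ≫ X.p ▷ F = F ◁ Y.p ≫ (ρ_ F).hom ≫ (λ_ F).inv)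
    (hz : ((ρ_ F).hom ≫ (λ_ F).inv) ≫ X.z ▷ F = F ◁ Y.z ≫ law)
    (hs : ∀ law₂ : F ≫ Y.T₂ ⟶ X.T₂ ≫ F, law₂ ≫ X.π₁ ▷ F = F ◁ Y.π₁ ≫ law →
      law₂ ≫ X.π₂ ▷ F = F ◁ Y.π₂ ≫ law → law₂ ≫ X.s ▷ F = F ◁ Y.s ≫ law)
    (hl : law ≫ X.l ▷ F = F ◁ Y.l ≫ stackLaw law law)
    (hc : stackLaw law law ≫ X.c ▷ F = F ◁ Y.c ≫ stackLaw law law) : IsColaxLaw X Y F law where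
  additive := by
    obtain ⟨law₂, h₁, h₂⟩ : ∃ law₂ : F ≫ Y.T₂ ⟶ X.T₂ ≫ F,
        law₂ ≫ X.π₁ ▷ F = F ◁ Y.π₁ ≫ law ∧ law₂ ≫ X.π₂ ▷ F = F ◁ Y.π₂ ≫ law :=
      ⟨hF.1.lift (F ◁ Y.π₁ ≫ law) (F ◁ Y.π₂ ≫ law) (by
        simp only [Category.assoc, hp, ← whiskerLeft_comp_assoc, Y.π₁_p]), by simp, by simp⟩
    refine ⟨law₂, (isMorphismVia_iff X Y F law law₂).2 ⟨h₁, h₂, hp, hz, hs law₂ h₁ h₂⟩, ?_⟩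
    -- After projection to either component, compatibility with `flip₂` becomes compatibility of the
    -- given law with `c`.
    apply hF.whiskerLeft_hom_ext
    · rw [Category.assoc, ← comp_whiskerRight, X.flip₂_π₁, Category.assoc,
        stackLaw_naturality_right law h₁, comp_whiskerRight,
        reassoc_of% stackLaw_naturality_left law h₁, hc, ← whiskerLeft_comp_assoc,
        ← whiskerLeft_comp_assoc, Y.flip₂_π₁]
    · rw [Category.assoc, ← comp_whiskerRight, X.flip₂_π₂, Category.assoc,
        stackLaw_naturality_right law h₂, comp_whiskerRight,
        reassoc_of% stackLaw_naturality_left law h₂, hc, ← whiskerLeft_comp_assoc,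
        ← whiskerLeft_comp_assoc, Y.flip₂_π₂]
  lift := hl
  flip := hc

/-- A law on a limit of colax tangent morphisms which is compatible with the projections of the
limit is a colax law. -/
theorem IsColaxLaw.of_jointlyMono {X Y : Tangentad K} {ι : Type*} {F : ι → (X ⟶ Y)}
    {P : X.base ⟶ Y.base} (π : ∀ i, P ⟶ (F i).mor)
    (hπ : ∀ (h : X.base ⟶ X.base) {Q : X.base ⟶ Y.base} (f g : Q ⟶ h ≫ P),
      (∀ i, f ≫ h ◁ π i = g ≫ h ◁ π i) → f = g)
    (hF : ∀ i, X.IsPreservedBy (F i).mor) (hP : X.IsPreservedBy P) (law : P ≫ Y.T ⟶ X.T ≫ P)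
    (hlaw : ∀ i, law ≫ X.T ◁ π i = π i ▷ Y.T ≫ (F i).law) : IsColaxLaw X Y P law := by
  have hF' := fun i => (F i).isColax
  have hstack := fun i => stackLaw_whiskerLeft (hlaw i) (hlaw i)
  refine .of_isPreservedBy hP ?_ ?_ (fun law₂ h₁ h₂ => ?_) ?_ ?_
  · refine hπ _ _ _ fun i => ?_
    obtain ⟨law₂, h, -⟩ := (hF' i).additive
    rw [isMorphismVia_iff] at h
    simp only [Category.assoc, ← whisker_exchange, reassoc_of% (hlaw i), h.2.2.1]
    rw [← whisker_exchange_assoc]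
    simp
  · refine hπ _ _ _ fun i => ?_
    obtain ⟨law₂, h, -⟩ := (hF' i).additive
    rw [isMorphismVia_iff] at h
    simp only [Category.assoc, ← whisker_exchange, hlaw i]
    rw [whisker_exchange_assoc, ← h.2.2.2.1]
    simp
  · refine hπ _ _ _ fun i => ?_
    obtain ⟨law₂', h, -⟩ := (hF' i).additive
    rw [isMorphismVia_iff] at h
    -- The law on `T₂` attached to `F i` is only given by existence. Since `F i` preserves `T₂`, it
    -- can be compared with `law₂` on the two projections.
    have key : law₂ ≫ X.T₂ ◁ π i = π i ▷ Y.T₂ ≫ law₂' := by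
      apply (hF i).1.hom_ext
      · rw [Category.assoc, whisker_exchange, reassoc_of% h₁, hlaw, Category.assoc, h.1,
          whisker_exchange_assoc]
      · rw [Category.assoc, whisker_exchange, reassoc_of% h₂, hlaw, Category.assoc, h.2.1,
          whisker_exchange_assoc]
    rw [Category.assoc, Category.assoc, ← whisker_exchange, reassoc_of% key, h.2.2.2.2, hlaw,
      whisker_exchange_assoc]
  · refine hπ _ _ _ fun i => ?_
    simp only [Category.assoc, ← whisker_exchange, reassoc_of% (hlaw i), hstack]
    rw [whisker_exchange_assoc, (hF' i).lift]
  · refine hπ _ _ _ fun i => ?_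
    simp only [Category.assoc, ← whisker_exchange, reassoc_of% (hstack i), hstack]
    rw [whisker_exchange_assoc, (hF' i).flip]

end Laws

/-! ### The forgetful 2-functor preserves and reflects pointwise limits -/

section Forget

variable {K : Type u} [Bicategory.{w, v} K]

namespace Tangentad

/-- The map induced in the underlying category is automatically compatible with the laws. Both sides
of the compatibility land in `X.T ≫ P.mor`, where `hT` makes the two projections jointly monic. -/
theorem isPullback_of_isPullback_hom {X Y : Tangentad K} {P A B C : X ⟶ Y} {fst : P ⟶ A}
    {snd : P ⟶ B} {f : A ⟶ C} {g : B ⟶ C} (h : IsPullback fst.hom snd.hom f.hom g.hom)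
    (hT : IsPullback (X.T ◁ fst.hom) (X.T ◁ snd.hom) (X.T ◁ f.hom) (X.T ◁ g.hom)) :
    IsPullback fst snd f g := by
  refine isPullback_iff_existsUnique.2 ⟨hom₂_ext h.w, fun W x y hxy => ?_⟩
  have hxy' : x.hom ≫ f.hom = y.hom ≫ g.hom := congrArg ColaxHom₂.hom hxy
  let t : W ⟶ P := ⟨h.lift x.hom y.hom hxy', by
    apply hT.hom_ext
    · rw [Category.assoc, Category.assoc, fst.comm, ← whiskerLeft_comp, IsPullback.lift_fst,
        x.comm, ← comp_whiskerRight_assoc, IsPullback.lift_fst]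
    · rw [Category.assoc, Category.assoc, snd.comm, ← whiskerLeft_comp, IsPullback.lift_snd,
        y.comm, ← comp_whiskerRight_assoc, IsPullback.lift_snd]⟩
  refine ⟨t, ⟨hom₂_ext (h.lift_fst _ _ _), hom₂_ext (h.lift_snd _ _ _)⟩, fun t' ⟨h₁, h₂⟩ =>
    hom₂_ext (h.hom_ext ?_ ?_)⟩
  · exact (congrArg ColaxHom₂.hom h₁).trans (h.lift_fst _ _ _).symm
  · exact (congrArg ColaxHom₂.hom h₂).trans (h.lift_snd _ _ _).symm

theorem isNFoldPullback_of_isNFoldPullback_hom {n : ℕ} {X Y : Tangentad K} {P E B : X ⟶ Y}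
    {q : E ⟶ B} {b : P ⟶ B} {π : Fin n → (P ⟶ E)}
    (h : IsNFoldPullback q.hom b.hom fun i => (π i).hom)
    (hT : IsNFoldPullback (X.T ◁ q.hom) (X.T ◁ b.hom) fun i => X.T ◁ (π i).hom) :
    IsNFoldPullback q b π := by
  refine .mk' (fun i => hom₂_ext (h.w i)) (fun {W} β x hx => ?_) fun {W t t'} hb hπ =>
    hom₂_ext (h.hom_ext (congrArg ColaxHom₂.hom hb) fun i => congrArg ColaxHom₂.hom (hπ i))
  obtain ⟨t, ht, ht'⟩ := h.exists_lift β.hom (fun i => (x i).hom)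
    fun i => congrArg ColaxHom₂.hom (hx i)
  refine ⟨⟨t, hT.hom_ext ?_ fun i => ?_⟩, hom₂_ext ht, fun i => hom₂_ext (ht' i)⟩
  · rw [Category.assoc, Category.assoc, b.comm, ← whiskerLeft_comp, ht, β.comm,
      ← comp_whiskerRight_assoc, ht]
  · rw [Category.assoc, Category.assoc, (π i).comm, ← whiskerLeft_comp, ht', (x i).comm,
      ← comp_whiskerRight_assoc, ht']

/-- The forgetful `2`-functor reflects pointwise pullbacks. -/
theorem isPointwisePullback_of_hom {X Y : Tangentad K} {P A B C : X ⟶ Y} {fst : P ⟶ A}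
    {snd : P ⟶ B} {f : A ⟶ C} {g : B ⟶ C}
    (h : IsPointwisePullback fst.hom snd.hom f.hom g.hom) : IsPointwisePullback fst snd f g :=
  isPointwisePullback_of_forall fun F =>
    -- Whiskering with the tangent `1`-morphism of the new source is one more precomposition, so
    -- pointwiseness covers it.
    isPullback_of_isPullback_hom (h.2 F.mor) ((h.whiskerLeft F.mor).2 _)

/-- The forgetful `2`-functor reflects pointwise `n`-fold pullbacks. -/
theorem isPointwiseNFoldPullback_of_hom {n : ℕ} {X Y : Tangentad K} {P E B : X ⟶ Y}
    {q : E ⟶ B} {b : P ⟶ B} {π : Fin n → (P ⟶ E)}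
    (h : IsPointwiseNFoldPullback q.hom b.hom fun i => (π i).hom) :
    IsPointwiseNFoldPullback q b π :=
  isPointwiseNFoldPullback_of_forall fun {W} F =>
    isNFoldPullback_of_isNFoldPullback_hom (h.2 F.mor) ((h.2 (W.T ≫ F.mor)).of_iso (α_ _ _ _)
      (α_ _ _ _) (α_ _ _ _) (by simp) (by simp) (by simp))

end Tangentad

/-- A form of the axioms of an additive bundle which does not mention the maps induced by the
pullback. -/
theorem BundleData.IsAdditive.of_forall {C : Type u} [Category.{v} C] {b : BundleData C}
    (isPullback : IsPullback b.π₁ b.π₂ b.q b.q)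
    (nfold : ∀ n : ℕ, 1 ≤ n → ∃ (P : C) (β : P ⟶ b.B) (π : Fin n → (P ⟶ b.E)),
      IsNFoldPullback b.q β π)
    (z_q : b.z ≫ b.q = 𝟙 b.B) (s_q : b.s ≫ b.q = b.π₁ ≫ b.q)
    (assoc : ∀ {W : C} (x y f g : W ⟶ b.E₂), x ≫ b.π₂ = y ≫ b.π₁ → f ≫ b.π₁ = x ≫ b.s →
      f ≫ b.π₂ = y ≫ b.π₂ → g ≫ b.π₁ = x ≫ b.π₁ → g ≫ b.π₂ = y ≫ b.s → f ≫ b.s = g ≫ b.s)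
    (unit : ∀ x : b.E ⟶ b.E₂, x ≫ b.π₁ = b.q ≫ b.z → x ≫ b.π₂ = 𝟙 b.E → x ≫ b.s = 𝟙 b.E)
    (comm : ∀ x : b.E₂ ⟶ b.E₂, x ≫ b.π₁ = b.π₂ → x ≫ b.π₂ = b.π₁ → x ≫ b.s = b.s) :
    b.IsAdditive where
  isPullback := isPullback
  nfold := nfold
  z_q := z_q
  s_q := s_q
  assoc x y t hxy hyt := assoc (isPullback.lift x y hxy) (isPullback.lift y t hyt) _ _
    (by simp) (by simp) (by simp) (by simp) (by simp)
  unit := unit _ (by simp) (by simp)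
  comm := comm _ (by simp) (by simp)

theorem BundleData.IsAdditive.lift_assoc {C : Type u} [Category.{v} C] {b : BundleData C}
    (h : b.IsAdditive) {W : C} (x y f g : W ⟶ b.E₂) (hxy : x ≫ b.π₂ = y ≫ b.π₁)
    (h₁ : f ≫ b.π₁ = x ≫ b.s) (h₂ : f ≫ b.π₂ = y ≫ b.π₂) (h₃ : g ≫ b.π₁ = x ≫ b.π₁)
    (h₄ : g ≫ b.π₂ = y ≫ b.s) : f ≫ b.s = g ≫ b.s := by
  have hx : (x ≫ b.π₁) ≫ b.q = (x ≫ b.π₂) ≫ b.q := by simp [h.isPullback.w]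
  have hy : (x ≫ b.π₂) ≫ b.q = (y ≫ b.π₂) ≫ b.q := by simp [hxy, h.isPullback.w]
  have key := h.assoc (x ≫ b.π₁) (x ≫ b.π₂) (y ≫ b.π₂) hx hy
  have e₁ : h.isPullback.lift _ _ hx = x := h.isPullback.hom_ext (by simp) (by simp)
  have e₂ : h.isPullback.lift _ _ hy = y := h.isPullback.hom_ext (by simp [hxy]) (by simp)
  simp only [e₁, e₂] at key
  convert key using 2
  · exact h.isPullback.hom_ext (by simp [h₁]) (by simp [h₂])
  · exact h.isPullback.hom_ext (by simp [h₃]) (by simp [h₄])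

theorem BundleData.IsAdditive.lift_unit {C : Type u} [Category.{v} C] {b : BundleData C}
    (h : b.IsAdditive) (x : b.E ⟶ b.E₂) (h₁ : x ≫ b.π₁ = b.q ≫ b.z) (h₂ : x ≫ b.π₂ = 𝟙 b.E) :
    x ≫ b.s = 𝟙 b.E := by
  rw [← h.unit]
  congr 1
  exact h.isPullback.hom_ext (by simp [h₁]) (by simp [h₂])

theorem BundleData.IsAdditive.lift_comm {C : Type u} [Category.{v} C] {b : BundleData C}
    (h : b.IsAdditive) (x : b.E₂ ⟶ b.E₂) (h₁ : x ≫ b.π₁ = b.π₂) (h₂ : x ≫ b.π₂ = b.π₁) :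
    x ≫ b.s = b.s := by
  conv_rhs => rw [← h.comm]
  congr 1
  exact h.isPullback.hom_ext (by simp [h₁]) (by simp [h₂])

/-- A form of the axioms of a tangent structure in which the additive bundles are unfolded. -/
theorem TangentData.IsTangent.of_forall {Y : K} {T T₂ : Y ⟶ Y} {π₁ π₂ : T₂ ⟶ T} {p : T ⟶ 𝟙 Y}
    {z : 𝟙 Y ⟶ T} {s : T₂ ⟶ T} {l : T ⟶ T ≫ T} {c : T ≫ T ⟶ T ≫ T}
    (pullback : ∀ k : ℕ, IsPointwisePullback (π₁ ▷ iterate T k) (π₂ ▷ iterate T k)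
      (p ▷ iterate T k) (p ▷ iterate T k))
    (nfold : ∀ n : ℕ, 1 ≤ n → ∃ (Tn : Y ⟶ Y) (b : Tn ⟶ 𝟙 Y) (π : Fin n → (Tn ⟶ T)),
      ∀ k : ℕ, IsPointwiseNFoldPullback (p ▷ iterate T k) (b ▷ iterate T k)
        (fun i => π i ▷ iterate T k))
    (z_p : z ≫ p = 𝟙 (𝟙 Y)) (s_p : s ≫ p = π₁ ≫ p)
    (assoc : ∀ {W : Y ⟶ Y} (x y f g : W ⟶ T₂), x ≫ π₂ = y ≫ π₁ → f ≫ π₁ = x ≫ s →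
      f ≫ π₂ = y ≫ π₂ → g ≫ π₁ = x ≫ π₁ → g ≫ π₂ = y ≫ s → f ≫ s = g ≫ s)
    (unit : ∀ x : T ⟶ T₂, x ≫ π₁ = p ≫ z → x ≫ π₂ = 𝟙 T → x ≫ s = 𝟙 T)
    (comm : ∀ x : T₂ ⟶ T₂, x ≫ π₁ = π₂ → x ≫ π₂ = π₁ → x ≫ s = s)
    (lift_additive : ∃ g : T₂ ⟶ T₂ ≫ T, g ≫ π₁ ▷ T = π₁ ≫ l ∧ g ≫ π₂ ▷ T = π₂ ≫ l ∧
      l ≫ p ▷ T = p ≫ z ≫ (λ_ T).inv ∧ z ≫ l = (z ≫ (λ_ T).inv) ≫ z ▷ T ∧ s ≫ l = g ≫ s ▷ T)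
    (flip_additive : ∃ g : T₂ ≫ T ⟶ T ≫ T₂, g ≫ T ◁ π₁ = π₁ ▷ T ≫ c ∧ g ≫ T ◁ π₂ = π₂ ▷ T ≫ c ∧
      c ≫ T ◁ p = p ▷ T ≫ (λ_ T).hom ≫ (ρ_ T).inv ∧
      z ▷ T ≫ c = ((λ_ T).hom ≫ (ρ_ T).inv) ≫ T ◁ z ∧ s ▷ T ≫ c = g ≫ T ◁ s)
    (l_coassoc : l ≫ l ▷ T ≫ (α_ T T T).hom = l ≫ T ◁ l)
    (l_c : l ≫ c = l)
    (lift_flip : T ◁ l ≫ (α_ T T T).inv ≫ c ▷ T ≫ (α_ T T T).hom ≫ T ◁ c =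
      c ≫ l ▷ T ≫ (α_ T T T).hom)
    (c_c : c ≫ c = 𝟙 _)
    (yang_baxter : c ▷ T ≫ (α_ T T T).hom ≫ T ◁ c ≫ (α_ T T T).inv ≫ c ▷ T =
      (α_ T T T).hom ≫ T ◁ c ≫ (α_ T T T).inv ≫ c ▷ T ≫ (α_ T T T).hom ≫ T ◁ c ≫ (α_ T T T).inv)
    (local_linearity : ∃ v : T₂ ⟶ T₂ ≫ T, v ≫ π₁ ▷ T = π₁ ≫ (ρ_ T).inv ≫ T ◁ z ∧
      v ≫ π₂ ▷ T = π₂ ≫ l ∧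
      IsPointwisePullback (v ≫ s ▷ T) (π₁ ≫ p) (p ▷ T ≫ (λ_ T).hom) z) :
    (TangentData.mk Y T T₂ π₁ π₂ p z s l c).IsTangent := by
  -- The zeroth iterate of `T` is the identity, so `k = 0` gives the unwhiskered pullback up to
  -- right unitors.
  have hpb : IsPullback π₁ π₂ p p := by
    have h : IsPointwisePullback (π₁ ▷ 𝟙 Y) (π₂ ▷ 𝟙 Y) (p ▷ 𝟙 Y) (p ▷ 𝟙 Y) := pullback 0
    exact h.1.of_iso (ρ_ T₂) (ρ_ T) (ρ_ T) (ρ_ (𝟙 Y)) (by simp) (by simp) (by simp) (by simp)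
  have hnf : ∀ n : ℕ, 1 ≤ n → ∃ (Tn : Y ⟶ Y) (b : Tn ⟶ 𝟙 Y) (π : Fin n → (Tn ⟶ T)),
      IsNFoldPullback p b π := fun n hn => by
    obtain ⟨Tn, b, π, h⟩ := nfold n hn
    have h' : IsPointwiseNFoldPullback (p ▷ 𝟙 Y) (b ▷ 𝟙 Y) (fun i => π i ▷ 𝟙 Y) := h 0
    exact ⟨Tn, b, π, h'.1.of_iso (ρ_ Tn) (ρ_ T) (ρ_ (𝟙 Y)) (by simp) (by simp) (by simp)⟩
  obtain ⟨g, h₁, h₂, h₃, h₄, h₅⟩ := lift_additive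
  obtain ⟨g', h₁', h₂', h₃', h₄', h₅'⟩ := flip_additive
  exact
  { additive := .of_forall hpb hnf z_p s_p assoc unit comm
    pullback := pullback
    nfold := nfold
    lift_additive := ⟨g, h₁, h₂, h₃, h₄, h₅⟩
    flip_additive := ⟨g', h₁', h₂', h₃', h₄', h₅'⟩
    l_coassoc := l_coassoc
    l_c := l_c
    lift_flip := lift_flip
    c_c := c_c
    yang_baxter := yang_baxter
    local_linearity := local_linearity }

theorem isPointwisePullback_of_isIso {X Y : K} {P A B C : X ⟶ Y} {fst : P ⟶ A} {snd : P ⟶ B}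
    {f : A ⟶ C} {g : B ⟶ C} [IsIso snd] [IsIso f] (hw : fst ≫ f = snd ≫ g) :
    IsPointwisePullback fst snd f g :=
  isPointwisePullback_of_forall fun h =>
    .of_vert_isIso ⟨by rw [← whiskerLeft_comp, hw, whiskerLeft_comp]⟩


/-- The data of the tangent structure whose tangent bundle `1`-morphism is the identity. -/
@[reducible]
def TangentData.trivial (Y : K) : TangentData K :=
  ⟨Y, 𝟙 Y, 𝟙 Y, 𝟙 _, 𝟙 _, 𝟙 _, 𝟙 _, 𝟙 _, (λ_ (𝟙 Y)).inv, 𝟙 _⟩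

/-- All structural `2`-morphisms are invertible, so every required square is a pullback and the
identity serves as every `n`-fold pullback. -/
theorem TangentData.trivial_isTangent (Y : K) : (TangentData.trivial Y).IsTangent := by
  refine .of_forall (fun k => isPointwisePullback_of_isIso rfl)
    (fun n _ => ⟨𝟙 Y, 𝟙 _, fun _ => 𝟙 _, fun k =>
      isPointwiseNFoldPullback_of_forall fun h => .of_isIso _ (by simp)⟩)
    (by simp) (by simp) ?_ ?_ ?_ ⟨(λ_ (𝟙 Y)).inv, ?_⟩ ⟨𝟙 _, ?_⟩ ?_ ?_ ?_ ?_ ?_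
    ⟨(λ_ (𝟙 Y)).inv, ?_, ?_, isPointwisePullback_of_isIso ?_⟩
  · intro W x y f g h₁ h₂ h₃ h₄ h₅
    simp_all
  all_goals simp

/-- The trivial tangentad on an object. -/
@[reducible]
def Tangentad.trivial (Y : K) : Tangentad K where
  toTangentData := .trivial Y
  isTangent := TangentData.trivial_isTangent Y

namespace Tangentad

@[simp]
theorem z_p (X : Tangentad K) : X.z ≫ X.p = 𝟙 (𝟙 X.base) :=
  X.isTangent.additive.z_q

@[simp]
theorem s_p (X : Tangentad K) : X.s ≫ X.p = X.π₁ ≫ X.p :=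
  X.isTangent.additive.s_q

theorem l_p (X : Tangentad K) : X.l ≫ X.p ▷ X.T = X.p ≫ X.z ≫ (λ_ X.T).inv := by
  obtain ⟨g, h⟩ := X.isTangent.lift_additive
  exact h.q

/-- The axioms give the relation with `p` on the other factor; composing with the involution `c`
exchanges the two factors. The same argument gives `whiskerLeft_z_c`. -/
theorem c_whiskerRight_p (X : Tangentad K) :
    X.c ≫ X.p ▷ X.T = X.T ◁ X.p ≫ (ρ_ X.T).hom ≫ (λ_ X.T).inv := by
  have h : X.T ◁ X.p = X.c ≫ X.p ▷ X.T ≫ (λ_ X.T).hom ≫ (ρ_ X.T).inv := by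
    rw [← X.c_projection, ← Category.assoc, X.isTangent.c_c, Category.id_comp]
  rw [h]
  simp

theorem z_whiskerRight_c (X : Tangentad K) :
    X.z ▷ X.T ≫ X.c = ((λ_ X.T).hom ≫ (ρ_ X.T).inv) ≫ X.T ◁ X.z := by
  obtain ⟨g, h⟩ := X.isTangent.flip_additive
  exact h.z

theorem whiskerLeft_z_c (X : Tangentad K) :
    X.T ◁ X.z ≫ X.c = ((ρ_ X.T).hom ≫ (λ_ X.T).inv) ≫ X.z ▷ X.T := by
  have h : X.T ◁ X.z = ((ρ_ X.T).hom ≫ (λ_ X.T).inv) ≫ X.z ▷ X.T ≫ X.c := by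
    rw [X.z_whiskerRight_c]
    simp
  rw [h]
  simp only [Category.assoc, X.isTangent.c_c, Category.comp_id]

/-- The witness in `flip_additive` has the same projections as `flip₂`, hence equals it. -/
theorem s_whiskerRight_c (X : Tangentad K) : X.s ▷ X.T ≫ X.c = X.flip₂ ≫ X.T ◁ X.s := by
  obtain ⟨g, h⟩ := X.isTangent.flip_additive
  have : g = X.flip₂ := (X.isPullback_whiskerLeft X.T).hom_ext
    (h.π₁.trans X.flip₂_π₁.symm) (h.π₂.trans X.flip₂_π₂.symm)
  exact this ▸ h.s

theorem stackLaw_trivial {X : Tangentad K} {Y : K} {F : Y ⟶ X.base}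
    {law : F ≫ X.T ⟶ 𝟙 Y ≫ F} (h : law = F ◁ X.p ≫ (ρ_ F).hom ≫ (λ_ F).inv) :
    stackLaw law law = F ◁ (X.p ▷ X.T ≫ (λ_ X.T).hom ≫ X.p) ≫ (ρ_ F).hom ≫ (λ_ F).inv ≫
      (λ_ (𝟙 Y)).inv ▷ F := by
  subst h
  simp only [stackLaw]
  bicategory

/-- The pullback square of the trivial tangentad consists of identities and is preserved by every
`F`, so only the equations on the law itself remain. They follow from the relations of `p` with `z`,
`s`, `l` and `c`. -/
theorem isColaxLaw_trivial (X : Tangentad K) {Y : K} (F : Y ⟶ X.base) :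
    IsColaxLaw (trivial Y) X F (F ◁ X.p ≫ (ρ_ F).hom ≫ (λ_ F).inv) := by
  refine .of_isPreservedBy (X := trivial Y) (isPointwisePullback_of_isIso rfl) ?_ ?_
    (fun law₂ h₁ h₂ => ?_) ?_ ?_
  · simp
  · rw [← whiskerLeft_comp_assoc, X.z_p]
    simp
  · rw [← whiskerLeft_comp_assoc, X.s_p, h₁]
    simp
  · rw [stackLaw_trivial rfl, ← whiskerLeft_comp_assoc, reassoc_of% X.l_p, Iso.inv_hom_id_assoc, X.z_p,
      Category.comp_id]
    simp
  -- The flip exchanges the two ways of projecting `T ≫ T` to the identity, and these agree by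
  -- interchange.
  · rw [stackLaw_trivial rfl, ← whiskerLeft_comp_assoc, reassoc_of% X.c_whiskerRight_p,
      Iso.inv_hom_id_assoc, ← leftUnitor_naturality, ← whisker_exchange_assoc]
    bicategory

/-- Every `1`-morphism out of an object is a colax tangent morphism out of the trivial
tangentad. -/
def ofTrivial (X : Tangentad K) {Y : K} (F : Y ⟶ X.base) : trivial Y ⟶ X :=
  ColaxHom.mk F _ (X.isColaxLaw_trivial F)

/-- The projection of the trivial tangentad is an identity, so compatibility with projections
determines the law completely. -/
theorem law_of_trivial {X : Tangentad K} {Y : K} (F : trivial Y ⟶ X) :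
    F.law = F.mor ◁ X.p ≫ (ρ_ F.mor).hom ≫ (λ_ F.mor).inv := by
  obtain ⟨law₂, h, -⟩ := F.isColax.additive
  have h' := ((isMorphismVia_iff _ _ _ _ _).1 h).2.2.1
  rwa [id_whiskerRight, Category.comp_id] at h'

/-- The functor underlying the forgetful `2`-functor, on the colax tangent morphisms out of a
trivial tangentad. -/
def forgetTrivial (Y : K) (X : Tangentad K) : (trivial Y ⟶ X) ⥤ (Y ⟶ X.base) where
  obj F := F.mor
  map φ := φ.hom

/-- Fullness uses that both laws are the forced one, with which every `2`-morphism is compatible by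
interchange. Being an equivalence, the functor preserves pullbacks. -/
instance (Y : K) (X : Tangentad K) : (forgetTrivial Y X).IsEquivalence where
  faithful := ⟨fun {_ _ _ _} h => hom₂_ext h⟩
  full := ⟨fun {F G} (φ : F.mor ⟶ G.mor) => ⟨⟨φ, by
    rw [law_of_trivial, law_of_trivial, ← whisker_exchange_assoc]
    simp⟩, rfl⟩⟩
  essSurj := ⟨fun F => ⟨X.ofTrivial F, ⟨Iso.refl _⟩⟩⟩

/-- The forgetful `2`-functor preserves pointwise pullbacks. -/
theorem isPointwisePullback_hom {X Y : Tangentad K} {P A B C : X ⟶ Y} {fst : P ⟶ A}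
    {snd : P ⟶ B} {f : A ⟶ C} {g : B ⟶ C} (h : IsPointwisePullback fst snd f g) :
    IsPointwisePullback fst.hom snd.hom f.hom g.hom :=
  -- Precomposition with `k` in `K` is precomposition with `ofTrivial k` in `Tng_co(K)` followed by
  -- the equivalence `forgetTrivial`.
  isPointwisePullback_of_forall fun {W} k =>
    (h.2 (X.ofTrivial k)).map (forgetTrivial W Y)

end Tangentad

end Forget

/-! ### Transport of laws along a strict 2-functor -/

section MapLaw

variable {K : Type u} [Bicategory.{w, v} K] {L : Type u'} [Bicategory.{w', v'} L]

/-- The image of a law under a strict `2`-functor. -/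
def mapLaw (Γ : StrictPseudofunctor K L) {X Y Y' Z : K} {f : X ⟶ Y} {g : Y ⟶ Z} {h : X ⟶ Y'}
    {k : Y' ⟶ Z} (σ : f ≫ g ⟶ h ≫ k) : Γ.map f ≫ Γ.map g ⟶ Γ.map h ≫ Γ.map k :=
  (Γ.mapComp f g).inv ≫ Γ.map₂ σ ≫ (Γ.mapComp h k).hom

variable (Γ : StrictPseudofunctor K L)

/-- This and the next few identities are oriented so as to gather a composite in `L` under a single
`Γ.map₂`, where the axioms in `K` apply, while the comparison cells in between cancel. -/
theorem map₂_whiskerRight_map {X Y Z : K} {f g : X ⟶ Y} (x : f ⟶ g) (h : Y ⟶ Z) :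
    Γ.map₂ x ▷ Γ.map h = (Γ.mapComp f h).inv ≫ Γ.map₂ (x ▷ h) ≫ (Γ.mapComp g h).hom := by
  simp

theorem map_whiskerLeft_map₂ {X Y Z : K} (f : X ⟶ Y) {g h : Y ⟶ Z} (x : g ⟶ h) :
    Γ.map f ◁ Γ.map₂ x = (Γ.mapComp f g).inv ≫ Γ.map₂ (f ◁ x) ≫ (Γ.mapComp f h).hom := by
  simp

theorem associator_map_hom {X Y Z W : K} (f : X ⟶ Y) (g : Y ⟶ Z) (h : Z ⟶ W) :
    (α_ (Γ.map f) (Γ.map g) (Γ.map h)).hom =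
      (Γ.mapComp f g).inv ▷ Γ.map h ≫ (Γ.mapComp (f ≫ g) h).inv ≫ Γ.map₂ (α_ f g h).hom ≫
        (Γ.mapComp f (g ≫ h)).hom ≫ Γ.map f ◁ (Γ.mapComp g h).hom := by
  simp

theorem associator_map_inv {X Y Z W : K} (f : X ⟶ Y) (g : Y ⟶ Z) (h : Z ⟶ W) :
    (α_ (Γ.map f) (Γ.map g) (Γ.map h)).inv =
      Γ.map f ◁ (Γ.mapComp g h).inv ≫ (Γ.mapComp f (g ≫ h)).inv ≫ Γ.map₂ (α_ f g h).inv ≫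
        (Γ.mapComp (f ≫ g) h).hom ≫ (Γ.mapComp f g).hom ▷ Γ.map h := by
  rw [← cancel_epi (α_ (Γ.map f) (Γ.map g) (Γ.map h)).hom, Iso.hom_inv_id, associator_map_hom]
  simp only [Category.assoc, whiskerLeft_hom_inv_assoc, Iso.hom_inv_id_assoc,
    ← PrelaxFunctor.map₂_comp_assoc, Iso.hom_inv_id, PrelaxFunctor.map₂_id, Category.id_comp,
    Iso.inv_hom_id_assoc, inv_hom_whiskerRight]

theorem leftUnitor_map_hom {X Y : K} (f : X ⟶ Y) :
    (λ_ (Γ.map f)).hom = (Γ.mapId X).inv ▷ Γ.map f ≫ (Γ.mapComp (𝟙 X) f).inv ≫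
      Γ.map₂ (λ_ f).hom := by
  simp

theorem rightUnitor_map_hom {X Y : K} (f : X ⟶ Y) :
    (ρ_ (Γ.map f)).hom = Γ.map f ◁ (Γ.mapId Y).inv ≫ (Γ.mapComp f (𝟙 Y)).inv ≫
      Γ.map₂ (ρ_ f).hom := by
  simp

theorem leftUnitor_map_inv {X Y : K} (f : X ⟶ Y) :
    (λ_ (Γ.map f)).inv = Γ.map₂ (λ_ f).inv ≫ (Γ.mapComp (𝟙 X) f).hom ≫
      (Γ.mapId X).hom ▷ Γ.map f := by
  rw [← cancel_epi (λ_ (Γ.map f)).hom, Iso.hom_inv_id, leftUnitor_map_hom]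
  simp only [Category.assoc, ← PrelaxFunctor.map₂_comp_assoc, Iso.hom_inv_id,
    PrelaxFunctor.map₂_id, Category.id_comp, Iso.inv_hom_id_assoc, inv_hom_whiskerRight]

theorem rightUnitor_map_inv {X Y : K} (f : X ⟶ Y) :
    (ρ_ (Γ.map f)).inv = Γ.map₂ (ρ_ f).inv ≫ (Γ.mapComp f (𝟙 Y)).hom ≫
      Γ.map f ◁ (Γ.mapId Y).hom := by
  rw [← cancel_epi (ρ_ (Γ.map f)).hom, Iso.hom_inv_id, rightUnitor_map_hom]
  simp only [Category.assoc, ← PrelaxFunctor.map₂_comp_assoc, Iso.hom_inv_id,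
    PrelaxFunctor.map₂_id, Category.id_comp, Iso.inv_hom_id_assoc, whiskerLeft_inv_hom]

theorem stackLaw_mapLaw {X Y : K} {F : X ⟶ Y} {S T : X ⟶ X} {S' T' : Y ⟶ Y}
    (σ : F ≫ S' ⟶ S ≫ F) (τ : F ≫ T' ⟶ T ≫ F) :
    stackLaw (mapLaw Γ σ) (mapLaw Γ τ) =
      Γ.map F ◁ (Γ.mapComp S' T').inv ≫ mapLaw Γ (stackLaw σ τ) ≫
        (Γ.mapComp S T).hom ▷ Γ.map F := by
  simp only [stackLaw, mapLaw, comp_whiskerRight, whiskerLeft_comp, associator_map_hom,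
    associator_map_inv, map₂_whiskerRight_map, map_whiskerLeft_map₂, Category.assoc,
    Iso.hom_inv_id_assoc, hom_inv_whiskerRight_assoc,
    whiskerLeft_hom_inv_assoc, PrelaxFunctor.map₂_comp]

theorem compLaw_mapLaw {X Y Z : K} {F : X ⟶ Y} {G : Y ⟶ Z} {T : X ⟶ X} {T' : Y ⟶ Y} {T'' : Z ⟶ Z}
    (σ : F ≫ T' ⟶ T ≫ F) (τ : G ≫ T'' ⟶ T' ≫ G) :
    compLaw (mapLaw Γ σ) (mapLaw Γ τ) =
      (Γ.mapComp F G).inv ▷ Γ.map T'' ≫ mapLaw Γ (compLaw σ τ) ≫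
        Γ.map T ◁ (Γ.mapComp F G).hom := by
  simp only [compLaw, mapLaw, comp_whiskerRight, whiskerLeft_comp, associator_map_hom,
    associator_map_inv, map₂_whiskerRight_map, map_whiskerLeft_map₂, Category.assoc,
    Iso.hom_inv_id_assoc, hom_inv_whiskerRight_assoc,
    whiskerLeft_hom_inv_assoc, PrelaxFunctor.map₂_comp]

theorem mapLaw_idLaw {X : K} (T : X ⟶ X) :
    mapLaw Γ (idLaw T) =
      (Γ.mapId X).hom ▷ Γ.map T ≫ idLaw (Γ.map T) ≫ Γ.map T ◁ (Γ.mapId X).inv := by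
  simp only [mapLaw, idLaw, leftUnitor_map_hom, rightUnitor_map_inv, Category.assoc,
    hom_inv_whiskerRight_assoc, whiskerLeft_hom_inv, Category.comp_id, PrelaxFunctor.map₂_comp]

theorem mapLaw_unit {X Y : K} (F : X ⟶ Y) :
    mapLaw Γ ((ρ_ F).hom ≫ (λ_ F).inv) =
      Γ.map F ◁ (Γ.mapId Y).hom ≫ ((ρ_ (Γ.map F)).hom ≫ (λ_ (Γ.map F)).inv) ≫
        (Γ.mapId X).inv ▷ Γ.map F := by
  simp only [mapLaw, rightUnitor_map_hom, leftUnitor_map_inv, Category.assoc,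
    hom_inv_whiskerRight, whiskerLeft_hom_inv_assoc, Category.comp_id, PrelaxFunctor.map₂_comp]

/-- Naturality of a law, in the two positions in which the `2`-morphisms `x` and `y` can occur. -/
theorem mapLaw_naturality {X Y Y' Z : K} {f : X ⟶ Y} {g g' : Y ⟶ Z} {h h' : X ⟶ Y'} {k : Y' ⟶ Z}
    {σ : f ≫ g ⟶ h ≫ k} {τ : f ≫ g' ⟶ h' ≫ k} {x : h ⟶ h'} {y : g ⟶ g'}
    (e : σ ≫ x ▷ k = f ◁ y ≫ τ) :
    mapLaw Γ σ ≫ Γ.map₂ x ▷ Γ.map k = Γ.map f ◁ Γ.map₂ y ≫ mapLaw Γ τ := by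
  simp only [mapLaw, map₂_whiskerRight_map, map_whiskerLeft_map₂, Category.assoc,
    Iso.hom_inv_id_assoc, ← PrelaxFunctor.map₂_comp_assoc, e]

theorem mapLaw_naturality' {X Y Y' Z : K} {f f' : X ⟶ Y} {g : Y ⟶ Z} {h : X ⟶ Y'}
    {k k' : Y' ⟶ Z} {σ : f ≫ g ⟶ h ≫ k} {τ : f' ≫ g ⟶ h ≫ k'} {x : k ⟶ k'} {y : f ⟶ f'}
    (e : σ ≫ h ◁ x = y ▷ g ≫ τ) :
    mapLaw Γ σ ≫ Γ.map h ◁ Γ.map₂ x = Γ.map₂ y ▷ Γ.map g ≫ mapLaw Γ τ := by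
  simp only [mapLaw, map₂_whiskerRight_map, map_whiskerLeft_map₂, Category.assoc,
    Iso.hom_inv_id_assoc, ← PrelaxFunctor.map₂_comp_assoc, e]

end MapLaw

/-! ### Preservation of n-fold pullbacks and of iterates -/

section PreservesNFold

variable {K : Type u} [Bicategory.{w, v} K] {L : Type u'} [Bicategory.{w', v'} L]
  {Γ : StrictPseudofunctor K L}

/-- The `n + 1`-fold pointwise pullback is a pointwise pullback of the `n`-fold one. -/
theorem IsPointwiseNFoldPullback.isPointwisePullback_succ {n : ℕ} {X Y : K} {P P' E B : X ⟶ Y}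
    {q : E ⟶ B} {b : P ⟶ B} {π : Fin n → (P ⟶ E)} {b' : P' ⟶ B} {π' : Fin (n + 1) → (P' ⟶ E)}
    (h : IsPointwiseNFoldPullback q b π) (h' : IsPointwiseNFoldPullback q b' π') {r : P' ⟶ P}
    (hb : r ≫ b = b') (hr : ∀ i, r ≫ π i = π' i.succ) : IsPointwisePullback r (π' 0) b q :=
  ⟨h.1.isPullback_succ h'.1 hb hr, fun k => (h.2 k).isPullback_succ (h'.2 k)
    (by rw [← whiskerLeft_comp, hb]) fun i => by rw [← whiskerLeft_comp, hr]⟩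

/-- A pointwise pullback-preserving `2`-functor preserves pointwise `n`-fold pullbacks of a
`2`-morphism which has them for all `n`. -/
theorem PreservesPointwisePullbacks.map_nfold (hΓ : PreservesPointwisePullbacks Γ) {X : K}
    {E B : X ⟶ X} {q : E ⟶ B}
    (hq : ∀ n : ℕ, 1 ≤ n → ∃ (P : X ⟶ X) (b : P ⟶ B) (π : Fin n → (P ⟶ E)),
      IsPointwiseNFoldPullback q b π) {n : ℕ} (hn : 1 ≤ n) {P : X ⟶ X} {b : P ⟶ B}
    {π : Fin n → (P ⟶ E)} (h : IsPointwiseNFoldPullback q b π) :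
    IsPointwiseNFoldPullback (Γ.map₂ q) (Γ.map₂ b) fun i => Γ.map₂ (π i) := by
  induction n, hn using Nat.le_induction generalizing P with
  | base =>
    -- The projection of a `1`-fold pullback is invertible, and `Γ` preserves invertibility.
    have := h.1.isIso_one
    refine isPointwiseNFoldPullback_of_forall fun k => ?_
    have : IsIso (k ◁ Γ.map₂ (π 0)) := inferInstance
    exact IsNFoldPullback.of_isIso_one (π := fun i => k ◁ Γ.map₂ (π i))
      (by rw [← whiskerLeft_comp, ← PrelaxFunctor.map₂_comp, h.1.w])
  | succ m hm ih =>
    -- An `m`-fold pullback must exist in `K` for the `(m + 1)`-fold one to be a binary pullback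
    -- over it; `r` forgets the component of index `0`.
    obtain ⟨P₀, b₀, π₀, h₀⟩ := hq m hm
    obtain ⟨r, hb, hr⟩ := h₀.1.exists_lift b (fun i => π i.succ) fun i => h.1.w _
    have h₁ := hΓ (h₀.isPointwisePullback_succ h hb hr)
    refine isPointwiseNFoldPullback_of_forall fun k =>
      ((ih h₀).2 k).of_isPullback_succ (π' := fun i => k ◁ Γ.map₂ (π i)) (h₁.2 k) ?_ fun i => ?_
    · rw [← whiskerLeft_comp, ← PrelaxFunctor.map₂_comp, hb]
    · rw [← whiskerLeft_comp, ← PrelaxFunctor.map₂_comp, hr]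

/-- Strict `2`-functors commute with the iterates of a `1`-endomorphism. -/
def mapIterateIso (Γ : StrictPseudofunctor K L) {X : K} (T : X ⟶ X) :
    ∀ k : ℕ, Γ.map (iterate T k) ≅ iterate (Γ.map T) k
  | 0 => Γ.mapId X
  | k + 1 => Γ.mapComp (iterate T k) T ≪≫ whiskerRightIso (mapIterateIso Γ T k) (Γ.map T)

end PreservesNFold

/-! ### Images of tangentads and of colax laws -/

section MapTangentad

variable {K : Type u} [Bicategory.{w, v} K] {L : Type u'} [Bicategory.{w', v'} L]
  (Γ : StrictPseudofunctor K L)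

/-- The whiskered square still lies in a category of endomorphisms, so `Γ` preserves it; it then
remains to move across `Γ (T^k) ≅ (Γ T)^k` and `Γ 𝟙 ≅ 𝟙`. -/
theorem PreservesPointwisePullbacks.map_iterate {Γ : StrictPseudofunctor K L}
    (hΓ : PreservesPointwisePullbacks Γ) (X : Tangentad K) (k : ℕ) :
    IsPointwisePullback (Γ.map₂ X.π₁ ▷ iterate (Γ.map X.T) k)
      (Γ.map₂ X.π₂ ▷ iterate (Γ.map X.T) k)
      ((Γ.map₂ X.p ≫ (Γ.mapId X.base).hom) ▷ iterate (Γ.map X.T) k)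
      ((Γ.map₂ X.p ≫ (Γ.mapId X.base).hom) ▷ iterate (Γ.map X.T) k) := by
  have key : ∀ {F G : X.base ⟶ X.base} (x : F ⟶ G), Γ.map₂ (x ▷ iterate X.T k) ≫
      (Γ.mapComp G _ ≪≫ whiskerLeftIso (Γ.map G) (mapIterateIso Γ X.T k)).hom =
      (Γ.mapComp F _ ≪≫ whiskerLeftIso (Γ.map F) (mapIterateIso Γ X.T k)).hom ≫
        Γ.map₂ x ▷ iterate (Γ.map X.T) k := by
    intro F G x
    simp [whisker_exchange]
  refine (hΓ (X.isTangent.pullback k)).of_iso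
    (Γ.mapComp _ _ ≪≫ whiskerLeftIso _ (mapIterateIso Γ X.T k))
    (Γ.mapComp _ _ ≪≫ whiskerLeftIso _ (mapIterateIso Γ X.T k))
    (Γ.mapComp _ _ ≪≫ whiskerLeftIso _ (mapIterateIso Γ X.T k))
    ((Γ.mapComp _ _ ≪≫ whiskerLeftIso _ (mapIterateIso Γ X.T k)) ≪≫
      whiskerRightIso (Γ.mapId X.base) _) (key _) (key _) ?_ ?_
  all_goals rw [Iso.trans_hom, ← Category.assoc, key, comp_whiskerRight, whiskerRightIso_hom,
    Category.assoc]

theorem PreservesPointwisePullbacks.map_nfold_iterate {Γ : StrictPseudofunctor K L}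
    (hΓ : PreservesPointwisePullbacks Γ) (X : Tangentad K) {n : ℕ} (hn : 1 ≤ n)
    {P : X.base ⟶ X.base} {b : P ⟶ 𝟙 X.base} {π : Fin n → (P ⟶ X.T)} (k : ℕ)
    (h : IsPointwiseNFoldPullback (X.p ▷ iterate X.T k) (b ▷ iterate X.T k)
      fun i => π i ▷ iterate X.T k) :
    IsPointwiseNFoldPullback ((Γ.map₂ X.p ≫ (Γ.mapId X.base).hom) ▷ iterate (Γ.map X.T) k)
      ((Γ.map₂ b ≫ (Γ.mapId X.base).hom) ▷ iterate (Γ.map X.T) k)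
      fun i => Γ.map₂ (π i) ▷ iterate (Γ.map X.T) k := by
  have key : ∀ {F G : X.base ⟶ X.base} (x : F ⟶ G), Γ.map₂ (x ▷ iterate X.T k) ≫
      (Γ.mapComp G _ ≪≫ whiskerLeftIso (Γ.map G) (mapIterateIso Γ X.T k)).hom =
      (Γ.mapComp F _ ≪≫ whiskerLeftIso (Γ.map F) (mapIterateIso Γ X.T k)).hom ≫
        Γ.map₂ x ▷ iterate (Γ.map X.T) k := by
    intro F G x
    simp [whisker_exchange]
  have h' := hΓ.map_nfold (q := X.p ▷ iterate X.T k) (fun m hm => by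
    obtain ⟨P, b, π, h⟩ := X.isTangent.nfold m hm
    exact ⟨_, _, _, h k⟩) hn h
  refine h'.of_iso (Γ.mapComp _ _ ≪≫ whiskerLeftIso _ (mapIterateIso Γ X.T k))
    (Γ.mapComp _ _ ≪≫ whiskerLeftIso _ (mapIterateIso Γ X.T k))
    ((Γ.mapComp _ _ ≪≫ whiskerLeftIso _ (mapIterateIso Γ X.T k)) ≪≫
      whiskerRightIso (Γ.mapId X.base) _) ?_ ?_ fun i => key _
  all_goals rw [Iso.trans_hom, ← Category.assoc, key, comp_whiskerRight, whiskerRightIso_hom,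
    Category.assoc]

namespace Tangentad

theorem isPullback (X : Tangentad K) : IsPullback X.π₁ X.π₂ X.p X.p :=
  X.isTangent.additive.isPullback

theorem s_assoc (X : Tangentad K) {W : X.base ⟶ X.base} (x y f g : W ⟶ X.T₂)
    (hxy : x ≫ X.π₂ = y ≫ X.π₁) (h₁ : f ≫ X.π₁ = x ≫ X.s) (h₂ : f ≫ X.π₂ = y ≫ X.π₂)
    (h₃ : g ≫ X.π₁ = x ≫ X.π₁) (h₄ : g ≫ X.π₂ = y ≫ X.s) : f ≫ X.s = g ≫ X.s :=
  X.isTangent.additive.lift_assoc x y f g hxy h₁ h₂ h₃ h₄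

theorem s_unit (X : Tangentad K) (x : X.T ⟶ X.T₂) (h₁ : x ≫ X.π₁ = X.p ≫ X.z)
    (h₂ : x ≫ X.π₂ = 𝟙 X.T) : x ≫ X.s = 𝟙 X.T :=
  X.isTangent.additive.lift_unit x h₁ h₂

theorem s_comm (X : Tangentad K) (x : X.T₂ ⟶ X.T₂) (h₁ : x ≫ X.π₁ = X.π₂)
    (h₂ : x ≫ X.π₂ = X.π₁) : x ≫ X.s = X.s :=
  X.isTangent.additive.lift_comm x h₁ h₂

theorem exists_lift₂ (X : Tangentad K) : ∃ g : X.T₂ ⟶ X.T₂ ≫ X.T,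
    g ≫ X.π₁ ▷ X.T = X.π₁ ≫ X.l ∧ g ≫ X.π₂ ▷ X.T = X.π₂ ≫ X.l ∧
      X.z ≫ X.l = (X.z ≫ (λ_ X.T).inv) ≫ X.z ▷ X.T ∧ X.s ≫ X.l = g ≫ X.s ▷ X.T := by
  obtain ⟨g, h⟩ := X.isTangent.lift_additive
  exact ⟨g, h.π₁, h.π₂, h.z, h.s⟩

end Tangentad

/-- The universal triple of composable summands. -/
theorem Tangentad.exists_nfold_three (X : Tangentad K) :
    ∃ (P : X.base ⟶ X.base) (b : P ⟶ 𝟙 X.base) (π : Fin 3 → (P ⟶ X.T)) (x y f g : P ⟶ X.T₂),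
      (∀ k, IsPointwiseNFoldPullback (X.p ▷ iterate X.T k) (b ▷ iterate X.T k)
        fun i => π i ▷ iterate X.T k) ∧
      x ≫ X.π₁ = π 0 ∧ x ≫ X.π₂ = π 1 ∧ y ≫ X.π₁ = π 1 ∧ y ≫ X.π₂ = π 2 ∧
      f ≫ X.π₁ = x ≫ X.s ∧ f ≫ X.π₂ = π 2 ∧ g ≫ X.π₁ = π 0 ∧ g ≫ X.π₂ = y ≫ X.s ∧
      f ≫ X.s = g ≫ X.s := by
  obtain ⟨P, b, π, h⟩ := X.isTangent.nfold 3 (by norm_num)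
  have h' : IsPointwiseNFoldPullback (X.p ▷ 𝟙 X.base) (b ▷ 𝟙 X.base) fun i => π i ▷ 𝟙 X.base :=
    h 0
  have h₀ : IsNFoldPullback X.p b π :=
    h'.1.of_iso (ρ_ _) (ρ_ _) (ρ_ _) (by simp) (by simp) (by simp)
  have hp := X.isPullback
  have hw : ∀ i j, π i ≫ X.p = π j ≫ X.p := fun i j => (h₀.w i).trans (h₀.w j).symm
  refine ⟨P, b, π, hp.lift _ _ (hw 0 1), hp.lift _ _ (hw 1 2),
    hp.lift (hp.lift _ _ (hw 0 1) ≫ X.s) (π 2) ?_, hp.lift (π 0) (hp.lift _ _ (hw 1 2) ≫ X.s) ?_,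
    h, ?_, ?_, ?_, ?_, ?_, ?_, ?_, ?_, ?_⟩
  · rw [Category.assoc, X.s_p, IsPullback.lift_fst_assoc, hw]
  · rw [Category.assoc, X.s_p, IsPullback.lift_fst_assoc, hw]
  all_goals try simp only [IsPullback.lift_fst, IsPullback.lift_snd]
  exact X.s_assoc (hp.lift _ _ (hw 0 1)) (hp.lift _ _ (hw 1 2)) _ _
    (by simp) (by simp) (by simp) (by simp) (by simp)

/-- Limit axioms hold because `Γ` preserves the limits. Unit and commutativity involve one specific
map each, which is the image of its counterpart in `K`. Associativity quantifies over all test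
objects of `L` and is reduced to a universal instance. The remaining axioms are equations under
`Γ.map₂`, with the images of existing lifts as witnesses where one is needed. -/
theorem Tangentad.isTangent_map (X : Tangentad K) (hΓ : PreservesPointwisePullbacks Γ) :
    (X.toTangentData.map Γ).IsTangent := by
  have hpb : IsPullback (Γ.map₂ X.π₁) (Γ.map₂ X.π₂) (Γ.map₂ X.p) (Γ.map₂ X.p) :=
    (hΓ X.isPointwisePullback).1
  change (TangentData.mk (Γ.obj X.base) (Γ.map X.T) (Γ.map X.T₂) (Γ.map₂ X.π₁) (Γ.map₂ X.π₂)
    (Γ.map₂ X.p ≫ (Γ.mapId X.base).hom) ((Γ.mapId X.base).inv ≫ Γ.map₂ X.z) (Γ.map₂ X.s)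
    (Γ.map₂ X.l ≫ (Γ.mapComp X.T X.T).hom) (mapLaw Γ X.c)).IsTangent
  refine .of_forall (hΓ.map_iterate X) (fun n hn => ?_) ?_ ?_ ?_ ?_ ?_ ?_ ?_ ?_ ?_ ?_ ?_ ?_ ?_
  · obtain ⟨P, b, π, h⟩ := X.isTangent.nfold n hn
    exact ⟨Γ.map P, _, _, fun k => hΓ.map_nfold_iterate X hn k (h k)⟩
  · rw [Category.assoc, ← PrelaxFunctor.map₂_comp_assoc, X.z_p]
    simp
  · rw [← PrelaxFunctor.map₂_comp_assoc, X.s_p]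
    simp
  · intro W x y f g h₁ h₂ h₃ h₄ h₅
    -- An arbitrary triple of summands factors through the image of the universal triple on `T₃`, so
    -- associativity for it is the image of one equation in `K`.
    obtain ⟨P, b, π, x', y', f', g', h, hx₁, hx₂, hy₁, hy₂, hf₁, hf₂, hg₁, hg₂, e⟩ :=
      X.exists_nfold_three
    have h' : IsPointwiseNFoldPullback ((Γ.map₂ X.p ≫ (Γ.mapId X.base).hom) ▷ 𝟙 (Γ.obj X.base))
      ((Γ.map₂ b ≫ (Γ.mapId X.base).hom) ▷ 𝟙 (Γ.obj X.base))
      fun i => Γ.map₂ (π i) ▷ 𝟙 (Γ.obj X.base) :=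
        hΓ.map_nfold_iterate X (by norm_num) 0 (h 0)
    have h₀ : IsNFoldPullback (Γ.map₂ X.p ≫ (Γ.mapId X.base).hom)
        (Γ.map₂ b ≫ (Γ.mapId X.base).hom) fun i => Γ.map₂ (π i) :=
      h'.1.of_iso (ρ_ _) (ρ_ _) (ρ_ _) (by simp) (by simp) (by simp)
    obtain ⟨t, -, ht⟩ := h₀.exists_lift
      (x ≫ Γ.map₂ X.π₁ ≫ Γ.map₂ X.p ≫ (Γ.mapId X.base).hom)
      ![x ≫ Γ.map₂ X.π₁, x ≫ Γ.map₂ X.π₂, y ≫ Γ.map₂ X.π₂] (by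
        rw [Fin.forall_fin_succ, Fin.forall_fin_two]
        refine ⟨?_, ?_, ?_⟩
        · simp
        · simp [hpb.w_assoc]
        · simp [← hpb.w_assoc, ← reassoc_of% h₁])
    have ht₀ : t ≫ Γ.map₂ (π 0) = x ≫ Γ.map₂ X.π₁ := ht 0
    have ht₁ : t ≫ Γ.map₂ (π 1) = x ≫ Γ.map₂ X.π₂ := ht 1
    have ht₂ : t ≫ Γ.map₂ (π 2) = y ≫ Γ.map₂ X.π₂ := ht 2
    have ex : x = t ≫ Γ.map₂ x' := hpb.hom_ext
      (by rw [Category.assoc, ← PrelaxFunctor.map₂_comp, hx₁, ht₀])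
      (by rw [Category.assoc, ← PrelaxFunctor.map₂_comp, hx₂, ht₁])
    have ey : y = t ≫ Γ.map₂ y' := hpb.hom_ext
      (by rw [Category.assoc, ← PrelaxFunctor.map₂_comp, hy₁, ht₁, h₁])
      (by rw [Category.assoc, ← PrelaxFunctor.map₂_comp, hy₂, ht₂])
    have ef : f = t ≫ Γ.map₂ f' := hpb.hom_ext
      (by rw [Category.assoc, ← PrelaxFunctor.map₂_comp, hf₁, h₂, ex, Category.assoc,
        PrelaxFunctor.map₂_comp])
      (by rw [Category.assoc, ← PrelaxFunctor.map₂_comp, hf₂, h₃, ht₂])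
    have eg : g = t ≫ Γ.map₂ g' := hpb.hom_ext
      (by rw [Category.assoc, ← PrelaxFunctor.map₂_comp, hg₁, h₄, ht₀])
      (by rw [Category.assoc, ← PrelaxFunctor.map₂_comp, hg₂, h₅, ey, Category.assoc,
        PrelaxFunctor.map₂_comp])
    rw [ef, eg, Category.assoc, Category.assoc, ← PrelaxFunctor.map₂_comp,
      ← PrelaxFunctor.map₂_comp, e]
  · intro x h₁ h₂
    let t : X.T ⟶ X.T₂ := X.isPullback.lift (X.p ≫ X.z) (𝟙 X.T) (by simp)
    have ht₁ : t ≫ X.π₁ = X.p ≫ X.z := IsPullback.lift_fst _ _ _ _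
    have ht₂ : t ≫ X.π₂ = 𝟙 X.T := IsPullback.lift_snd _ _ _ _
    have hx : x = Γ.map₂ t := hpb.hom_ext
      (by rw [← PrelaxFunctor.map₂_comp, h₁, ht₁]; simp)
      (by rw [← PrelaxFunctor.map₂_comp, h₂, ht₂]; simp)
    rw [hx, ← PrelaxFunctor.map₂_comp, X.s_unit t ht₁ ht₂, PrelaxFunctor.map₂_id]
  · intro x h₁ h₂
    let t : X.T₂ ⟶ X.T₂ := X.isPullback.lift X.π₂ X.π₁ X.π₁_p.symm
    have ht₁ : t ≫ X.π₁ = X.π₂ := IsPullback.lift_fst _ _ _ _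
    have ht₂ : t ≫ X.π₂ = X.π₁ := IsPullback.lift_snd _ _ _ _
    have hx : x = Γ.map₂ t := hpb.hom_ext
      (by rw [← PrelaxFunctor.map₂_comp, h₁, ht₁]) (by rw [← PrelaxFunctor.map₂_comp, h₂, ht₂])
    rw [hx, ← PrelaxFunctor.map₂_comp, X.s_comm t ht₁ ht₂]
  · obtain ⟨g, h₁, h₂, h₄, h₅⟩ := X.exists_lift₂
    refine ⟨Γ.map₂ g ≫ (Γ.mapComp _ _).hom, ?_, ?_, ?_, ?_, ?_⟩
    · simp only [map₂_whiskerRight_map, Category.assoc,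
        Iso.hom_inv_id_assoc, ← PrelaxFunctor.map₂_comp_assoc, h₁]
    · simp only [map₂_whiskerRight_map, Category.assoc,
        Iso.hom_inv_id_assoc, ← PrelaxFunctor.map₂_comp_assoc, h₂]
    · simp only [map₂_whiskerRight_map, Category.assoc, comp_whiskerRight, leftUnitor_map_inv,
        Iso.hom_inv_id_assoc, ← PrelaxFunctor.map₂_comp_assoc, X.l_p]
    · simp only [map₂_whiskerRight_map, Category.assoc, comp_whiskerRight, leftUnitor_map_inv,
        Iso.hom_inv_id_assoc, ← PrelaxFunctor.map₂_comp_assoc, hom_inv_whiskerRight_assoc, h₄]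
    · simp only [map₂_whiskerRight_map, Category.assoc, Iso.hom_inv_id_assoc, ← PrelaxFunctor.map₂_comp_assoc, h₅]
  · refine ⟨mapLaw Γ X.flip₂, ?_, ?_, ?_, ?_, ?_⟩
    · exact mapLaw_naturality' Γ X.flip₂_π₁
    · exact mapLaw_naturality' Γ X.flip₂_π₂
    · simp only [mapLaw, map_whiskerLeft_map₂, map₂_whiskerRight_map, Category.assoc,
        comp_whiskerRight, whiskerLeft_comp, leftUnitor_map_hom, rightUnitor_map_inv,
        Iso.hom_inv_id_assoc, hom_inv_whiskerRight_assoc, ← PrelaxFunctor.map₂_comp_assoc,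
        X.c_projection]
    · simp only [mapLaw, map_whiskerLeft_map₂, map₂_whiskerRight_map, Category.assoc,
        comp_whiskerRight, whiskerLeft_comp, leftUnitor_map_hom, rightUnitor_map_inv,
        Iso.hom_inv_id_assoc, whiskerLeft_hom_inv_assoc, ← PrelaxFunctor.map₂_comp_assoc,
        X.z_whiskerRight_c]
    · exact (mapLaw_naturality' Γ X.s_whiskerRight_c.symm).symm
  · have e := X.isTangent.l_coassoc
    simp only [map_whiskerLeft_map₂, map₂_whiskerRight_map, Category.assoc,
        comp_whiskerRight, whiskerLeft_comp, associator_map_hom,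
        Iso.hom_inv_id_assoc, hom_inv_whiskerRight_assoc, ← PrelaxFunctor.map₂_comp_assoc, e]
  · have e := X.isTangent.l_c
    simp only [mapLaw, Category.assoc,
        Iso.hom_inv_id_assoc, ← PrelaxFunctor.map₂_comp_assoc, e]
  · have e := X.isTangent.lift_flip
    simp only [mapLaw, map_whiskerLeft_map₂, map₂_whiskerRight_map, Category.assoc,
        comp_whiskerRight, whiskerLeft_comp, associator_map_hom, associator_map_inv,
        Iso.hom_inv_id_assoc, hom_inv_whiskerRight_assoc, whiskerLeft_hom_inv_assoc,
        ← PrelaxFunctor.map₂_comp_assoc, e]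
  · have e := X.isTangent.c_c
    simp only [mapLaw, Category.assoc,
        Iso.hom_inv_id_assoc, ← PrelaxFunctor.map₂_comp_assoc, e, PrelaxFunctor.map₂_id,
        Category.id_comp, Iso.inv_hom_id]
  · have e := X.isTangent.yang_baxter
    simp only [mapLaw, map_whiskerLeft_map₂, map₂_whiskerRight_map, Category.assoc,
        comp_whiskerRight, whiskerLeft_comp, associator_map_hom, associator_map_inv,
        Iso.hom_inv_id_assoc, hom_inv_whiskerRight_assoc, whiskerLeft_hom_inv_assoc,
        ← PrelaxFunctor.map₂_comp_assoc, e]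
  · obtain ⟨v, h₁, h₂, h₃⟩ := X.isTangent.local_linearity
    refine ⟨Γ.map₂ v ≫ (Γ.mapComp _ _).hom, ?_, ?_, ?_⟩
    · simp only [map_whiskerLeft_map₂, map₂_whiskerRight_map, Category.assoc,
        whiskerLeft_comp, rightUnitor_map_inv, Iso.hom_inv_id_assoc, whiskerLeft_hom_inv_assoc,
        ← PrelaxFunctor.map₂_comp_assoc, h₁]
    · simp only [map₂_whiskerRight_map, Category.assoc, Iso.hom_inv_id_assoc,
        ← PrelaxFunctor.map₂_comp_assoc, h₂]
    -- The square of local linearity is itself a pointwise pullback of endomorphisms; only its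
    -- corners `T ≫ T` and `𝟙` require comparison cells.
    · refine (hΓ h₃).of_iso (Iso.refl _) (Γ.mapComp _ _) (Γ.mapId _) (Iso.refl _) ?_ ?_ ?_ ?_
      · simp
      · simp
      · simp
      · simp

/-- The image of a tangentad under a pointwise pullback-preserving `2`-functor. -/
def Tangentad.map (hΓ : PreservesPointwisePullbacks Γ) (X : Tangentad K) : Tangentad L where
  toTangentData := X.toTangentData.map Γ
  isTangent := X.isTangent_map Γ hΓ

/-- Both sides have the same projections. This lets the flip clause of a colax law be transported
like the others. -/
theorem Tangentad.flip₂_map (hΓ : PreservesPointwisePullbacks Γ) (X : Tangentad K) :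
    (X.map Γ hΓ).flip₂ = mapLaw Γ X.flip₂ :=
  ((X.map Γ hΓ).isPullback_whiskerLeft (X.map Γ hΓ).T).hom_ext
    ((X.map Γ hΓ).flip₂_π₁.trans (mapLaw_naturality' Γ X.flip₂_π₁).symm)
    ((X.map Γ hΓ).flip₂_π₂.trans (mapLaw_naturality' Γ X.flip₂_π₂).symm)

/-- The comparison cells produced by stacking cancel those inside `mapLaw Γ x` and `mapLaw Γ y`. It
serves both for `c` and for `flip₂`. -/
theorem mapLaw_naturality_stackLaw {X Y : K} {F : X ⟶ Y} {R S T U : X ⟶ X} {R' S' T' U' : Y ⟶ Y}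
    {σ : F ≫ R' ⟶ R ≫ F} {τ : F ≫ S' ⟶ S ≫ F} {σ' : F ≫ T' ⟶ T ≫ F} {τ' : F ≫ U' ⟶ U ≫ F}
    {x : R ≫ S ⟶ T ≫ U} {y : R' ≫ S' ⟶ T' ≫ U'}
    (e : stackLaw σ τ ≫ x ▷ F = F ◁ y ≫ stackLaw σ' τ') :
    stackLaw (mapLaw Γ σ) (mapLaw Γ τ) ≫ mapLaw Γ x ▷ Γ.map F =
      Γ.map F ◁ mapLaw Γ y ≫ stackLaw (mapLaw Γ σ') (mapLaw Γ τ') := by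
  have e' := mapLaw_naturality Γ e
  rw [stackLaw_mapLaw, stackLaw_mapLaw]
  simp only [mapLaw, Category.assoc] at e'
  simp [mapLaw, reassoc_of% e']

/-- The image of a given `law₂` is a witness for the image law, so `F` need not preserve the
pullback `T₂`. -/
theorem IsColaxLaw.map (hΓ : PreservesPointwisePullbacks Γ) {X Y : Tangentad K}
    {F : X.base ⟶ Y.base} {law : F ≫ Y.T ⟶ X.T ≫ F} (h : IsColaxLaw X Y F law) :
    IsColaxLaw (X.map Γ hΓ) (Y.map Γ hΓ) (Γ.map F) (mapLaw Γ law) where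
  additive := by
    obtain ⟨law₂, h₂, hf⟩ := h.additive
    rw [isMorphismVia_iff] at h₂
    obtain ⟨h₁, h₂, h₃, h₄, h₅⟩ := h₂
    refine ⟨mapLaw Γ law₂, (isMorphismVia_iff (X.map Γ hΓ) (Y.map Γ hΓ) _ _ _).2
      ⟨mapLaw_naturality Γ h₁, mapLaw_naturality Γ h₂, ?_, ?_, mapLaw_naturality Γ h₅⟩, ?_⟩
    · have h₃' := mapLaw_naturality Γ h₃
      rw [mapLaw_unit] at h₃'
      change mapLaw Γ law ≫ (Γ.map₂ X.p ≫ (Γ.mapId X.base).hom) ▷ Γ.map F =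
        Γ.map F ◁ (Γ.map₂ Y.p ≫ (Γ.mapId Y.base).hom) ≫ (ρ_ _).hom ≫ (λ_ _).inv
      rw [comp_whiskerRight, reassoc_of% h₃']
      simp
    · have h₄' := mapLaw_naturality Γ h₄
      rw [mapLaw_unit] at h₄'
      change ((ρ_ _).hom ≫ (λ_ _).inv) ≫ ((Γ.mapId X.base).inv ≫ Γ.map₂ X.z) ▷ Γ.map F =
        Γ.map F ◁ ((Γ.mapId Y.base).inv ≫ Γ.map₂ Y.z) ≫ mapLaw Γ law
      rw [whiskerLeft_comp, Category.assoc (_ ◁ _), ← h₄']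
      simp
    · rw [Tangentad.flip₂_map, Tangentad.flip₂_map]
      exact mapLaw_naturality_stackLaw Γ hf
  lift := by
    have h' := mapLaw_naturality Γ h.lift
    change mapLaw Γ law ≫ (Γ.map₂ X.l ≫ (Γ.mapComp X.T X.T).hom) ▷ Γ.map F =
      Γ.map F ◁ (Γ.map₂ Y.l ≫ (Γ.mapComp Y.T Y.T).hom) ≫ stackLaw (mapLaw Γ law) (mapLaw Γ law)
    rw [stackLaw_mapLaw, comp_whiskerRight, reassoc_of% h']
    simp
  flip := mapLaw_naturality_stackLaw Γ h.flip

end MapTangentad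

/-! ### The 2-functor Tng_co(Γ) -/

section TngMap

variable {K : Type u} [Bicategory.{w, v} K] {L : Type u'} [Bicategory.{w', v'} L]

/-- The image of a colax tangent morphism under a pointwise pullback-preserving `2`-functor. -/
def ColaxHom.map (Γ : StrictPseudofunctor K L) (hΓ : PreservesPointwisePullbacks Γ)
    {X Y : Tangentad K} (F : X ⟶ Y) : X.map Γ hΓ ⟶ Y.map Γ hΓ :=
  ColaxHom.mk (Γ.map (ColaxHom.mor F)) (mapLaw Γ (ColaxHom.law F)) (ColaxHom.isColax F |>.map Γ hΓ)

variable [Strict K] [Strict L]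

/-- The `2`-functor `Tng_co(Γ)`. -/
def tngMap (Γ : StrictPseudofunctor K L) (hΓ : PreservesPointwisePullbacks Γ) :
    StrictPseudofunctor (Tangentad K) (Tangentad L) :=
  .mk''
  { obj := Tangentad.map Γ hΓ
    map := ColaxHom.map Γ hΓ
    map₂ {X Y F G} φ := ColaxHom₂.mk (F := ColaxHom.map Γ hΓ F) (G := ColaxHom.map Γ hΓ G)
      (Γ.map₂ φ.hom) (mapLaw_naturality' Γ φ.comm)
    map₂_id F := Tangentad.hom₂_ext (Γ.map₂_id _)
    map₂_comp φ ψ := Tangentad.hom₂_ext (Γ.map₂_comp _ _)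
    -- The comparison cell of `Γ` is an `eqToHom` underneath; once it is compatible with the laws,
    -- it identifies the laws as well as the `1`-morphisms. The same device proves `map_comp`.
    map_id X := Tangentad.eq_of_hom_eq_eqToHom
      (ColaxHom₂.mk (F := ColaxHom.map Γ hΓ (𝟙 X)) (G := 𝟙 (X.map Γ hΓ)) (Γ.mapId X.base).hom (by
        change mapLaw Γ (idLaw X.T) ≫ Γ.map X.T ◁ _ = _ ▷ Γ.map X.T ≫ idLaw (Γ.map X.T)
        rw [mapLaw_idLaw]
        simp))
      (Γ.map_id _) (congrArg Iso.hom (Γ.mapId_eq_eqToIso _))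
    map_comp {X Y Z} F G := Tangentad.eq_of_hom_eq_eqToHom
      (ColaxHom₂.mk (F := ColaxHom.map Γ hΓ (F ≫ G))
        (G := ColaxHom.map Γ hΓ F ≫ ColaxHom.map Γ hΓ G) (Γ.mapComp F.mor G.mor).hom (by
        change mapLaw Γ (compLaw F.law G.law) ≫ Γ.map X.T ◁ _ =
          _ ▷ Γ.map Z.T ≫ compLaw (mapLaw Γ F.law) (mapLaw Γ G.law)
        rw [compLaw_mapLaw]
        simp))
      (Γ.map_comp _ _) (congrArg Iso.hom (Γ.mapComp_eq_eqToIso _ _))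
    map₂_whisker_left {X Y Z} F G G' φ := Tangentad.hom₂_ext (by
      rw [Tangentad.comp_hom, Tangentad.comp_hom, Tangentad.eqToHom_hom, Tangentad.eqToHom_hom]
      have h := Γ.map₂_whisker_left F.mor φ.hom
      rw [Γ.mapComp_eq_eqToIso, Γ.mapComp_eq_eqToIso] at h
      exact h)
    map₂_whisker_right {X Y Z} F F' φ G := Tangentad.hom₂_ext (by
      rw [Tangentad.comp_hom, Tangentad.comp_hom, Tangentad.eqToHom_hom, Tangentad.eqToHom_hom]
      have h := Γ.map₂_whisker_right φ.hom G.mor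
      rw [Γ.mapComp_eq_eqToIso, Γ.mapComp_eq_eqToIso] at h
      exact h) }

theorem isTngMap_tngMap (Γ : StrictPseudofunctor K L) (hΓ : PreservesPointwisePullbacks Γ) :
    IsTngMap Γ (tngMap Γ hΓ) where
  obj _ := rfl
  map _ := rfl
  map₂ _ := rfl

/-- Forget to `K`, apply `Γ`, and reflect back from `L`. -/
theorem preservesPointwisePullbacks_tngMap (Γ : StrictPseudofunctor K L)
    (hΓ : PreservesPointwisePullbacks Γ) : PreservesPointwisePullbacks (tngMap Γ hΓ) :=
  fun h => Tangentad.isPointwisePullback_of_hom (hΓ (Tangentad.isPointwisePullback_hom h))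

end TngMap

/-! ### The 2-natural transformation Tng_co[φ] -/

section TngMapTwo

variable {K : Type u} [Bicategory.{w, v} K] {L : Type u'} [Bicategory.{w', v'} L]
  {Γ Γ' : StrictPseudofunctor K L} (φ : TwoNatTrans Γ Γ')

/-- The identity `2`-morphism which witnesses the naturality of `φ`, as a law. -/
def TwoNatTrans.law {X Y : K} (F : X ⟶ Y) : φ.app X ≫ Γ'.map F ⟶ Γ.map F ≫ φ.app Y :=
  eqToHom (φ.naturality F).symm

theorem TwoNatTrans.law_naturality {X Y : K} {F G : X ⟶ Y} (x : F ⟶ G) :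
    φ.law F ≫ Γ.map₂ x ▷ φ.app Y = φ.app X ◁ Γ'.map₂ x ≫ φ.law G := by
  rw [φ.map₂_whiskerRight]
  simp [law]

variable [Strict L]

theorem TwoNatTrans.stackLaw_law {X : K} (S T : X ⟶ X) :
    stackLaw (φ.law S) (φ.law T) =
      φ.app X ◁ (Γ'.mapComp S T).inv ≫ φ.law (S ≫ T) ≫ (Γ.mapComp S T).hom ▷ φ.app X := by
  simp [stackLaw, law, Strict.associator_eqToIso, StrictPseudofunctor.mapComp_eq_eqToIso]

theorem TwoNatTrans.compLaw_mapLaw_law {X Y : K} {F : X ⟶ Y} {T : X ⟶ X} {T' : Y ⟶ Y}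
    (σ : F ≫ T' ⟶ T ≫ F) :
    compLaw (mapLaw Γ σ) (φ.law T') ≫ Γ.map T ◁ eqToHom (φ.naturality F) =
      eqToHom (φ.naturality F) ▷ Γ'.map T' ≫ compLaw (φ.law T) (mapLaw Γ' σ) := by
  have h := φ.map₂_whiskerRight σ
  simp [compLaw, law, mapLaw, h, Strict.associator_eqToIso,
    StrictPseudofunctor.mapComp_eq_eqToIso]

theorem TwoNatTrans.law_id (X : K) :
    φ.law (𝟙 X) = φ.app X ◁ (Γ'.mapId X).hom ≫ ((ρ_ (φ.app X)).hom ≫ (λ_ (φ.app X)).inv) ≫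
      (Γ.mapId X).inv ▷ φ.app X := by
  simp [law, Strict.leftUnitor_eqToIso, Strict.rightUnitor_eqToIso,
    StrictlyUnitaryPseudofunctor.mapId_eq_eqToIso]

theorem TwoNatTrans.stackLaw_law_naturality {X : K} {R S T U : X ⟶ X} (x : R ≫ S ⟶ T ≫ U) :
    stackLaw (φ.law R) (φ.law S) ≫ mapLaw Γ x ▷ φ.app X =
      φ.app X ◁ mapLaw Γ' x ≫ stackLaw (φ.law T) (φ.law U) := by
  have h := φ.law_naturality x
  rw [φ.stackLaw_law, φ.stackLaw_law]
  simp [mapLaw, reassoc_of% h]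

/-- Each condition is `2`-naturality of `φ` at one structural `2`-morphism, with the naturality
identity at `T₂` as the witness on `T₂`; the rest is cancellation of comparison cells. -/
theorem TwoNatTrans.isColaxLaw_law (hΓ : PreservesPointwisePullbacks Γ)
    (hΓ' : PreservesPointwisePullbacks Γ') (X : Tangentad K) :
    IsColaxLaw (X.map Γ hΓ) (X.map Γ' hΓ') (φ.app X.base) (φ.law X.T) where
  additive := by
    refine ⟨φ.law X.T₂, (isMorphismVia_iff (X.map Γ hΓ) (X.map Γ' hΓ') _ _ _).2
      ⟨φ.law_naturality _, φ.law_naturality _, ?_, ?_, φ.law_naturality _⟩, ?_⟩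
    · change φ.law X.T ≫ (Γ.map₂ X.p ≫ (Γ.mapId X.base).hom) ▷ φ.app X.base =
        φ.app X.base ◁ (Γ'.map₂ X.p ≫ (Γ'.mapId X.base).hom) ≫ (ρ_ _).hom ≫ (λ_ _).inv
      have h := φ.law_naturality X.p
      rw [comp_whiskerRight, reassoc_of% h, φ.law_id]
      simp
    · change ((ρ_ _).hom ≫ (λ_ _).inv) ≫ ((Γ.mapId X.base).inv ≫ Γ.map₂ X.z) ▷ φ.app X.base =
        φ.app X.base ◁ ((Γ'.mapId X.base).inv ≫ Γ'.map₂ X.z) ≫ φ.law X.T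
      have h := φ.law_naturality X.z
      rw [whiskerLeft_comp, Category.assoc (_ ◁ _), ← h, φ.law_id]
      simp
    · rw [Tangentad.flip₂_map, Tangentad.flip₂_map]
      exact φ.stackLaw_law_naturality _
  lift := by
    change φ.law X.T ≫ (Γ.map₂ X.l ≫ (Γ.mapComp X.T X.T).hom) ▷ φ.app X.base =
      φ.app X.base ◁ (Γ'.map₂ X.l ≫ (Γ'.mapComp X.T X.T).hom) ≫ stackLaw (φ.law _) (φ.law _)
    have h := φ.law_naturality X.l
    rw [φ.stackLaw_law, comp_whiskerRight, reassoc_of% h]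
    simp
  flip := φ.stackLaw_law_naturality _

/-- The components of `Tng_co[φ]`. -/
def TwoNatTrans.tngApp (hΓ : PreservesPointwisePullbacks Γ)
    (hΓ' : PreservesPointwisePullbacks Γ') (X : Tangentad K) : X.map Γ hΓ ⟶ X.map Γ' hΓ' :=
  ColaxHom.mk (φ.app X.base) (φ.law X.T) (φ.isColaxLaw_law hΓ hΓ' X)

theorem TwoNatTrans.tngApp_naturality (hΓ : PreservesPointwisePullbacks Γ)
    (hΓ' : PreservesPointwisePullbacks Γ') {X Y : Tangentad K} (F : X ⟶ Y) :
    ColaxHom.map Γ hΓ F ≫ φ.tngApp hΓ hΓ' Y = φ.tngApp hΓ hΓ' X ≫ ColaxHom.map Γ' hΓ' F :=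
  Tangentad.eq_of_hom_eq_eqToHom
    (ColaxHom₂.mk (F := ColaxHom.map Γ hΓ F ≫ φ.tngApp hΓ hΓ' Y)
      (G := φ.tngApp hΓ hΓ' X ≫ ColaxHom.map Γ' hΓ' F) (eqToHom (φ.naturality F.mor))
      (φ.compLaw_mapLaw_law F.law)) (φ.naturality F.mor) rfl

variable [Strict K]

/-- The `2`-natural transformation `Tng_co[φ]`. -/
def TwoNatTrans.tng (hΓ : PreservesPointwisePullbacks Γ) (hΓ' : PreservesPointwisePullbacks Γ') :
    TwoNatTrans (tngMap Γ hΓ) (tngMap Γ' hΓ') where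
  app := φ.tngApp hΓ hΓ'
  naturality F := φ.tngApp_naturality hΓ hΓ' F
  naturality₂ {X Y F G} x := Tangentad.hom₂_ext (by
    have e₁ := Tangentad.eqToHom_hom (φ.tngApp_naturality hΓ hΓ' F)
    have e₂ := Tangentad.eqToHom_hom (φ.tngApp_naturality hΓ hΓ' G)
    exact (congrArg (Γ.map₂ x.hom ▷ φ.app Y.base ≫ ·) e₂).trans
      ((φ.naturality₂ x.hom).trans
        (congrArg (· ≫ φ.app X.base ◁ Γ'.map₂ x.hom) e₁.symm)))

theorem TwoNatTrans.isTngMap₂_tng (hΓ : PreservesPointwisePullbacks Γ)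
    (hΓ' : PreservesPointwisePullbacks Γ') : IsTngMap₂ φ (φ.tng hΓ hΓ') :=
  fun _ => rfl

end TngMapTwo

/-! ### The comultiplication -/

section Comult

variable {K : Type u} [Bicategory.{w, v} K]

namespace Tangentad

@[simp]
theorem c_c (X : Tangentad K) : X.c ≫ X.c = 𝟙 _ :=
  X.isTangent.c_c

theorem stackLaw_c (X : Tangentad K) :
    stackLaw X.c X.c = (α_ X.T X.T X.T).inv ≫ X.c ▷ X.T ≫ (α_ X.T X.T X.T).hom ≫
      X.T ◁ X.c ≫ (α_ X.T X.T X.T).inv :=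
  rfl

/-- `T` preserves the pullback `T₂`, so only conditions on `c` remain: those with `p`, `z` and `s`
come from additivity of the flip and `c² = 𝟙`, the one with `l` is `lift_flip`, and the one with `c`
is the Yang–Baxter equation. -/
theorem isColaxLaw_c (X : Tangentad K) : IsColaxLaw X X X.T X.c := by
  refine .of_isPreservedBy X.isPreservedBy_T X.c_whiskerRight_p X.whiskerLeft_z_c.symm
    (fun law₂ h₁ h₂ => ?_) ?_ ?_
  -- Since `c` is an involution, `law₂` followed by `flip₂` is the identity; this turns the
  -- additivity of `c` around.
  · have h : law₂ ≫ X.flip₂ = 𝟙 _ := by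
      apply (X.isPullback_whiskerLeft X.T).hom_ext
      · rw [Category.assoc, X.flip₂_π₁, reassoc_of% h₁, X.c_c, Category.comp_id, Category.id_comp]
      · rw [Category.assoc, X.flip₂_π₂, reassoc_of% h₂, X.c_c, Category.comp_id, Category.id_comp]
    rw [← Category.id_comp (X.T ◁ X.s ≫ X.c), ← h, Category.assoc, ← reassoc_of% X.s_whiskerRight_c,
      X.c_c, Category.comp_id]
  · have h := X.isTangent.lift_flip
    rw [X.stackLaw_c, reassoc_of% h, Iso.hom_inv_id, Category.comp_id]
  · have h := X.isTangent.yang_baxter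
    rw [X.stackLaw_c]
    simp only [Category.assoc]
    rw [h, Iso.inv_hom_id_assoc]

/-- The tangent bundle `1`-morphism `(T, c)` of a tangentad, as a colax tangent morphism. -/
def tangent (X : Tangentad K) : X ⟶ X :=
  ColaxHom.mk X.T X.c X.isColaxLaw_c

/-- `T_n` is a limit of copies of `(T, c)` and preserves `T₂`, so compatibility with the projections
suffices. -/
theorem isColaxLaw_of_nfold (X : Tangentad K) {n : ℕ} (hn : 1 ≤ n) {P : X.base ⟶ X.base}
    {b : P ⟶ 𝟙 X.base} {π : Fin n → (P ⟶ X.T)} (h : IsPointwiseNFoldPullback X.p b π)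
    {law : P ≫ X.T ⟶ X.T ≫ P} (hlaw : ∀ i, law ≫ X.T ◁ π i = π i ▷ X.T ≫ X.c) :
    IsColaxLaw X X P law :=
  .of_jointlyMono (F := fun _ => X.tangent) π
    (fun k _ _ _ hfg => (h.2 k).hom_ext_of_pos hn hfg) (fun _ => X.isPreservedBy_T)
    (X.isPreservedBy_of_nfold h X.isPreservedBy_T X.isPreservedBy_id) law hlaw

/-- The `1`-morphism `T₂` of a tangentad, as a colax tangent morphism. -/
noncomputable def tangent₂ (X : Tangentad K) : X ⟶ X :=
  ColaxHom.mk X.T₂ X.flip₂ (X.isColaxLaw_of_nfold le_add_self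
    (isPointwiseNFoldPullback_two_iff.2 X.isPointwisePullback)
    (Fin.forall_fin_two.2 ⟨X.flip₂_π₁, X.flip₂_π₂⟩))

/-- This is `c × ⋯ × c`, induced by the pullback precomposed with `T`. The base clause is what later
makes `b` a tangent `2`-morphism to the identity. -/
theorem exists_nfold_law (X : Tangentad K) {n : ℕ} {P : X.base ⟶ X.base}
    {b : P ⟶ 𝟙 X.base} {π : Fin n → (P ⟶ X.T)} (h : IsPointwiseNFoldPullback X.p b π) :
    ∃ law : P ≫ X.T ⟶ X.T ≫ P, law ≫ X.T ◁ b = b ▷ X.T ≫ idLaw X.T ∧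
      ∀ i, law ≫ X.T ◁ π i = π i ▷ X.T ≫ X.c :=
  (h.2 X.T).exists_lift _ _ fun i => by
    rw [Category.assoc, X.c_projection, ← comp_whiskerRight_assoc, h.1.w]
    rfl

/-- The axiom `lift_flip`, solved for `l ▷ T` by means of `c² = 𝟙`. In this form it says that `l` is
a tangent `2`-morphism from `(T, c)` to its square. -/
theorem whiskerLeft_l (X : Tangentad K) :
    X.c ≫ X.T ◁ X.l = X.l ▷ X.T ≫ compLaw X.c X.c := by
  have h := X.isTangent.lift_flip
  have h' : X.l ▷ X.T = X.c ≫ (X.T ◁ X.l ≫ (α_ X.T X.T X.T).inv ≫ X.c ▷ X.T ≫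
      (α_ X.T X.T X.T).hom ≫ X.T ◁ X.c) ≫ (α_ X.T X.T X.T).inv := by
    rw [h]
    simp [reassoc_of% X.c_c]
  have hc : X.c ▷ X.T ≫ X.c ▷ X.T = 𝟙 _ := by simp [← comp_whiskerRight]
  have hc' : X.T ◁ X.c ≫ X.T ◁ X.c = 𝟙 _ := by simp [← whiskerLeft_comp]
  rw [h']
  simp [compLaw, reassoc_of% hc, reassoc_of% hc']

/-- The Yang–Baxter equation, rebracketed: it says that `c` is a tangent `2`-morphism on the square
of `(T, c)`. -/
theorem whiskerLeft_c (X : Tangentad K) :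
    compLaw X.c X.c ≫ X.T ◁ X.c = X.c ▷ X.T ≫ compLaw X.c X.c := by
  have h := X.isTangent.yang_baxter
  simp only [compLaw, Category.assoc]
  rw [← cancel_mono (α_ X.T X.T X.T).inv]
  simp only [Category.assoc, Iso.hom_inv_id, Category.comp_id]
  exact h.symm

/-- The data of the tangentad `(T, c)` in `Tng_co(K)` on a tangentad `(X, T)`. -/
noncomputable def comultData (X : Tangentad K) : TangentData (Tangentad K) where
  base := X
  T := X.tangent
  T₂ := X.tangent₂
  π₁ := ColaxHom₂.mk (F := X.tangent₂) (G := X.tangent) X.π₁ X.flip₂_π₁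
  π₂ := ColaxHom₂.mk (F := X.tangent₂) (G := X.tangent) X.π₂ X.flip₂_π₂
  p := ColaxHom₂.mk (F := X.tangent) (G := 𝟙 X) X.p X.c_projection
  z := ColaxHom₂.mk (F := 𝟙 X) (G := X.tangent) X.z X.z_whiskerRight_c.symm
  s := ColaxHom₂.mk (F := X.tangent₂) (G := X.tangent) X.s X.s_whiskerRight_c.symm
  l := ColaxHom₂.mk (F := X.tangent) (G := X.tangent ≫ X.tangent) X.l X.whiskerLeft_l
  c := ColaxHom₂.mk (F := X.tangent ≫ X.tangent) (G := X.tangent ≫ X.tangent) X.c X.whiskerLeft_c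

theorem iterate_tangent_mor (X : Tangentad K) (k : ℕ) :
    (iterate X.tangent k).mor = iterate X.T k := by
  induction k with
  | zero => rfl
  | succ k ih => exact congrArg (· ≫ X.T) ih

/-- The pullback is reflected to `Tng_co(K)`, and the lift taken there has the same projections as
`t`. This spares checking by hand that the maps in the lift, flip and local linearity axioms respect
the laws. -/
theorem exists_hom₂_of_isPointwisePullback {X Y : Tangentad K} {W P A B C : X ⟶ Y} {fst : P ⟶ A}
    {snd : P ⟶ B} {f : A ⟶ C} {g : B ⟶ C}
    (h : IsPointwisePullback fst.hom snd.hom f.hom g.hom) {t : W.mor ⟶ P.mor} {x : W ⟶ A}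
    {y : W ⟶ B} (h₁ : t ≫ fst.hom = x.hom) (h₂ : t ≫ snd.hom = y.hom) :
    ∃ t' : W ⟶ P, t'.hom = t := by
  have h' := (isPointwisePullback_of_hom h).1
  have hxy : x ≫ f = y ≫ g := hom₂_ext (by
    rw [comp_hom, comp_hom, ← h₁, ← h₂, Category.assoc, Category.assoc, h.1.w])
  refine ⟨h'.lift x y hxy, h.1.hom_ext ?_ ?_⟩
  · exact (congrArg ColaxHom₂.hom (h'.lift_fst x y hxy)).trans h₁.symm
  · exact (congrArg ColaxHom₂.hom (h'.lift_snd x y hxy)).trans h₂.symm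

/-- Equations are detected by the forgetful `2`-functor and limits are reflected by it. Only the
existence clauses need work: the `n`-fold pullbacks must receive laws, and the witnesses in `K` must
be lifted. -/
theorem isTangent_comultData (X : Tangentad K) : X.comultData.IsTangent := by
  refine TangentData.IsTangent.of_forall (fun k => isPointwisePullback_of_hom ?_)
    (fun n hn => ?_) (hom₂_ext X.z_p) (hom₂_ext X.s_p)
    (fun x y f g h₁ h₂ h₃ h₄ h₅ => hom₂_ext (X.s_assoc x.hom y.hom f.hom g.hom
      (congrArg ColaxHom₂.hom h₁) (congrArg ColaxHom₂.hom h₂) (congrArg ColaxHom₂.hom h₃)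
      (congrArg ColaxHom₂.hom h₄) (congrArg ColaxHom₂.hom h₅)))
    (fun x h₁ h₂ => hom₂_ext (X.s_unit x.hom (congrArg ColaxHom₂.hom h₁)
      (congrArg ColaxHom₂.hom h₂)))
    (fun x h₁ h₂ => hom₂_ext (X.s_comm x.hom (congrArg ColaxHom₂.hom h₁)
      (congrArg ColaxHom₂.hom h₂))) ?_ ?_
    (hom₂_ext X.isTangent.l_coassoc) (hom₂_ext X.isTangent.l_c)
    (hom₂_ext X.isTangent.lift_flip) (hom₂_ext X.isTangent.c_c)
    (hom₂_ext X.isTangent.yang_baxter) ?_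
  · have h := X.isTangent.pullback k
    rw [← X.iterate_tangent_mor] at h
    exact h
  · obtain ⟨P, b, π, h⟩ := X.isTangent.nfold n hn
    have h' : IsPointwiseNFoldPullback (X.p ▷ 𝟙 X.base) (b ▷ 𝟙 X.base) fun i => π i ▷ 𝟙 X.base :=
      h 0
    have h₀ : IsPointwiseNFoldPullback X.p b π :=
      h'.of_iso (ρ_ _) (ρ_ _) (ρ_ _) (by simp) (by simp) (by simp)
    obtain ⟨law, hb, hπ⟩ := X.exists_nfold_law h₀
    let P' : X ⟶ X := ColaxHom.mk P law (X.isColaxLaw_of_nfold hn h₀ hπ)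
    refine ⟨P', ColaxHom₂.mk (F := P') (G := 𝟙 X) b hb,
      fun i => ColaxHom₂.mk (F := P') (G := X.tangent) (π i) (hπ i),
      fun k => isPointwiseNFoldPullback_of_hom ?_⟩
    have hk := h k
    rw [← X.iterate_tangent_mor] at hk
    exact hk
  · obtain ⟨g, h₁, h₂, h₃, h₄⟩ := X.exists_lift₂
    obtain ⟨g', rfl⟩ := exists_hom₂_of_isPointwisePullback (W := X.tangent₂)
      (P := X.tangent₂ ≫ X.tangent) (fst := X.comultData.π₁ ▷ X.tangent)
      (snd := X.comultData.π₂ ▷ X.tangent)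
      (f := X.comultData.p ▷ X.tangent) (g := X.comultData.p ▷ X.tangent) (x := X.comultData.π₁ ≫ X.comultData.l)
      (y := X.comultData.π₂ ≫ X.comultData.l) (X.isPreservedBy_T) h₁ h₂
    exact ⟨g', hom₂_ext h₁, hom₂_ext h₂, hom₂_ext X.l_p, hom₂_ext h₃, hom₂_ext h₄⟩
  · obtain ⟨g', hg⟩ := exists_hom₂_of_isPointwisePullback (W := X.tangent₂ ≫ X.tangent)
      (P := X.tangent ≫ X.tangent₂) (fst := X.tangent ◁ X.comultData.π₁)
      (snd := X.tangent ◁ X.comultData.π₂)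
      (f := X.tangent ◁ X.comultData.p) (g := X.tangent ◁ X.comultData.p) (x := X.comultData.π₁ ▷ X.tangent ≫ X.comultData.c)
      (y := X.comultData.π₂ ▷ X.tangent ≫ X.comultData.c)
      (X.isPointwisePullback.whiskerLeft X.T) X.flip₂_π₁ X.flip₂_π₂
    refine ⟨g', hom₂_ext ?_, hom₂_ext ?_, hom₂_ext X.c_projection, hom₂_ext X.z_whiskerRight_c,
      hom₂_ext ?_⟩
    · exact (congrArg (· ≫ X.T ◁ X.π₁) hg).trans X.flip₂_π₁
    · exact (congrArg (· ≫ X.T ◁ X.π₂) hg).trans X.flip₂_π₂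
    · exact X.s_whiskerRight_c.trans (congrArg (· ≫ X.T ◁ X.s) hg.symm)
  · obtain ⟨v, h₁, h₂, h₃⟩ := X.isTangent.local_linearity
    obtain ⟨v', rfl⟩ := exists_hom₂_of_isPointwisePullback (W := X.tangent₂)
      (P := X.tangent₂ ≫ X.tangent) (fst := X.comultData.π₁ ▷ X.tangent)
      (snd := X.comultData.π₂ ▷ X.tangent)
      (f := X.comultData.p ▷ X.tangent) (g := X.comultData.p ▷ X.tangent)
      (x := X.comultData.π₁ ≫ (ρ_ X.tangent).inv ≫ X.tangent ◁ X.comultData.z)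
      (y := X.comultData.π₂ ≫ X.comultData.l) (X.isPreservedBy_T) h₁ h₂
    exact ⟨v', hom₂_ext h₁, hom₂_ext h₂, isPointwisePullback_of_hom h₃⟩

/-- The tangentad `(T, c)` in `Tng_co(K)` on a tangentad `(X, T)`. -/
noncomputable def comultObj (X : Tangentad K) : Tangentad (Tangentad K) where
  toTangentData := X.comultData
  isTangent := X.isTangent_comultData

theorem flip₂_comultObj_hom (X : Tangentad K) : X.comultObj.flip₂.hom = X.flip₂ :=
  (X.isPullback_whiskerLeft X.T).hom_ext
    ((congrArg ColaxHom₂.hom X.comultObj.flip₂_π₁).trans X.flip₂_π₁.symm)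
    ((congrArg ColaxHom₂.hom X.comultObj.flip₂_π₂).trans X.flip₂_π₂.symm)

end Tangentad

/-- The law of a colax tangent morphism `F` is a tangent `2`-morphism
`(T, c) ∘ F ⟶ F ∘ (T, c)`. -/
theorem ColaxHom.law_comm {X Y : Tangentad K} (F : X ⟶ Y) :
    compLaw F.law Y.c ≫ X.T ◁ F.law = F.law ▷ Y.T ≫ compLaw X.c F.law := by
  have h := F.isColax.flip
  have h' := congrArg (fun t => (α_ F.mor Y.T Y.T).hom ≫ t ≫ (α_ X.T X.T F.mor).hom) h
  simpa [stackLaw, compLaw] using h'.symm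

/-- The flip clause in `additive`, rebracketed, is exactly the condition for `law₂` to be a tangent
`2`-morphism. As `F` need not preserve `T₂`, testing on projections is not available here. -/
theorem ColaxHom.law₂_comm {X Y : Tangentad K} (F : X ⟶ Y) {law₂ : F.mor ≫ Y.T₂ ⟶ X.T₂ ≫ F.mor}
    (h : stackLaw law₂ F.law ≫ X.flip₂ ▷ F.mor = F.mor ◁ Y.flip₂ ≫ stackLaw F.law law₂) :
    compLaw F.law Y.flip₂ ≫ X.T ◁ law₂ = law₂ ▷ Y.T ≫ compLaw X.flip₂ F.law := by
  have h' := congrArg (fun t => (α_ F.mor Y.T₂ Y.T).hom ≫ t ≫ (α_ X.T X.T₂ F.mor).hom) h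
  simpa [stackLaw, compLaw] using h'.symm

/-- The law of a colax tangent morphism, as a tangent `2`-morphism. -/
def ColaxHom.lawHom {X Y : Tangentad K} (F : X ⟶ Y) : F ≫ Y.tangent ⟶ X.tangent ≫ F :=
  ColaxHom₂.mk (F := F ≫ Y.tangent) (G := X.tangent ≫ F) F.law (ColaxHom.law_comm F)

/-- The conditions over `Tng_co(K)` have those of `F` as their underlying equations; the one new
requirement, a tangent `2`-morphism on `T₂`, is met by `law₂_comm`. -/
theorem ColaxHom.isColaxLaw_lawHom {X Y : Tangentad K} (F : X ⟶ Y) :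
    IsColaxLaw X.comultObj Y.comultObj F (ColaxHom.lawHom F) where
  additive := by
    obtain ⟨law₂, h, hf⟩ := F.isColax.additive
    obtain ⟨h₁, h₂, h₃, h₄, h₅⟩ := (isMorphismVia_iff _ _ _ _ _).1 h
    refine ⟨ColaxHom₂.mk (F := F ≫ Y.tangent₂) (G := X.tangent₂ ≫ F) law₂
      (ColaxHom.law₂_comm F hf), (isMorphismVia_iff X.comultObj Y.comultObj _ _ _).2
      ⟨Tangentad.hom₂_ext h₁, Tangentad.hom₂_ext h₂, Tangentad.hom₂_ext h₃,
        Tangentad.hom₂_ext h₄, Tangentad.hom₂_ext h₅⟩, Tangentad.hom₂_ext ?_⟩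
    have e := X.flip₂_comultObj_hom
    have e' := Y.flip₂_comultObj_hom
    exact (congrArg (fun t => stackLaw law₂ F.law ≫ t ▷ F.mor) e).trans
      (hf.trans (congrArg (fun t => F.mor ◁ t ≫ stackLaw F.law law₂) e'.symm))
  lift := Tangentad.hom₂_ext F.isColax.lift
  flip := Tangentad.hom₂_ext F.isColax.flip

/-- The image of a colax tangent morphism `F` under the comultiplication. -/
noncomputable def ColaxHom.comult {X Y : Tangentad K} (F : X ⟶ Y) :
    X.comultObj ⟶ Y.comultObj :=
  ColaxHom.mk F (ColaxHom.lawHom F) (ColaxHom.isColaxLaw_lawHom F)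

/-- The comultiplication `2`-functor `Δ_co`. -/
noncomputable def tngComult (K : Type u) [Bicategory.{w, v} K] :
    StrictPseudofunctor (Tangentad K) (Tangentad (Tangentad K)) :=
  .mk'
  { obj := Tangentad.comultObj
    map := ColaxHom.comult
    map₂ {_ _ F G} φ := ColaxHom₂.mk (F := ColaxHom.comult F) (G := ColaxHom.comult G) φ
      (Tangentad.hom₂_ext φ.comm)
    map₂_id _ := rfl
    map₂_comp _ _ := rfl
    map_id _ := rfl
    map_comp _ _ := rfl
    map₂_whisker_left _ _ _ _ := Tangentad.hom₂_ext (Tangentad.hom₂_ext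
      ((Category.id_comp _).trans (Category.comp_id _)).symm)
    map₂_whisker_right _ _ := Tangentad.hom₂_ext (Tangentad.hom₂_ext
      ((Category.id_comp _).trans (Category.comp_id _)).symm)
    map₂_left_unitor _ := Tangentad.hom₂_ext (Tangentad.hom₂_ext
      (Category.id_comp _).symm)
    map₂_right_unitor _ := Tangentad.hom₂_ext (Tangentad.hom₂_ext
      (Category.id_comp _).symm)
    map₂_associator _ _ _ := Tangentad.hom₂_ext (Tangentad.hom₂_ext
      ((Category.id_comp _).trans (Category.comp_id _)).symm) }

theorem Tangentad.map_forget_comultData (X : Tangentad K) :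
    X.comultData.map (forget K) = X.toTangentData := by
  change TangentData.mk X.base X.T X.T₂ X.π₁ X.π₂ (X.p ≫ 𝟙 _) (𝟙 _ ≫ X.z) X.s (X.l ≫ 𝟙 _)
    (𝟙 _ ≫ X.c ≫ 𝟙 _) = _
  rw [Category.comp_id, Category.id_comp, Category.comp_id, Category.id_comp, Category.comp_id]

theorem isTngComult_tngComult : IsTngComult (tngComult K) where
  obj_base _ := rfl
  obj_T _ := rfl
  obj_data X := X.map_forget_comultData
  map_mor _ := rfl
  map_law _ := rfl
  map₂ _ := rfl

/-- The `2`-morphisms underlying the image square are the original ones, so reflection along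
`Tng_co(Tng_co(K)) ⟶ Tng_co(K)` is enough. -/
theorem preservesPointwisePullbacks_tngComult : PreservesPointwisePullbacks (tngComult K) :=
  fun h => Tangentad.isPointwisePullback_of_hom h

theorem preservesPointwisePullbacks_forget : PreservesPointwisePullbacks (Tangentad.forget K) :=
  fun h => Tangentad.isPointwisePullback_hom h

end Comult

/-! ### Extensionality for tangentads, cells and 2-functors -/

section Ext

variable {K : Type u} [Bicategory.{w, v} K]

theorem Tangentad.eq_of_toTangentData {X Y : Tangentad K}
    (h : X.toTangentData = Y.toTangentData) : X = Y := by
  obtain ⟨X, hX⟩ := X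
  obtain ⟨Y, hY⟩ := Y
  obtain rfl : X = Y := h
  rfl

/-- Heterogeneous because the two sides of a strict law have sources and targets that are equal
without being definitionally so. -/
theorem ColaxHom.heq_of_eq {X Y X' Y' : Tangentad K} {F : X ⟶ Y} {G : X' ⟶ Y'}
    (hX : X = X') (hY : Y = Y') (hm : HEq (ColaxHom.mor F) (ColaxHom.mor G))
    (hl : HEq (ColaxHom.law F) (ColaxHom.law G)) : HEq F G := by
  subst hX hY
  obtain ⟨F, σ, hF⟩ := F
  obtain ⟨G, τ, hG⟩ := G
  obtain rfl : F = G := eq_of_heq hm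
  obtain rfl : σ = τ := eq_of_heq hl
  rfl

theorem oneCell_injective {X Y : Tangentad K} {F G : X ⟶ Y} (h : oneCell F = oneCell G) :
    F = G := by
  simp only [oneCell, OneCellData.mk.injEq, heq_eq_eq, true_and] at h
  exact ColaxHom.ext h.1 h.2

theorem twoCell_injective {X Y : Tangentad K} {F G : X ⟶ Y} {φ ψ : F ⟶ G}
    (h : twoCell φ = twoCell ψ) : φ = ψ := by
  simp only [twoCell, TwoCellData.mk.injEq, heq_eq_eq, true_and] at h
  exact Tangentad.hom₂_ext h

/-- Strict `2`-functors into `Tng_co(K)` with the same action on the data of cells are equal. -/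
theorem prelaxFunctor_tangentad_ext {B : Type u'} [Bicategory.{w', v'} B]
    {F G : PrelaxFunctor B (Tangentad K)} (h₀ : ∀ X, F.obj X = G.obj X)
    (h₁ : ∀ {X Y : B} (f : X ⟶ Y), HEq (F.map f) (G.map f))
    (h₂ : ∀ {X Y : B} {f g : X ⟶ Y} (η : f ⟶ g), twoCell (F.map₂ η) = twoCell (G.map₂ η)) :
    F = G := by
  obtain ⟨⟨⟨Fo, Fm⟩, Fn⟩, _, _⟩ := F
  obtain ⟨⟨⟨Go, Gm⟩, Gn⟩, _, _⟩ := G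
  obtain rfl : Fo = Go := funext h₀
  obtain rfl : @Fm = @Gm := by
    funext X Y f
    exact eq_of_heq (h₁ f)
  obtain rfl : @Fn = @Gn := by
    funext X Y f g η
    exact twoCell_injective (h₂ η)
  rfl

/-- Comparing cells together with their boundaries in `K` keeps the entries independent: a
propositional difference in the law on `T₂` does not obstruct the comparison of `π₁`, `π₂` or `s`.
-/
theorem tangentData_tangentad_ext {A B : TangentData (Tangentad K)} (hb : A.base = B.base)
    (hT : oneCell A.T = oneCell B.T) (hT₂ : oneCell A.T₂ = oneCell B.T₂)
    (hπ₁ : twoCell A.π₁ = twoCell B.π₁) (hπ₂ : twoCell A.π₂ = twoCell B.π₂)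
    (hp : twoCell A.p = twoCell B.p) (hz : twoCell A.z = twoCell B.z)
    (hs : twoCell A.s = twoCell B.s) (hl : twoCell A.l = twoCell B.l)
    (hc : twoCell A.c = twoCell B.c) : A = B := by
  obtain ⟨X, T, T₂, π₁, π₂, p, z, s, l, c⟩ := A
  obtain ⟨X', T', T₂', π₁', π₂', p', z', s', l', c'⟩ := B
  obtain rfl : X = X' := hb
  obtain rfl : T = T' := oneCell_injective hT
  obtain rfl : T₂ = T₂' := oneCell_injective hT₂
  obtain rfl : π₁ = π₁' := twoCell_injective hπ₁
  obtain rfl : π₂ = π₂' := twoCell_injective hπ₂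
  obtain rfl : p = p' := twoCell_injective hp
  obtain rfl : z = z' := twoCell_injective hz
  obtain rfl : s = s' := twoCell_injective hs
  obtain rfl : l = l' := twoCell_injective hl
  obtain rfl : c = c' := twoCell_injective hc
  rfl

end Ext

/-! ### Functoriality of Γ ↦ Tng_co(Γ) -/

section Functoriality

variable {K : Type u} [Bicategory.{w, v} K] {L : Type u'} [Bicategory.{w', v'} L]
  {M : Type u''} [Bicategory.{w'', v''} M]

theorem TangentData.map_id (X : TangentData K) : X.map (.id K) = X := by
  change TangentData.mk X.base X.T X.T₂ X.π₁ X.π₂ (X.p ≫ 𝟙 _) (𝟙 _ ≫ X.z) X.s (X.l ≫ 𝟙 _)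
    (𝟙 _ ≫ X.c ≫ 𝟙 _) = _
  rw [Category.comp_id, Category.id_comp, Category.comp_id, Category.id_comp, Category.comp_id]

theorem mapLaw_id {X Y : K} {F : X ⟶ Y} {T : X ⟶ X} {T' : Y ⟶ Y} (σ : F ≫ T' ⟶ T ≫ F) :
    mapLaw (.id K) σ = σ :=
  (Category.id_comp _).trans (Category.comp_id _)

theorem mapLaw_comp (Γ : StrictPseudofunctor K L) (Λ : StrictPseudofunctor L M)
    {X Y : K} {F : X ⟶ Y} {T : X ⟶ X} {T' : Y ⟶ Y} (σ : F ≫ T' ⟶ T ≫ F) :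
    mapLaw (Γ.comp Λ) σ = mapLaw Λ (mapLaw Γ σ) := by
  change ((Λ.mapComp _ _).inv ≫ Λ.map₂ (Γ.mapComp F T').inv) ≫ Λ.map₂ (Γ.map₂ σ) ≫
    Λ.map₂ (Γ.mapComp T F).hom ≫ (Λ.mapComp _ _).hom = _
  simp [mapLaw]

theorem TangentData.map_comp (Γ : StrictPseudofunctor K L) (Λ : StrictPseudofunctor L M)
    (X : TangentData K) : X.map (Γ.comp Λ) = (X.map Γ).map Λ := by
  have hp : Λ.map₂ (Γ.map₂ X.p) ≫ Λ.map₂ (Γ.mapId X.base).hom ≫ (Λ.mapId _).hom =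
      Λ.map₂ (Γ.map₂ X.p ≫ (Γ.mapId X.base).hom) ≫ (Λ.mapId _).hom := by simp
  have hz : ((Λ.mapId _).inv ≫ Λ.map₂ (Γ.mapId X.base).inv) ≫ Λ.map₂ (Γ.map₂ X.z) =
      (Λ.mapId _).inv ≫ Λ.map₂ ((Γ.mapId X.base).inv ≫ Γ.map₂ X.z) := by simp
  have hl : Λ.map₂ (Γ.map₂ X.l) ≫ Λ.map₂ (Γ.mapComp X.T X.T).hom ≫ (Λ.mapComp _ _).hom =
      Λ.map₂ (Γ.map₂ X.l ≫ (Γ.mapComp X.T X.T).hom) ≫ (Λ.mapComp _ _).hom := by simp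
  have hc := mapLaw_comp Γ Λ X.c
  -- Only `p`, `z`, `l` and `c` involve comparison cells; all other entries agree definitionally.
  exact congr (congr (congrFun (congr (congrArg (TangentData.mk (Λ.obj (Γ.obj X.base))
    (Λ.map (Γ.map X.T)) (Λ.map (Γ.map X.T₂)) (Λ.map₂ (Γ.map₂ X.π₁)) (Λ.map₂ (Γ.map₂ X.π₂)))
    hp) hz) (Λ.map₂ (Γ.map₂ X.s))) hl) hc

theorem Tangentad.map_comp (Γ : StrictPseudofunctor K L) (hΓ : PreservesPointwisePullbacks Γ)
    (Λ : StrictPseudofunctor L M) (hΛ : PreservesPointwisePullbacks Λ)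
    (h : PreservesPointwisePullbacks (Γ.comp Λ)) (X : Tangentad K) :
    X.map (Γ.comp Λ) h = (X.map Γ hΓ).map Λ hΛ :=
  Tangentad.eq_of_toTangentData (X.toTangentData.map_comp Γ Λ)

theorem mapLaw_law {Γ Γ' : StrictPseudofunctor K L} (φ : TwoNatTrans Γ Γ')
    (Λ : StrictPseudofunctor L M) {X : K} (F : X ⟶ X) :
    mapLaw Λ (φ.law F) = (φ.whiskerRight Λ).law F := by
  simp [mapLaw, TwoNatTrans.law, PrelaxFunctor.map₂_eqToHom,
    StrictPseudofunctor.mapComp_eq_eqToIso]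
  rfl

variable [Strict K] [Strict L] [Strict M]

theorem tngMap_id : (tngMap (.id K) fun h => h).toPrelaxFunctor =
    (StrictPseudofunctor.id (Tangentad K)).toPrelaxFunctor := by
  have h₀ (X : Tangentad K) : X.map (.id K) (fun h => h) = X :=
    Tangentad.eq_of_toTangentData X.toTangentData.map_id
  exact prelaxFunctor_tangentad_ext h₀
    (fun F => ColaxHom.heq_of_eq (h₀ _) (h₀ _) HEq.rfl (heq_of_eq (mapLaw_id _))) fun _ => rfl

theorem tngMap_comp (Γ : StrictPseudofunctor K L) (hΓ : PreservesPointwisePullbacks Γ)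
    (Λ : StrictPseudofunctor L M) (hΛ : PreservesPointwisePullbacks Λ)
    (h : PreservesPointwisePullbacks (Γ.comp Λ)) :
    (tngMap (Γ.comp Λ) h).toPrelaxFunctor =
      ((tngMap Γ hΓ).comp (tngMap Λ hΛ)).toPrelaxFunctor :=
  prelaxFunctor_tangentad_ext (Tangentad.map_comp Γ hΓ Λ hΛ h)
    (fun _ => ColaxHom.heq_of_eq (Tangentad.map_comp Γ hΓ Λ hΛ h _)
      (Tangentad.map_comp Γ hΓ Λ hΛ h _) HEq.rfl (heq_of_eq (mapLaw_comp Γ Λ _)))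
    fun _ => rfl

/-- Comparison cells of strict `2`-functors are `eqToHom`s, and the forgetful `2`-functor takes an
`eqToHom` to an `eqToHom`. The next three lemmas hold for the same reason. -/
theorem tngMap_mapId_hom (Γ : StrictPseudofunctor K L) (hΓ : PreservesPointwisePullbacks Γ)
    (X : Tangentad K) : ((tngMap Γ hΓ).mapId X).hom.hom = (Γ.mapId X.base).hom := by
  rw [StrictlyUnitaryPseudofunctor.mapId_eq_eqToIso, StrictlyUnitaryPseudofunctor.mapId_eq_eqToIso]
  exact Tangentad.eqToHom_hom ((tngMap Γ hΓ).map_id X)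

theorem tngMap_mapId_inv (Γ : StrictPseudofunctor K L) (hΓ : PreservesPointwisePullbacks Γ)
    (X : Tangentad K) : ((tngMap Γ hΓ).mapId X).inv.hom = (Γ.mapId X.base).inv := by
  rw [StrictlyUnitaryPseudofunctor.mapId_eq_eqToIso, StrictlyUnitaryPseudofunctor.mapId_eq_eqToIso]
  exact Tangentad.eqToHom_hom ((tngMap Γ hΓ).map_id X).symm

theorem tngMap_mapComp_hom (Γ : StrictPseudofunctor K L) (hΓ : PreservesPointwisePullbacks Γ)
    {X Y Z : Tangentad K} (F : X ⟶ Y) (G : Y ⟶ Z) :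
    ((tngMap Γ hΓ).mapComp F G).hom.hom = (Γ.mapComp F.mor G.mor).hom := by
  rw [StrictPseudofunctor.mapComp_eq_eqToIso, StrictPseudofunctor.mapComp_eq_eqToIso]
  exact Tangentad.eqToHom_hom ((tngMap Γ hΓ).map_comp F G)

theorem tngMap_mapComp_inv (Γ : StrictPseudofunctor K L) (hΓ : PreservesPointwisePullbacks Γ)
    {X Y Z : Tangentad K} (F : X ⟶ Y) (G : Y ⟶ Z) :
    ((tngMap Γ hΓ).mapComp F G).inv.hom = (Γ.mapComp F.mor G.mor).inv := by
  rw [StrictPseudofunctor.mapComp_eq_eqToIso, StrictPseudofunctor.mapComp_eq_eqToIso]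
  exact Tangentad.eqToHom_hom ((tngMap Γ hΓ).map_comp F G).symm

theorem mapLaw_tngMap_hom (Γ : StrictPseudofunctor K L) (hΓ : PreservesPointwisePullbacks Γ)
    {X Y : Tangentad K} {F : X ⟶ Y} {T : X ⟶ X} {T' : Y ⟶ Y} (σ : F ≫ T' ⟶ T ≫ F) :
    (mapLaw (tngMap Γ hΓ) σ).hom =
      mapLaw Γ (f := F.mor) (g := T'.mor) (h := T.mor) (k := F.mor) σ.hom := by
  change ((tngMap Γ hΓ).mapComp F T').inv.hom ≫ Γ.map₂ σ.hom ≫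
    ((tngMap Γ hΓ).mapComp T F).hom.hom = _
  rw [tngMap_mapComp_hom, tngMap_mapComp_inv]
  rfl

end Functoriality

/-! ### Naturality of the comultiplication and the comonad laws -/

section ComultNaturality

variable {K : Type u} [Bicategory.{w, v} K] {L : Type u'} [Bicategory.{w', v'} L]

theorem Tangentad.map_forget_comultObj (X : Tangentad K) :
    X.comultObj.map (forget K) preservesPointwisePullbacks_forget = X :=
  Tangentad.eq_of_toTangentData X.map_forget_comultData

/-- Coassociativity on objects. The law on `T₂` is the induced flip of `Tng_co(K)` on one side and
that of `K` on the other, and these agree by their projections; `p`, `z`, `l`, `c` differ by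
identity comparison cells. -/
theorem Tangentad.comultObj_comultObj (X : Tangentad K) :
    X.comultObj.comultObj = X.comultObj.map (tngComult K) preservesPointwisePullbacks_tngComult := by
  refine Tangentad.eq_of_toTangentData (tangentData_tangentad_ext rfl rfl ?_ rfl rfl ?_ ?_ rfl ?_ ?_)
  · exact congrArg (OneCellData.mk X.comultData X.comultData X.tangent₂)
      (Tangentad.hom₂_ext X.flip₂_comultObj_hom)
  · exact congrArg TwoCellData.mk (Category.comp_id X.comultData.p).symm
  · exact congrArg TwoCellData.mk (Category.id_comp X.comultData.z).symm
  · exact congrArg TwoCellData.mk (Category.comp_id X.comultData.l).symm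
  · exact congrArg TwoCellData.mk
      ((Category.id_comp _).trans (Category.comp_id X.comultData.c)).symm

variable [Strict K] [Strict L]

/-- Naturality of the comultiplication on objects. It needs that `Γ` carries `flip₂` to `flip₂`, and
that the comparison cells of `Tng_co(Γ)` lie over those of `Γ`. -/
theorem Tangentad.comultObj_map (Γ : StrictPseudofunctor K L)
    (hΓ : PreservesPointwisePullbacks Γ) (X : Tangentad K) :
    (X.map Γ hΓ).comultObj =
      X.comultObj.map (tngMap Γ hΓ) (preservesPointwisePullbacks_tngMap Γ hΓ) := by
  refine Tangentad.eq_of_toTangentData (tangentData_tangentad_ext rfl rfl ?_ rfl rfl ?_ ?_ rfl ?_ ?_)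
  · exact congrArg (OneCellData.mk (X.map Γ hΓ).toTangentData (X.map Γ hΓ).toTangentData
      (Γ.map X.T₂)) (X.flip₂_map Γ hΓ)
  · exact congrArg TwoCellData.mk (congrArg (Γ.map₂ X.p ≫ ·) (tngMap_mapId_hom Γ hΓ X).symm)
  · exact congrArg TwoCellData.mk (congrArg (· ≫ Γ.map₂ X.z) (tngMap_mapId_inv Γ hΓ X).symm)
  · exact congrArg TwoCellData.mk (congrArg (Γ.map₂ X.l ≫ ·)
      (tngMap_mapComp_hom Γ hΓ X.tangent X.tangent).symm)
  · exact congrArg TwoCellData.mk (mapLaw_tngMap_hom Γ hΓ (F := X.tangent) (T := X.tangent)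
      (T' := X.tangent) X.comultData.c).symm

theorem tngComult_naturality (Γ : StrictPseudofunctor K L)
    (hΓ : PreservesPointwisePullbacks Γ) :
    ((tngMap Γ hΓ).comp (tngComult L)).toPrelaxFunctor =
      ((tngComult K).comp
        (tngMap (tngMap Γ hΓ) (preservesPointwisePullbacks_tngMap Γ hΓ))).toPrelaxFunctor :=
  prelaxFunctor_tangentad_ext (Tangentad.comultObj_map Γ hΓ)
    (fun F => ColaxHom.heq_of_eq (Tangentad.comultObj_map Γ hΓ _)
      (Tangentad.comultObj_map Γ hΓ _) HEq.rfl
      (heq_of_eq (Tangentad.hom₂_ext (mapLaw_tngMap_hom Γ hΓ (ColaxHom.lawHom F)).symm)))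
    fun _ => rfl

theorem TwoNatTrans.comult_tngApp {Γ Γ' : StrictPseudofunctor K L} (φ : TwoNatTrans Γ Γ')
    (hΓ : PreservesPointwisePullbacks Γ) (hΓ' : PreservesPointwisePullbacks Γ')
    (X : Tangentad K) :
    HEq (ColaxHom.comult (φ.tngApp hΓ hΓ' X))
      ((φ.tng hΓ hΓ').tngApp (preservesPointwisePullbacks_tngMap Γ hΓ)
        (preservesPointwisePullbacks_tngMap Γ' hΓ') X.comultObj) :=
  ColaxHom.heq_of_eq (Tangentad.comultObj_map Γ hΓ X) (Tangentad.comultObj_map Γ' hΓ' X) HEq.rfl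
    (heq_of_eq (Tangentad.hom₂_ext (Tangentad.eqToHom_hom
      ((φ.tng hΓ hΓ').naturality X.tangent).symm).symm))

theorem tngComult_map_forget :
    ((tngComult K).comp (tngMap (Tangentad.forget K)
      preservesPointwisePullbacks_forget)).toPrelaxFunctor =
      (StrictPseudofunctor.id (Tangentad K)).toPrelaxFunctor :=
  prelaxFunctor_tangentad_ext Tangentad.map_forget_comultObj
    (fun _ => ColaxHom.heq_of_eq (Tangentad.map_forget_comultObj _)
      (Tangentad.map_forget_comultObj _) HEq.rfl
      (heq_of_eq ((Category.id_comp _).trans (Category.comp_id _)))) fun _ => rfl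

theorem tngComult_coassoc :
    ((tngComult K).comp (tngComult (Tangentad K))).toPrelaxFunctor =
      ((tngComult K).comp (tngMap (tngComult K)
        preservesPointwisePullbacks_tngComult)).toPrelaxFunctor :=
  prelaxFunctor_tangentad_ext Tangentad.comultObj_comultObj
    (fun F => ColaxHom.heq_of_eq (Tangentad.comultObj_comultObj _)
      (Tangentad.comultObj_comultObj _) HEq.rfl
      (heq_of_eq (Tangentad.hom₂_ext
        ((Category.id_comp _).trans (Category.comp_id (ColaxHom.lawHom F))).symm))) fun _ => rfl

end ComultNaturality

/-! ### Assembly of the 2-comonad -/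

section Comonad

theorem TwoCatPP.comp_eqToHom_eq {K L : TwoCatPP.{w, v, u}} {Γ Γ' Λ Λ' : K ⟶ L} (σ : Γ ⟶ Γ')
    (τ : Λ ⟶ Λ') (h₁ : Γ = Λ) (h₂ : Γ' = Λ')
    (H : ∀ X : K, HEq ((Hom₂.trans σ).app X) ((Hom₂.trans τ).app X)) :
    σ ≫ eqToHom h₂ = eqToHom h₁ ≫ τ := by
  rw [eq_conj_eqToHom σ τ h₁ h₂.symm H]
  simp

/-- The action of `Tng_co` on `1`-morphisms. -/
def TwoCatPP.tngCoMap {K L : TwoCatPP.{w, max v w, max u v w}} (Γ : K ⟶ L) :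
    TwoCatPP.tngCo.{w, v, u} K ⟶ TwoCatPP.tngCo.{w, v, u} L :=
  Hom.mk (tngMap Γ.functor Γ.preserves)
    (preservesPointwisePullbacks_tngMap Γ.functor Γ.preserves)

/-- The action of `Tng_co` on `2`-morphisms. -/
def TwoCatPP.tngCoMap₂ {K L : TwoCatPP.{w, max v w, max u v w}} {Γ Γ' : K ⟶ L} (φ : Γ ⟶ Γ') :
    TwoCatPP.tngCoMap.{w, v, u} Γ ⟶ TwoCatPP.tngCoMap.{w, v, u} Γ' :=
  Hom₂.mk (Γ := TwoCatPP.tngCoMap Γ) (Γ' := TwoCatPP.tngCoMap Γ')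
    ((Hom₂.trans φ).tng Γ.preserves Γ'.preserves)

theorem TwoNatTrans.id_law {K : Type u} [Bicategory.{w, v} K] {L : Type u'} [Bicategory.{w', v'} L]
    [Strict L] (Γ : StrictPseudofunctor K L) {X : K} (F : X ⟶ X) :
    (TwoNatTrans.id Γ).law F = idLaw (Γ.map F) := by
  simp [TwoNatTrans.law, idLaw, Strict.leftUnitor_eqToIso, Strict.rightUnitor_eqToIso]
  rfl

theorem TwoNatTrans.vcomp_law {K : Type u} [Bicategory.{w, v} K] {L : Type u'}
    [Bicategory.{w', v'} L] [Strict L] {Γ Γ' Γ'' : StrictPseudofunctor K L}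
    (σ : TwoNatTrans Γ Γ') (τ : TwoNatTrans Γ' Γ'') {X : K} (F : X ⟶ X) :
    (σ.vcomp τ).law F = compLaw (σ.law F) (τ.law F) := by
  simp [TwoNatTrans.law, compLaw, Strict.associator_eqToIso]
  rfl

/-- The `2`-endofunctor `Tng_co` of `TwoCat_pp`. -/
def tngCoEndofunctor : TwoEndofunctorOn TwoCatPP.tngCo.{w, v, u} where
  map := TwoCatPP.tngCoMap
  map₂ := TwoCatPP.tngCoMap₂
  map₂_id Γ := TwoCatPP.hom₂_ext fun X =>
    ColaxHom.ext rfl (heq_of_eq (TwoNatTrans.id_law (TwoCatPP.Hom.functor Γ) (TangentData.T X.toTangentData)))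
  map₂_comp σ τ := TwoCatPP.hom₂_ext fun X =>
    ColaxHom.ext rfl (heq_of_eq (TwoNatTrans.vcomp_law (TwoCatPP.Hom₂.trans σ) (TwoCatPP.Hom₂.trans τ) (TangentData.T X.toTangentData)))
  map_id _ := TwoCatPP.hom_ext tngMap_id
  map_comp Γ Λ := TwoCatPP.hom_ext
    (tngMap_comp Γ.functor Γ.preserves Λ.functor Λ.preserves (Γ ≫ Λ).preserves)
  map₂_whisker_left {_ _ _} Γ {Λ Λ'} _ := TwoCatPP.eq_conj_eqToHom _ _ _ _ fun X =>
    ColaxHom.heq_of_eq (Tangentad.map_comp Γ.functor Γ.preserves Λ.functor Λ.preserves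
      (Γ ≫ Λ).preserves X) (Tangentad.map_comp Γ.functor Γ.preserves Λ'.functor Λ'.preserves
      (Γ ≫ Λ').preserves X) HEq.rfl HEq.rfl
  map₂_whisker_right {_ _ _ Γ Γ'} η Λ := TwoCatPP.eq_conj_eqToHom _ _ _ _ fun X =>
    ColaxHom.heq_of_eq (Tangentad.map_comp Γ.functor Γ.preserves Λ.functor Λ.preserves
      (Γ ≫ Λ).preserves X) (Tangentad.map_comp Γ'.functor Γ'.preserves Λ.functor Λ.preserves
      (Γ' ≫ Λ).preserves X) HEq.rfl (heq_of_eq (mapLaw_law η.trans Λ.functor X.T).symm)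

/-- The counit of `Tng_co` at `K`. -/
def TwoCatPP.tngCoCounit (K : TwoCatPP.{w, max v w, max u v w}) :
    TwoCatPP.tngCo.{w, v, u} K ⟶ K :=
  Hom.mk (Tangentad.forget K) preservesPointwisePullbacks_forget

/-- The comultiplication of `Tng_co` at `K`. -/
noncomputable def TwoCatPP.tngCoComult (K : TwoCatPP.{w, max v w, max u v w}) :
    TwoCatPP.tngCo.{w, v, u} K ⟶ TwoCatPP.tngCo.{w, v, u} (TwoCatPP.tngCo.{w, v, u} K) :=
  Hom.mk (tngComult K) preservesPointwisePullbacks_tngComult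

/-- The `2`-comonad `Tng_co` on `TwoCat_pp`. -/
noncomputable def tngCoComonad : TwoComonadOn TwoCatPP.tngCo.{w, v, u} where
  toTwoEndofunctorOn := tngCoEndofunctor
  counit :=
    { app := TwoCatPP.tngCoCounit.{w, v, u}
      naturality := fun _ => TwoCatPP.hom_ext rfl
      naturality₂ := fun _ => TwoCatPP.comp_eqToHom_eq _ _ _ _ fun _ => HEq.rfl }
  comult :=
    { app := TwoCatPP.tngCoComult.{w, v, u}
      naturality := fun Γ => TwoCatPP.hom_ext (tngComult_naturality Γ.functor Γ.preserves)
      naturality₂ := fun {_ _ Γ Γ'} η => TwoCatPP.comp_eqToHom_eq _ _ _ _ fun X =>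
        TwoNatTrans.comult_tngApp η.trans Γ.preserves Γ'.preserves X }
  -- The base of `comultObj` is the original tangentad, so this counit law holds definitionally on
  -- cells; the other one has to remove identity comparison cells.
  comult_counit _ := TwoCatPP.hom_ext rfl
  comult_map_counit _ := TwoCatPP.hom_ext tngComult_map_forget
  coassoc _ := TwoCatPP.hom_ext tngComult_coassoc

end Comonad

end FormalTangent

theorem mainTheorem1 :
    ∃ 𝕋 : FormalTangent.TwoComonadOn FormalTangent.TwoCatPP.tngCo.{w, v, u},
      (∀ {K L : FormalTangent.TwoCatPP.{w, max v w, max u v w}} (Γ : K ⟶ L),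
        FormalTangent.IsTngMap Γ.functor (𝕋.map Γ).functor) ∧
      (∀ {K L : FormalTangent.TwoCatPP.{w, max v w, max u v w}} {Γ Γ' : K ⟶ L} (φ : Γ ⟶ Γ'),
        FormalTangent.IsTngMap₂ φ.trans (𝕋.map₂ φ).trans) ∧
      (∀ K : FormalTangent.TwoCatPP.{w, max v w, max u v w},
        (𝕋.counitAt K).functor = FormalTangent.Tangentad.forget K) ∧
      (∀ K : FormalTangent.TwoCatPP.{w, max v w, max u v w},
        FormalTangent.IsTngComult (𝕋.comultAt K).functor) := by
  exact ⟨FormalTangent.tngCoComonad,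
    fun Γ => FormalTangent.isTngMap_tngMap Γ.functor Γ.preserves,
    fun {_ _ Γ Γ'} φ => FormalTangent.TwoNatTrans.isTngMap₂_tng φ.trans Γ.preserves Γ'.preserves,
    fun _ => rfl, fun _ => FormalTangent.isTngComult_tngComult⟩
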